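/- **Coverage probability, finite zooming parameter.** Let $0<\alpha\le 2$, $\sigma\ge 0$, $\mu\in\mathbb R$, and let $\mathbb S(\alpha,\sigma,\mu)$ be the stable law with skewness $\beta=1$, i.e. with characteristic function $$\exp\{-\sigma^\alpha|\omega|^\alpha(1-j\,\mathrm{sgn}(\omega)\tan\tfrac{\pi\alpha}{2})+j\mu\omega\}\ (\alpha\ne1),\qquad \exp\{-\sigma|\omega|(1+j\tfrac{2}{\pi}\mathrm{sgn}(\omega)\ln|\omega|)+j\mu\omega\}\ (\alpha=1).$$ Let $R>0$, $a>1$, $0\le H<1$, $\delta\ge 2$, $\zeta>0$, $T>0$, $N_0\ge 0$, and let $\nu$ be a probability law on $[0,\infty)$ (for Rayleigh fading, an exponential law). *Model.* The base stations (BSs) form a doubly stochastic Poisson point process in the plane. Given random densities $\lambda,\lambda_S\ge 0$, it is a Poisson process of density $\lambda$ in the disc $\Delta=\{|x|<R\}$ and of density $\lambda_S$ in the annulus $\Delta_S=\{R\le|x|<aR\}$, without points elsewhere. Here $\lambda\sim\mathbb S(\alpha,\sigma,\mu)$, and $\lambda_S$ is independent of $\lambda$ with the same distribution as $a^{H-2}\lambda$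 (self-similarity). The user is at the origin and is served by the nearest BS $b_0$, at distance $r$, which is assumed to lie in $\Delta$ (i.e. $r<R$); it is not covered if $\Delta$ contains no BS. The serving link has fading $h\sim\exp(\zeta)$ (rate $\zeta$), the interfering links have i.i.d. fadings $g_i\sim\nu$, and $h$, $(g_i)$ and the point process with its densities are independent. With $I_r=\sum_{i\neq b_0}g_i\hat R_i^{-\delta}$, where $\hat R_i$ is the distance of BS $i$, put $$p_c=\mathbb P\Big(\Delta\text{ contains a BS and }\frac{h r^{-\delta}}{N_0+I_r}>T\Big)$$ (a positive signal over zero noise and interference has SINR $\infty$). *Extension to densities of either sign.* For $\alpha\ge1$ and $\sigma>0$ the stable law charges negative densities (as it does for $\alpha<1$ when $\mu<0$). For $l,l_S\in\mathbb R$ put $$c(l,l_S)=\sum_{n,m\ge0}e^{-l|\Delta|}\frac{(l|\Delta|)^n}{n!}\,e^{-l_S|\Delta_S|}\frac{(l_S|\Delta_S|)^m}{m!}\,q(n,m),$$ where $|\cdot|$ is area and $q(n,m)$ is the probability of coverage for $n$ independent uniform BSs in $\Delta$ and $m$ in $\Delta_S$, with the same fading. In general define $p_c=\mathbb E\,c(\lambda,\lambda_S)$,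 with $\lambda,\lambda_S$ distributed as above. *Claim.* The series for $c$ and the expectation $\mathbb E\,c(\lambda,\lambda_S)$ converge absolutely, and whenever the model above is realized on a probability space (so that $\lambda,\lambda_S\ge0$), its coverage probability equals $\mathbb E\,c(\lambda,\lambda_S)$. Moreover, put $\Gamma(d,x)=\int_x^\infty t^{d-1}e^{-t}\,dt$, $\Xi(s,b,c)=\pi\,\mathbb E_{g\sim\nu}[\Lambda(s,b,c)-\Theta(s,b,c)]$, $$\Lambda(s,b,c)=c^2\big[1-e^{-sgc^{-\delta}}\big]-b^2\big[1-e^{-sgb^{-\delta}}\big],$$ $$\Theta(s,b,c)=(sg)^{2/\delta}\big(\Gamma(1-\tfrac2\delta,sgb^{-\delta})-\Gamma(1-\tfrac2\delta,sgc^{-\delta})\big),$$ and abbreviate $\Xi_1=\Xi(\zeta Tr^\delta,r,R)$, $\Xi_2=\Xi(\zeta Tr^\delta,R,aR)$. Then the following integrals converge absolutely and: 1) if $\alpha\ne1$, $$p_c=\int_0^R 2\pi r\exp\Big\{-\frac{\sigma^\alpha a^{\alpha(H-2)}}{\cos\frac{\pi\alpha}2}\Xi_2^\alpha-a^{H-2}\mu\,\Xi_2-\mu\,\Xi_1-\frac{\sigma^\alpha}{\cos\frac{\pi\alpha}2}(\Xi_1+\pi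 r^2)^\alpha-\mu\pi r^2-\zeta Tr^\delta N_0\Big\}\Big[\frac{\sigma^\alpha\alpha}{\cos\frac{\pi\alpha}2}(\Xi_1+\pi r^2)^{\alpha-1}+\mu\Big]dr;$$ 2) if $\alpha=1$ (with $0\ln 0=0$), $$p_c=\int_0^R 2\pi r\exp\Big\{\Big[\frac{2\sigma a^{H-2}}\pi\big(\ln\Xi_2+(H-2)\ln a\big)-a^{H-2}\mu\Big]\Xi_2+\frac{2\sigma\Xi_1+2\sigma\pi r^2}{\pi}\ln(\Xi_1+\pi r^2)-\mu\,\Xi_1-\mu\pi r^2-\zeta Tr^\delta N_0\Big\}\Big[-\frac{2\sigma}\pi\big(\ln(\Xi_1+\pi r^2)+1\big)+\mu\Big]dr.$$ -/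

import Mathlib

open MeasureTheory ProbabilityTheory Set
open scoped ENNReal Nat

noncomputable section

/-- The Euclidean plane; the user equipment sits at the origin. -/
abbrev Plane : Type := EuclideanSpace ℝ (Fin 2)

/-- The inner disc of radius `R`. -/
def innerDisc (R : ℝ) : Set Plane := {x | ‖x‖ < R}

/-- The outer region: the annulus between the radii `R` and `a * R`. -/
def outerAnnulus (R a : ℝ) : Set Plane := {x | R ≤ ‖x‖ ∧ ‖x‖ < a * R}

/-- `ρ` is the stable law with stability `α`, skewness `β`, scale `σ` and shift `μ`,
given by its characteristic function. -/
structure IsStableLaw (α β σ μ : ℝ) (ρ : Measure ℝ) : Prop where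
  isProbabilityMeasure : IsProbabilityMeasure ρ
  charFun_eq : ∀ ω : ℝ, charFun ρ ω =
    if α = 1 then
      Complex.exp (-((σ * |ω| : ℝ) : ℂ)
          * (1 + Complex.I * ((2 * β / Real.pi * Real.sign ω * Real.log |ω| : ℝ) : ℂ))
        + Complex.I * ((μ * ω : ℝ) : ℂ))
    else
      Complex.exp (-((σ ^ α * |ω| ^ α : ℝ) : ℂ)
          * (1 - Complex.I * ((β * Real.sign ω * Real.tan (Real.pi * α / 2) : ℝ) : ℂ))
        + Complex.I * ((μ * ω : ℝ) : ℂ))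

/-! ### The functions in the coverage formula -/

/-- The (upper) incomplete Gamma function. -/
def upperGamma (d x : ℝ) : ℝ := ∫ t in Ioi x, t ^ (d - 1) * Real.exp (-t)

def bsTheta (δ s b c g : ℝ) : ℝ :=
  (s * g) ^ (2 / δ) *
    (upperGamma (-(2 / δ) + 1) (s * g * b ^ (-δ)) - upperGamma (-(2 / δ) + 1) (s * g * c ^ (-δ)))

def bsLambda (δ s b c g : ℝ) : ℝ :=
  c ^ 2 * (1 - Real.exp (-(s * g * c ^ (-δ)))) - b ^ 2 * (1 - Real.exp (-(s * g * b ^ (-δ))))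

/-- `Ξ(s, b, c) = π 𝔼_g (Λ(s, b, c) - Θ(s, b, c))`, the interfering fading `g` having law `ν`. -/
def bsXi (ν : Measure ℝ) (δ s b c : ℝ) : ℝ :=
  Real.pi * ∫ g, (bsLambda δ s b c g - bsTheta δ s b c g) ∂ν

/-- The integrand of the coverage formula for `α ≠ 1`. -/
def coverageIntegrand (α σ μ a H R δ ζ T N₀ : ℝ) (ν : Measure ℝ) (r : ℝ) : ℝ :=
  let Ξi := bsXi ν δ (ζ * T * r ^ δ) r R
  let Ξo := bsXi ν δ (ζ * T * r ^ δ) R (a * R)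
  2 * Real.pi * r *
    Real.exp (-(σ ^ α * a ^ (α * (H - 2)) / Real.cos (Real.pi * α / 2)) * Ξo ^ α
      - a ^ (H - 2) * μ * Ξo - μ * Ξi
      - σ ^ α / Real.cos (Real.pi * α / 2) * (Ξi + Real.pi * r ^ 2) ^ α
      - μ * Real.pi * r ^ 2 - ζ * T * r ^ δ * N₀) *
    (σ ^ α * α / Real.cos (Real.pi * α / 2) * (Ξi + Real.pi * r ^ 2) ^ (α - 1) + μ)

/-- The integrand of the coverage formula for `α = 1`. -/
def coverageIntegrandOne (σ μ a H R δ ζ T N₀ : ℝ) (ν : Measure ℝ) (r : ℝ) : ℝ :=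
  let Ξi := bsXi ν δ (ζ * T * r ^ δ) r R
  let Ξo := bsXi ν δ (ζ * T * r ^ δ) R (a * R)
  2 * Real.pi * r *
    Real.exp ((2 * σ * a ^ (H - 2) / Real.pi * (Real.log Ξo + (H - 2) * Real.log a)
        - a ^ (H - 2) * μ) * Ξo
      + (2 * σ * Ξi + 2 * σ * Real.pi * r ^ 2) / Real.pi * Real.log (Ξi + Real.pi * r ^ 2)
      - μ * Ξi - μ * Real.pi * r ^ 2 - ζ * T * r ^ δ * N₀) *
    (-(2 * σ / Real.pi) * (Real.log (Ξi + Real.pi * r ^ 2) + 1) + μ)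

/-! ### The SINR -/

/-- The interference at the origin from all base stations but the `i`-th one. -/
def interference {ι : Type*} [Fintype ι] (δ : ℝ) (x : ι → Plane) (g : ι → ℝ) (i : ι) : ℝ :=
  open Classical in ∑ j ∈ Finset.univ.erase i, g j * ‖x j‖ ^ (-δ)

/-- The SINR at the origin when served by the `i`-th base station over a link with fading `h`.
The quotient is taken in `[0, ∞]`: a positive signal without noise and interference has
SINR `∞`. -/
def sinr {ι : Type*} [Fintype ι] (δ N₀ : ℝ) (x : ι → Plane) (g : ι → ℝ) (h : ℝ) (i : ι) : ℝ≥0∞ :=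
  ENNReal.ofReal (h * ‖x i‖ ^ (-δ)) / ENNReal.ofReal (N₀ + interference δ x g i)

/-- The user is covered: the nearest base station, which serves it, exists and lies in the inner
disc, and the SINR exceeds the threshold `T`. -/
def Covered {ι : Type*} [Fintype ι] (R δ N₀ T : ℝ) (x : ι → Plane) (g : ι → ℝ) (h : ℝ) : Prop :=
  ∃ i, x i ∈ innerDisc R ∧ (∀ j, ‖x i‖ ≤ ‖x j‖) ∧ ENNReal.ofReal T < sinr δ N₀ x g h i

/-! ### The doubly stochastic Poisson network -/

/-- The Poisson weight `e^{-t} t^n / n!`; for `t ≥ 0` the probability of `n` under the Poisson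
law with mean `t`. -/
def poissonWeight (t : ℝ) (n : ℕ) : ℝ := Real.exp (-t) * t ^ n / (n ! : ℝ)

/-- The number of base stations in `B`, for a network with `k` stations at `x 0, …, x (k - 1)`. -/
def stationCount (k : ℕ) (x : ℕ → Plane) (B : Set Plane) : ℕ :=
  open Classical in ((Finset.range k).filter (fun i => x i ∈ B)).card

/-- A network on the probability space `(Ω, P)`. The `K` base stations at `X 0, …, X (K - 1)` form
a doubly stochastic Poisson point process with random density `lam` in the inner disc and `lamS`
in the annulus; `lam` has law `ρ`, `lamS` is independent of `lam` and distributed like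
`a ^ (H - 2) * lam`; the interfering links have i.i.d. fadings `g i` with law `ν`, and the serving
link has an independent exponential fading `h` with rate `ζ`. -/
structure IsStableNetwork {Ω : Type*} [MeasurableSpace Ω] (P : Measure Ω)
    (ρ ν : Measure ℝ) (a H R ζ : ℝ) (lam lamS : Ω → ℝ) (K : Ω → ℕ) (X : ℕ → Ω → Plane)
    (g : ℕ → Ω → ℝ) (h : Ω → ℝ) : Prop where
  measurable_lam : Measurable lam
  measurable_lamS : Measurable lamS
  measurable_K : Measurable K
  measurable_X : ∀ i, Measurable (X i)
  measurable_g : ∀ i, Measurable (g i)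
  measurable_h : Measurable h
  lam_nonneg : ∀ᵐ ω ∂P, 0 ≤ lam ω
  lamS_nonneg : ∀ᵐ ω ∂P, 0 ≤ lamS ω
  law_lam : P.map lam = ρ
  law_lamS : P.map lamS = P.map (fun ω => a ^ (H - 2) * lam ω)
  indep_lam_lamS : IndepFun lam lamS P
  /-- Given the densities, the numbers of stations in disjoint sets are independent and Poisson. -/
  poisson : ∀ (k : ℕ) (B : Fin k → Set Plane), (∀ i, MeasurableSet (B i)) →
    Pairwise (Function.onFun Disjoint B) → ∀ n : Fin k → ℕ,
    P⟦{ω | ∀ i, stationCount (K ω) (fun j => X j ω) (B i) = n i} |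
        MeasurableSpace.comap (fun ω => (lam ω, lamS ω)) inferInstance⟧
      =ᵐ[P] fun ω => ∏ i, poissonWeight
        (lam ω * volume.real (B i ∩ innerDisc R)
          + lamS ω * volume.real (B i ∩ outerAnnulus R a)) (n i)
  law_g : ∀ i, P.map (g i) = ν
  law_h : P.map h = expMeasure ζ
  indep_g : iIndepFun g P
  indep_g_h : IndepFun (fun ω i => g i ω) h P
  indep_fading : IndepFun (fun ω => (lam ω, lamS ω, K ω, fun i => X i ω))
    (fun ω => (fun i => g i ω, h ω)) P

/-! ### The coverage probability as a mixture over the densities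

Given `n` stations in the inner disc and `m` in the annulus, the stations of a Poisson process of
constant densities are independent and uniform. The weights `poissonWeight` make sense for a
density of either sign, and so does the mixture. -/

/-- The coverage probability for `n` independent uniform stations in the inner disc and `m`
in the annulus. -/
def fixedCountCoverage (a R δ ζ T N₀ : ℝ) (ν : Measure ℝ) (n m : ℕ) : ℝ :=
  ((Measure.pi (fun i : Fin n ⊕ Fin m =>
      Sum.elim (fun _ => ProbabilityTheory.cond (volume : Measure Plane) (innerDisc R))
        (fun _ => ProbabilityTheory.cond (volume : Measure Plane) (outerAnnulus R a)) i)).prod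
    ((Measure.pi (fun _ : Fin n ⊕ Fin m => ν)).prod (expMeasure ζ))).real
    {p | Covered R δ N₀ T p.1 p.2.1 p.2.2}

/-- The contribution of `k.1` stations in the inner disc and `k.2` stations in the annulus, for
the densities `l` and `lS`. -/
def coverageTerm (a R δ ζ T N₀ : ℝ) (ν : Measure ℝ) (l lS : ℝ) (k : ℕ × ℕ) : ℝ :=
  poissonWeight (l * volume.real (innerDisc R)) k.1
    * poissonWeight (lS * volume.real (outerAnnulus R a)) k.2
    * fixedCountCoverage a R δ ζ T N₀ ν k.1 k.2

/-- The coverage probability for constant densities `l` in the inner disc and `lS` in the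
annulus. -/
def conditionalCoverage (a R δ ζ T N₀ : ℝ) (ν : Measure ℝ) (l lS : ℝ) : ℝ :=
  ∑' k : ℕ × ℕ, coverageTerm a R δ ζ T N₀ ν l lS k

/-- The joint law of the two densities: independent, the first with law `ρ`, the second
distributed like `a ^ (H - 2)` times the first. -/
def densityLaw (ρ : Measure ℝ) (a H : ℝ) : Measure (ℝ × ℝ) :=
  ρ.prod (ρ.map (fun x => a ^ (H - 2) * x))

/-- The coverage probability averaged over the random densities. -/
def coverageProbability (ρ ν : Measure ℝ) (a H R δ ζ T N₀ : ℝ) : ℝ :=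
  ∫ p, conditionalCoverage a R δ ζ T N₀ ν p.1 p.2 ∂(densityLaw ρ a H)

end

/-!
For fixed densities `l` and `lS`, the user is served from distance `r` at the rate
`2 π r l * exp (-l π r²)`, reduced by the noise factor `exp (-ζ T r^δ N₀)` and, since the serving
fading is exponential, by one factor `𝔼 exp (-ζ T r^δ g x^(-δ))` per interferer at distance `x`.
For Poisson stations the product of these factors averages to an exponential, so that the
conditional coverage probability is
`∫ 2 π r l * exp (-(l * D₁ r) - lS * D₂ r - ζ T r^δ N₀) dr`, where `D₁ r = Ξ(ζ T r^δ, r, R) + π r²`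
and `D₂ r = Ξ(ζ T r^δ, R, aR)` are areas weighted by the probability that a station there is
harmful. The formula follows from the coverage probability for fixed numbers of uniform stations
(`fixedCountCoverage_eq`) by summing an absolutely convergent double series, which does not require
the densities to be nonnegative (`hasSum_coverageTerm`).

The expectation over the densities is computed by Fubini, from `𝔼 exp (-t λ)` and
`𝔼 λ exp (-t λ)`. The law of `λ` is known through its characteristic function only. The skewness
`1` is what makes the latter the boundary value of `exp (stableExponent α σ μ z)`, holomorphic in
the right half-plane; comparing the two through a contour shift, with a Gaussian damping that is
removed by monotone convergence, shows that `𝔼 exp (-t λ)` is finite for `t ≥ 0` and equal to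
`exp (stableExponent α σ μ t)` (`laplace_of_charFun`, `IsStableLaw.laplace`), and differentiation
gives the factor in brackets (`IsStableLaw.integral_mul_exp`). Integrability in `(λ, λ_S, r)` holds
because `∫ 2 π r |l| exp (-l π r²) dr` over `0 < r < R` is at most `1 + exp (-l π R²)`, which absorbs
the singularity at `r = 0` (`abs_radialCoverage_le`, `abs_mul_setIntegral_mul_exp_neg_sq_le`).

A network is given through the joint laws of its counts in disjoint sets, conditionally on the
densities. Its coverage probability is the expectation of a sum over stations that has at most
one nonzero term, that of the nearest station (`IsStableNetwork.coverage_eq_integral`). Rounding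
all distances up to multiples of a small mesh turns that sum into a function of finitely many
counts, whose expectation is a finite sum over thin rings; as the mesh tends to `0` it converges to
the integral above (`IsStableNetwork.integral_nearestSum`).
-/

open Filter Topology

/-! ### From a characteristic function to a Laplace transform -/

/-- A Gaussian factor centred at `t` beats any growth of order two once `k` exceeds its rate. -/
lemma norm_cexp_mul_sq_mul_le {ψ : ℂ → ℂ} {A B : ℝ}
    (hb : ∀ z : ℂ, 0 ≤ z.re → ‖ψ z‖ ≤ A * Real.exp (B * ‖z‖ ^ 2)) (hA : 0 ≤ A) (hB : 0 ≤ B)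
    {k t x y : ℝ} (hk : 0 ≤ k) (hx : 0 ≤ x) (hxt : x ≤ t) :
    ‖Complex.exp (k * ((x + y * Complex.I : ℂ) - t) ^ 2) * ψ (x + y * Complex.I)‖
      ≤ A * Real.exp ((k + B) * t ^ 2) * Real.exp (-(k - B) * y ^ 2) := by
  have h1 : ((k : ℂ) * ((x + y * Complex.I : ℂ) - t) ^ 2).re = k * ((x - t) ^ 2 - y ^ 2) := by
    simp [pow_two]
  have h2 : ‖(x + y * Complex.I : ℂ)‖ ^ 2 = x ^ 2 + y ^ 2 := by
    rw [Complex.sq_norm, Complex.normSq_add_mul_I]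
  have h3 := hb (x + y * Complex.I) (by simpa using hx)
  rw [h2] at h3
  rw [norm_mul, Complex.norm_exp, h1]
  calc _ ≤ Real.exp (k * ((x - t) ^ 2 - y ^ 2)) * (A * Real.exp (B * (x ^ 2 + y ^ 2))) := by gcongr
    _ = A * Real.exp (k * ((x - t) ^ 2 - y ^ 2) + B * (x ^ 2 + y ^ 2)) := by
      rw [Real.exp_add]; ring
    _ ≤ A * Real.exp ((k + B) * t ^ 2 + -(k - B) * y ^ 2) := by
      have : (x - t) ^ 2 ≤ t ^ 2 := by nlinarith
      have h5 : x ^ 2 ≤ t ^ 2 := by nlinarith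
      have := mul_le_mul_of_nonneg_left this hk
      have := mul_le_mul_of_nonneg_left h5 hB
      refine mul_le_mul_of_nonneg_left (Real.exp_le_exp.2 ?_) hA
      nlinarith
    _ = _ := by rw [Real.exp_add]; ring

lemma integrable_vertical_line {ψ : ℂ → ℂ} {A B : ℝ} (hc : ContinuousOn ψ {z | 0 ≤ z.re})
    (hb : ∀ z : ℂ, 0 ≤ z.re → ‖ψ z‖ ≤ A * Real.exp (B * ‖z‖ ^ 2)) (hA : 0 ≤ A) (hB : 0 ≤ B)
    {k t x : ℝ} (hk : B < k) (hx : 0 ≤ x) (hxt : x ≤ t) :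
    Integrable fun y : ℝ =>
      Complex.exp (k * ((x + y * Complex.I : ℂ) - t) ^ 2) * ψ (x + y * Complex.I) := by
  refine Integrable.mono' ((integrable_exp_neg_mul_sq (sub_pos.2 hk)).const_mul
    (A * Real.exp ((k + B) * t ^ 2))) ?_ (ae_of_all _ fun y => ?_)
  · refine Continuous.aestronglyMeasurable ?_
    exact Continuous.mul (by fun_prop)
      (hc.comp_continuous (by fun_prop) fun y => by simpa using hx)
  · exact norm_cexp_mul_sq_mul_le hb hA hB (hB.trans hk.le) hx hxt

/-- Shifting the contour of a Gaussian-damped integral from the imaginary axis to the line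
`Re z = t`. -/
lemma integral_vertical_line_shift {ψ : ℂ → ℂ} {A B : ℝ} (hc : ContinuousOn ψ {z | 0 ≤ z.re})
    (hd : DifferentiableOn ℂ ψ {z | 0 < z.re})
    (hb : ∀ z : ℂ, 0 ≤ z.re → ‖ψ z‖ ≤ A * Real.exp (B * ‖z‖ ^ 2)) (hA : 0 ≤ A) (hB : 0 ≤ B)
    {k t : ℝ} (hk : B < k) (ht : 0 ≤ t) :
    ∫ y : ℝ, Complex.exp (k * ((y * Complex.I : ℂ) - t) ^ 2) * ψ (y * Complex.I) =
      ∫ y : ℝ, Complex.exp (-k * y ^ 2) * ψ (t + y * Complex.I) := by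
  set f : ℂ → ℂ := fun z => Complex.exp (k * (z - t) ^ 2) * ψ z with hf
  have hrect : ∀ N : ℝ, 0 ≤ N → (((∫ x : ℝ in 0..t, f (x + (-N : ℝ) * Complex.I)) -
      ∫ x : ℝ in 0..t, f (x + N * Complex.I)) +
      Complex.I • ∫ y : ℝ in -N..N, f (t + y * Complex.I)) -
      Complex.I • ∫ y : ℝ in -N..N, f ((0 : ℝ) + y * Complex.I) = 0 := by
    intro N hN
    have := Complex.integral_boundary_rect_eq_zero_of_continuousOn_of_differentiableOn f
      ⟨0, -N⟩ ⟨t, N⟩ ?_ ?_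
    · simpa using this
    · refine ContinuousOn.mul (by fun_prop) (hc.mono fun z hz => ?_)
      have := (Complex.mem_reProdIm.1 hz).1
      simp only [uIcc_of_le ht] at this
      exact this.1
    · refine DifferentiableOn.mul (by fun_prop) (hd.mono fun z hz => ?_)
      have := (Complex.mem_reProdIm.1 hz).1
      simp only [min_eq_left ht] at this
      exact this.1
  have hi0 := integrable_vertical_line hc hb hA hB hk le_rfl ht
  have hit := integrable_vertical_line hc hb hA hB hk ht le_rfl
  have l0 := intervalIntegral_tendsto_integral hi0 tendsto_neg_atTop_atBot tendsto_id
  have lt := intervalIntegral_tendsto_integral hit tendsto_neg_atTop_atBot tendsto_id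
  have hG : Tendsto (fun N : ℝ => A * Real.exp ((k + B) * t ^ 2) * Real.exp (-(k - B) * N ^ 2) *
      |t - 0|) atTop (𝓝 0) := by
    have : Tendsto (fun N : ℝ => Real.exp (-(k - B) * N ^ 2)) atTop (𝓝 0) := by
      refine Real.tendsto_exp_atBot.comp ?_
      exact (tendsto_pow_atTop two_ne_zero).const_mul_atTop_of_neg (by linarith)
    simpa using (this.const_mul (A * Real.exp ((k + B) * t ^ 2))).mul_const |t - 0|
  have hh : ∀ s : ℝ, s = 1 ∨ s = -1 → Tendsto (fun N : ℝ =>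
      ∫ x : ℝ in 0..t, f (x + (s * N : ℝ) * Complex.I)) atTop (𝓝 0) := by
    intro s hs
    refine squeeze_zero_norm (fun N => ?_) hG
    refine intervalIntegral.norm_integral_le_of_norm_le_const fun x hx => ?_
    rw [uIoc_of_le ht] at hx
    have h2 : N ^ 2 = (s * N) ^ 2 := by rcases hs with rfl | rfl <;> ring
    rw [h2]
    exact norm_cexp_mul_sq_mul_le hb hA hB (hB.trans hk.le) hx.1.le hx.2
  have hlim := (((hh (-1) (Or.inr rfl)).sub (hh 1 (Or.inl rfl))).add
    (lt.const_smul Complex.I)).sub (l0.const_smul Complex.I)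
  have hz := hlim.congr' (f₂ := fun _ => (0 : ℂ)) ((eventually_ge_atTop 0).mono fun N hN => by
    have := hrect N hN
    simpa [hf] using this)
  have := tendsto_nhds_unique hz tendsto_const_nhds
  simp only [sub_zero, zero_add] at this
  rw [← smul_sub, smul_eq_zero, sub_eq_zero] at this
  have := this.resolve_left Complex.I_ne_zero
  simp only [Complex.ofReal_zero, zero_add] at this
  rw [← this]
  refine integral_congr_ae (ae_of_all _ fun y => ?_)
  simp only [add_sub_cancel_left, mul_pow, Complex.I_sq]
  ring_nf

/-- The Gaussian regularisation of the Laplace transform, as an integral along `Re z = t`. -/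
lemma integral_exp_regularised {ρ : Measure ℝ} [IsProbabilityMeasure ρ] {ψ : ℂ → ℂ} {A B : ℝ}
    (hc : ContinuousOn ψ {z | 0 ≤ z.re}) (hd : DifferentiableOn ℂ ψ {z | 0 < z.re})
    (hb : ∀ z : ℂ, 0 ≤ z.re → ‖ψ z‖ ≤ A * Real.exp (B * ‖z‖ ^ 2)) (hA : 0 ≤ A) (hB : 0 ≤ B)
    (hψ : ∀ y : ℝ, charFun ρ (-y) = ψ (y * Complex.I)) {k t : ℝ} (hk : B < k) (ht : 0 ≤ t) :
    ((Real.pi / k : ℝ) : ℂ) ^ (1 / 2 : ℂ) *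
        ∫ x, Complex.exp (-t * x - x ^ 2 / (4 * k)) ∂ρ =
      ∫ y : ℝ, Complex.exp (-k * y ^ 2) * ψ (t + y * Complex.I) := by
  have hk0 : 0 < k := hB.trans_lt hk
  rw [← integral_vertical_line_shift hc hd hb hA hB hk ht, ← integral_const_mul]
  have hL : ∀ x : ℝ, ((Real.pi / k : ℝ) : ℂ) ^ (1 / 2 : ℂ) *
      Complex.exp (-t * x - x ^ 2 / (4 * k)) =
      ∫ y : ℝ, Complex.exp (k * ((y * Complex.I : ℂ) - t) ^ 2) *
        Complex.exp ((-y : ℝ) * x * Complex.I) := by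
    intro x
    have h := integral_cexp_quadratic (b := -(k : ℂ)) (by simpa using hk0)
      (-(2 * t * k + x) * Complex.I) (k * t ^ 2)
    have hkc : (k : ℂ) ≠ 0 := by exact_mod_cast hk0.ne'
    rw [neg_neg] at h
    convert! h.symm using 2
    · push_cast; rfl
    · congr 1
      rw [mul_pow, Complex.I_sq]
      field_simp
      ring
    · ext y
      rw [← Complex.exp_add]
      congr 1
      have := Complex.I_sq
      push_cast
      linear_combination (k * y ^ 2 : ℂ) * this
  simp_rw [hL]
  rw [integral_integral_swap]
  · refine integral_congr_ae (ae_of_all _ fun y => ?_)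
    simp only
    rw [integral_const_mul, ← hψ, charFun_apply_real]
  · have h1 : Integrable (fun y : ℝ => Complex.exp (k * ((y * Complex.I : ℂ) - t) ^ 2)) := by
      have := integrable_vertical_line (ψ := fun _ => 1) (A := 1) (B := 0) (k := k) (t := t)
        (x := 0) continuousOn_const (by simp) zero_le_one le_rfl hk0 le_rfl ht
      simpa using this
    have h2 := (integrable_const (μ := ρ) (1 : ℂ)).mul_prod h1
    refine Integrable.mono h2 (Continuous.aestronglyMeasurable (by
      simp only [Function.uncurry_def]; fun_prop)) (ae_of_all _ fun p => ?_)
    have : ‖Complex.exp ((-p.2 : ℝ) * p.1 * Complex.I)‖ = 1 := by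
      rw [← Complex.ofReal_mul]; exact Complex.norm_exp_ofReal_mul_I _
    simp only [Function.uncurry_def, norm_mul, this]
    simp

/-- If the characteristic function of a law extends to a function `ψ` on the closed right
half-plane, continuous, holomorphic inside and of growth at most `exp (B |z| ^ 2)`, then the law
has the Laplace transform `ψ`; in particular all these exponential moments are finite. -/
theorem laplace_of_charFun {ρ : Measure ℝ} [IsProbabilityMeasure ρ] {ψ : ℂ → ℂ} {A B : ℝ}
    (hc : ContinuousOn ψ {z | 0 ≤ z.re}) (hd : DifferentiableOn ℂ ψ {z | 0 < z.re})
    (hb : ∀ z : ℂ, 0 ≤ z.re → ‖ψ z‖ ≤ A * Real.exp (B * ‖z‖ ^ 2)) (hA : 0 ≤ A) (hB : 0 ≤ B)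
    (hψ : ∀ y : ℝ, charFun ρ (-y) = ψ (y * Complex.I)) {t : ℝ} (ht : 0 ≤ t) :
    Integrable (fun x => Real.exp (-t * x)) ρ ∧
      ((∫ x, Real.exp (-t * x) ∂ρ : ℝ) : ℂ) = ψ t := by
  -- the regularisations converge to `ψ t`
  have key : Tendsto (fun k : ℝ => ((∫ x, Real.exp (-t * x - x ^ 2 / (4 * k)) ∂ρ : ℝ) : ℂ))
      atTop (𝓝 (ψ t)) := by
    have hlim : Tendsto (fun k : ℝ => ((Real.pi : ℝ) : ℂ) ^ (-(1 / 2) : ℂ) *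
        ∫ u : ℝ, Complex.exp (-(u : ℂ) ^ 2) * ψ (t + ((√k)⁻¹ * u : ℝ) * Complex.I)) atTop
        (𝓝 (((Real.pi : ℝ) : ℂ) ^ (-(1 / 2) : ℂ) *
          ∫ u : ℝ, Complex.exp (-(u : ℂ) ^ 2) * ψ t)) := by
      refine Tendsto.const_mul _ ?_
      refine tendsto_integral_filter_of_dominated_convergence
        (fun u => A * Real.exp (B * t ^ 2) * Real.exp (-(1 / 2) * u ^ 2)) ?_ ?_ ?_ ?_
      · refine Eventually.of_forall fun k => Continuous.aestronglyMeasurable ?_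
        exact Continuous.mul (by fun_prop)
          (hc.comp_continuous (by fun_prop) fun y => by simpa using ht)
      · filter_upwards [eventually_ge_atTop (2 * B), eventually_gt_atTop 0] with k hk hk0
        refine ae_of_all _ fun u => ?_
        have h3 := hb (t + ((√k)⁻¹ * u : ℝ) * Complex.I) (by simpa using ht)
        rw [Complex.sq_norm, Complex.normSq_add_mul_I] at h3
        have h4 : ((√k)⁻¹ * u) ^ 2 = u ^ 2 / k := by
          rw [mul_pow, inv_pow, Real.sq_sqrt hk0.le]; field_simp
        have h5 : B * (u ^ 2 / k) ≤ 1 / 2 * u ^ 2 := by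
          rw [← mul_div_assoc, div_le_iff₀ hk0]; nlinarith [sq_nonneg u]
        have h1 : ‖Complex.exp (-(u : ℂ) ^ 2)‖ = Real.exp (-u ^ 2) := by
          rw [Complex.norm_exp]; norm_cast
        rw [norm_mul, h1]
        calc _ ≤ Real.exp (-u ^ 2) * (A * Real.exp (B * (t ^ 2 + ((√k)⁻¹ * u) ^ 2))) := by gcongr
          _ = A * Real.exp (-u ^ 2 + B * (t ^ 2 + u ^ 2 / k)) := by
            rw [h4, Real.exp_add]; ring
          _ ≤ A * Real.exp (B * t ^ 2 + -(1 / 2) * u ^ 2) := by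
            refine mul_le_mul_of_nonneg_left (Real.exp_le_exp.2 ?_) hA
            linarith
          _ = _ := by rw [Real.exp_add]; ring
      · exact ((integrable_exp_neg_mul_sq (by norm_num)).const_mul _)
      · refine ae_of_all _ fun u => Tendsto.const_mul _ ?_
        have h1 : Tendsto (fun k : ℝ => (t + ((√k)⁻¹ * u : ℝ) * Complex.I : ℂ)) atTop
            (𝓝 (t : ℂ)) := by
          have h0 : Tendsto (fun k : ℝ => (√k)⁻¹ * u) atTop (𝓝 0) := by
            simpa using (tendsto_inv_atTop_zero.comp Real.tendsto_sqrt_atTop).mul_const u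
          have := ((Complex.continuous_ofReal.tendsto 0).comp h0).mul_const Complex.I
          simpa using this.const_add (t : ℂ)
        have h2 := hc t (by simpa using ht)
        exact h2.tendsto.comp (tendsto_nhdsWithin_iff.2 ⟨h1, Eventually.of_forall fun k => by
          simpa using ht⟩)
    have hgauss : ((Real.pi : ℝ) : ℂ) ^ (-(1 / 2) : ℂ) *
        ∫ u : ℝ, Complex.exp (-(u : ℂ) ^ 2) * ψ t = ψ t := by
      rw [integral_mul_const]
      have : ∫ u : ℝ, Complex.exp (-(u : ℂ) ^ 2) = ((Real.pi : ℝ) : ℂ) ^ (1 / 2 : ℂ) := by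
        have := integral_gaussian_complex (b := 1) (by simp)
        simpa using this
      rw [this, ← mul_assoc, ← Complex.cpow_add _ _ (by exact_mod_cast Real.pi_ne_zero)]
      simp
    rw [hgauss] at hlim
    refine hlim.congr' ?_
    filter_upwards [eventually_gt_atTop B] with k hk
    have hk0 : 0 < k := hB.trans_lt hk
    have h := integral_exp_regularised hc hd hb hA hB hψ hk ht
    have hs : 0 < (√k)⁻¹ := by positivity
    have hcv := MeasureTheory.Measure.integral_comp_mul_left
      (fun y : ℝ => Complex.exp (-k * y ^ 2) * ψ (t + y * Complex.I)) (√k)⁻¹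
    rw [← h] at hcv
    have e1 : ∫ u : ℝ, Complex.exp (-(u : ℂ) ^ 2) * ψ (t + ((√k)⁻¹ * u : ℝ) * Complex.I) =
        ∫ u : ℝ, Complex.exp (-k * (((√k)⁻¹ * u : ℝ) : ℂ) ^ 2) *
          ψ (t + ((√k)⁻¹ * u : ℝ) * Complex.I) := by
      refine integral_congr_ae (ae_of_all _ fun u => ?_)
      have h4 : k * ((√k)⁻¹ * u) ^ 2 = u ^ 2 := by
        rw [mul_pow, inv_pow, Real.sq_sqrt hk0.le]; field_simp
      have h5 : (k : ℂ) * (((√k)⁻¹ * u : ℝ) : ℂ) ^ 2 = (u : ℂ) ^ 2 := by exact_mod_cast h4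
      simp only [neg_mul, h5]
    rw [e1, hcv, inv_inv, abs_of_pos (Real.sqrt_pos.2 hk0)]
    have e2 : ((∫ x, Real.exp (-t * x - x ^ 2 / (4 * k)) ∂ρ : ℝ) : ℂ) =
        ∫ x, Complex.exp (-t * x - x ^ 2 / (4 * k)) ∂ρ := by
      rw [← integral_complex_ofReal]
      push_cast
      rfl
    rw [e2, Complex.real_smul, ← mul_assoc, ← mul_assoc]
    have e3 : ((Real.pi : ℝ) : ℂ) ^ (-(1 / 2) : ℂ) * ((√k : ℝ) : ℂ) *
        ((Real.pi / k : ℝ) : ℂ) ^ (1 / 2 : ℂ) = 1 := by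
      have a1 : ((Real.pi : ℝ) : ℂ) ^ (-(1 / 2) : ℂ) = ((√Real.pi)⁻¹ : ℝ) := by
        rw [Complex.cpow_neg, Real.sqrt_eq_rpow, Complex.ofReal_inv,
          Complex.ofReal_cpow Real.pi_pos.le]
        simp
      have a2 : ((Real.pi / k : ℝ) : ℂ) ^ (1 / 2 : ℂ) = (√(Real.pi / k) : ℝ) := by
        rw [Real.sqrt_eq_rpow, Complex.ofReal_cpow (by positivity)]
        simp
      rw [a1, a2, Real.sqrt_div' _ hk0.le]
      norm_cast
      have := Real.sqrt_pos.2 hk0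
      have := Real.sqrt_pos.2 Real.pi_pos
      field_simp
    rw [e3, one_mul]
  have keyR : Tendsto (fun k : ℝ => ∫ x, Real.exp (-t * x - x ^ 2 / (4 * k)) ∂ρ)
      atTop (𝓝 (ψ t).re) := by
    have := (Complex.continuous_re.tendsto _).comp key
    simpa [Function.comp_def] using this
  -- monotone convergence along `k = n + 1` identifies the limit with the Laplace transform
  have hintk : ∀ k : ℝ, 0 < k → Integrable (fun x => Real.exp (-t * x - x ^ 2 / (4 * k))) ρ := by
    intro k hk
    refine Integrable.mono' (integrable_const (Real.exp (k * t ^ 2)))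
      (Continuous.aestronglyMeasurable (by fun_prop)) (ae_of_all _ fun x => ?_)
    rw [Real.norm_of_nonneg (Real.exp_pos _).le]
    gcongr
    have : k * t ^ 2 - (-t * x - x ^ 2 / (4 * k)) = (2 * k * t + x) ^ 2 / (4 * k) := by
      field_simp; ring
    have h2 : 0 ≤ (2 * k * t + x) ^ 2 / (4 * k) := by positivity
    linarith
  have hptw : ∀ x : ℝ, Tendsto (fun n : ℕ => Real.exp (-t * x - x ^ 2 / (4 * ((n : ℝ) + 1))))
      atTop (𝓝 (Real.exp (-t * x))) := by
    intro x
    refine (Real.continuous_exp.tendsto _).comp ?_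
    have h1 : Tendsto (fun n : ℕ => x ^ 2 / 4 * (1 / ((n : ℝ) + 1))) atTop (𝓝 0) := by
      have := (tendsto_one_div_add_atTop_nhds_zero_nat (𝕜 := ℝ)).const_mul (x ^ 2 / 4)
      rwa [mul_zero] at this
    have h2 := h1.const_sub (-t * x)
    rw [sub_zero] at h2
    refine h2.congr fun n => ?_
    have : (n : ℝ) + 1 ≠ 0 := by positivity
    field_simp
  have htop : Tendsto (fun n : ℕ => (n : ℝ) + 1) atTop atTop :=
    tendsto_atTop_add_const_right _ _ tendsto_natCast_atTop_atTop
  have keyN := keyR.comp htop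
  have hmono : ∀ x : ℝ, Monotone fun n : ℕ => Real.exp (-t * x - x ^ 2 / (4 * ((n : ℝ) + 1))) := by
    intro x m n hmn
    have : (m : ℝ) ≤ n := by exact_mod_cast hmn
    simp only
    gcongr
  have hint : Integrable (fun x => Real.exp (-t * x)) ρ := by
    have hint_k : ∀ n : ℕ, Integrable (fun x =>
        Real.exp (-t * x - x ^ 2 / (4 * ((n : ℝ) + 1)))) ρ := fun n => hintk _ (by positivity)
    refine integrable_of_tendsto (ae_of_all _ hptw) (fun n => (hint_k n).aestronglyMeasurable) ?_
    obtain ⟨C, hC⟩ := keyN.bddAbove_range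
    refine ne_top_of_le_ne_top (ENNReal.ofReal_ne_top (r := C)) (liminf_le_of_le ?_ ?_)
    · isBoundedDefault
    · intro b hb'
      obtain ⟨n, hn⟩ := hb'.exists
      refine hn.trans ?_
      have h0 : ∀ x, ‖Real.exp (-t * x - x ^ 2 / (4 * ((n : ℝ) + 1)))‖ₑ =
          ENNReal.ofReal (Real.exp (-t * x - x ^ 2 / (4 * ((n : ℝ) + 1)))) := fun x =>
        Real.enorm_of_nonneg (Real.exp_pos _).le
      simp_rw [h0]
      rw [← ofReal_integral_eq_lintegral_ofReal (hint_k n)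
        (ae_of_all _ fun x => (Real.exp_pos _).le)]
      exact ENNReal.ofReal_le_ofReal (hC ⟨n, rfl⟩)
  refine ⟨hint, ?_⟩
  have h1 := integral_tendsto_of_tendsto_of_monotone (μ := ρ) (f := fun n : ℕ => fun x =>
      Real.exp (-t * x - x ^ 2 / (4 * ((n : ℝ) + 1)))) (fun n => hintk _ (by positivity)) hint
      (ae_of_all _ hmono) (ae_of_all _ hptw)
  have h2 := (Complex.continuous_ofReal.tendsto _).comp h1
  exact tendsto_nhds_unique h2 (key.comp htop)

/-! ### The Laplace transform of a totally skewed stable law -/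

/-- The logarithm of the Laplace transform of the stable law with skewness `1`, as a function on
the closed right half-plane. On the imaginary axis it is the exponent of the characteristic
function; the value at `0` is `0`. -/
noncomputable def stableExponent (α σ μ : ℝ) (z : ℂ) : ℂ :=
  if α = 1 then ((2 * σ / Real.pi : ℝ) : ℂ) * (z * Complex.log z) - μ * z
  else -((σ ^ α / Real.cos (Real.pi * α / 2) : ℝ) : ℂ) * z ^ (α : ℂ) - μ * z

/-- The Laplace transform of the stable law with skewness `1`. -/
noncomputable def stableLaplace (α σ μ t : ℝ) : ℝ :=
  if α = 1 then Real.exp (2 * σ / Real.pi * (t * Real.log t) - μ * t)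
  else Real.exp (-(σ ^ α / Real.cos (Real.pi * α / 2)) * t ^ α - μ * t)

lemma cos_pi_mul_div_two_ne_zero {α : ℝ} (hα₀ : 0 < α) (hα₂ : α ≤ 2) (h1 : α ≠ 1) :
    Real.cos (Real.pi * α / 2) ≠ 0 := by
  have hpi := Real.pi_pos
  rcases lt_or_gt_of_ne h1 with h | h
  · exact (Real.cos_pos_of_mem_Ioo ⟨by nlinarith, by nlinarith⟩).ne'
  · exact (Real.cos_neg_of_pi_div_two_lt_of_lt (by nlinarith) (by nlinarith)).ne

lemma mem_slitPlane_of_re_nonneg {z : ℂ} (hz : 0 ≤ z.re) (h0 : z ≠ 0) : z ∈ Complex.slitPlane := by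
  rw [Complex.mem_slitPlane_iff]
  rcases hz.lt_or_eq with h | h
  · exact Or.inl h
  · exact Or.inr fun him => h0 (Complex.ext h.symm him)

lemma norm_mul_log_le (z : ℂ) : ‖z * Complex.log z‖ ≤ ‖z‖ * |Real.log ‖z‖| + Real.pi * ‖z‖ := by
  rw [norm_mul]
  have h1 : ‖Complex.log z‖ ≤ |Real.log ‖z‖| + Real.pi := by
    refine (Complex.norm_le_abs_re_add_abs_im _).trans ?_
    rw [Complex.log_re, Complex.log_im]
    gcongr
    exact Complex.abs_arg_le_pi z
  nlinarith [norm_nonneg z]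

lemma continuousOn_mul_log : ContinuousOn (fun z : ℂ => z * Complex.log z) {z | 0 ≤ z.re} := by
  intro z hz
  rcases eq_or_ne z 0 with rfl | h0
  · refine ContinuousAt.continuousWithinAt ?_
    have h : Tendsto (fun z : ℂ => ‖z‖ * |Real.log ‖z‖| + Real.pi * ‖z‖) (𝓝 0) (𝓝 0) := by
      have h1 : Continuous fun x : ℝ => |x * Real.log x| + Real.pi * x := by
        have := Real.continuous_mul_log
        fun_prop
      have h2 := (h1.tendsto 0).comp (continuous_norm.tendsto (0 : ℂ) |>.trans (by simp))
      simp only [mul_zero, zero_mul, abs_zero, add_zero] at h2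
      refine h2.congr fun z => ?_
      simp [abs_mul]
    rw [ContinuousAt]
    simp only [zero_mul]
    exact squeeze_zero_norm norm_mul_log_le h
  · exact (continuousAt_id.mul
      (continuousAt_clog (mem_slitPlane_of_re_nonneg hz h0))).continuousWithinAt

lemma continuousOn_cpow_re_nonneg {α : ℝ} (hα : 0 < α) :
    ContinuousOn (fun z : ℂ => z ^ (α : ℂ)) {z | 0 ≤ z.re} := by
  intro z hz
  rcases eq_or_ne z 0 with rfl | h0
  · have := Complex.continuousAt_cpow_zero_of_re_pos (z := (α : ℂ)) (by simpa using hα)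
    exact (ContinuousAt.comp (f := fun z : ℂ => (z, (α : ℂ))) this
      (by fun_prop)).continuousWithinAt
  · exact (continuousAt_cpow_const (mem_slitPlane_of_re_nonneg hz h0)).continuousWithinAt

lemma continuousOn_stableExponent {α σ μ : ℝ} (hα : 0 < α) :
    ContinuousOn (stableExponent α σ μ) {z | 0 ≤ z.re} := by
  unfold stableExponent
  split_ifs
  · exact (continuousOn_const.mul continuousOn_mul_log).sub
      (continuous_const.mul continuous_id).continuousOn
  · exact (continuousOn_const.mul (continuousOn_cpow_re_nonneg hα)).sub
      (continuous_const.mul continuous_id).continuousOn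

lemma differentiableOn_stableExponent {α σ μ : ℝ} :
    DifferentiableOn ℂ (stableExponent α σ μ) {z | 0 < z.re} := by
  intro z hz
  have hz' : z ∈ Complex.slitPlane := Or.inl hz
  refine DifferentiableAt.differentiableWithinAt ?_
  unfold stableExponent
  split_ifs
  · have := (differentiableAt_id (𝕜 := ℂ) (x := z)).clog hz'
    simp only [id] at this
    fun_prop
  · have := (differentiableAt_id (𝕜 := ℂ) (x := z)).cpow_const (c := (α : ℂ)) hz'
    simp only [id] at this
    fun_prop

/-- The exponent grows at most quadratically. -/
lemma exists_norm_stableExponent_le {α σ μ : ℝ} (hα₀ : 0 < α) (hα₂ : α ≤ 2) :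
    ∃ B, 0 ≤ B ∧ ∀ z : ℂ, 0 ≤ z.re → ‖stableExponent α σ μ z‖ ≤ B * (1 + ‖z‖ ^ 2) := by
  have hμ : ∀ z : ℂ, ‖(μ : ℂ) * z‖ ≤ |μ| * (1 + ‖z‖ ^ 2) := by
    intro z
    rw [norm_mul, Complex.norm_real, Real.norm_eq_abs]
    gcongr
    nlinarith [sq_nonneg (‖z‖ - 1)]
  by_cases h1 : α = 1
  · refine ⟨|2 * σ / Real.pi| * (1 + Real.pi) + |μ|, by positivity, fun z hz => ?_⟩
    rw [stableExponent, if_pos h1]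
    refine (norm_sub_le _ _).trans ?_
    rw [add_mul]
    refine add_le_add ?_ (hμ z)
    rw [norm_mul, Complex.norm_real, Real.norm_eq_abs, mul_assoc]
    gcongr
    refine (norm_mul_log_le z).trans ?_
    have hn := norm_nonneg z
    have h2 : ‖z‖ * |Real.log ‖z‖| ≤ 1 + ‖z‖ ^ 2 := by
      rcases hn.eq_or_lt with h | h
      · simp [← h]
      rcases le_total ‖z‖ 1 with h3 | h3
      · have := Real.abs_log_mul_self_lt ‖z‖ h h3
        rw [abs_mul, abs_of_pos h] at this
        nlinarith [sq_nonneg ‖z‖]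
      · rw [abs_of_nonneg (Real.log_nonneg h3)]
        have := Real.log_le_sub_one_of_pos h
        nlinarith
    nlinarith [Real.pi_pos, mul_nonneg Real.pi_pos.le (sq_nonneg (‖z‖ - 1)),
      mul_nonneg Real.pi_pos.le (sq_nonneg ‖z‖)]
  · refine ⟨|σ ^ α / Real.cos (Real.pi * α / 2)| + |μ|, by positivity, fun z hz => ?_⟩
    rw [stableExponent, if_neg h1]
    refine (norm_sub_le _ _).trans ?_
    rw [add_mul]
    refine add_le_add ?_ (hμ z)
    rw [norm_mul, norm_neg, Complex.norm_real, Real.norm_eq_abs]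
    gcongr
    have hn := norm_nonneg z
    rw [Complex.norm_cpow_real]
    rcases le_total ‖z‖ 1 with h3 | h3
    · have := Real.rpow_le_one hn h3 hα₀.le
      nlinarith [sq_nonneg ‖z‖]
    · have := Real.rpow_le_rpow_of_exponent_le h3 hα₂
      rw [Real.rpow_two] at this
      linarith

lemma log_mul_I_of_pos {y : ℝ} (hy : 0 < y) :
    Complex.log (y * Complex.I) = Real.log y + Real.pi / 2 * Complex.I := by
  rw [Complex.log_ofReal_mul hy Complex.I_ne_zero, Complex.log_I]

lemma log_mul_I_of_neg {y : ℝ} (hy : y < 0) :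
    Complex.log (y * Complex.I) = Real.log |y| - Real.pi / 2 * Complex.I := by
  have : (y * Complex.I : ℂ) = ((-y : ℝ) : ℂ) * (-Complex.I) := by push_cast; ring
  rw [this, Complex.log_ofReal_mul (neg_pos.2 hy) (neg_ne_zero.2 Complex.I_ne_zero),
    Complex.log_neg_I, abs_of_neg hy]
  ring

lemma mul_I_cpow {α : ℝ} (hα : 0 < α) (y : ℝ) :
    (y * Complex.I : ℂ) ^ (α : ℂ) = ((|y| ^ α : ℝ) : ℂ) *
      (((Real.cos (Real.pi * α / 2) : ℝ) : ℂ)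
        + Complex.I * ((Real.sign y * Real.sin (Real.pi * α / 2) : ℝ) : ℂ)) := by
  rcases lt_trichotomy y 0 with h | rfl | h
  · have h0 : (y * Complex.I : ℂ) ≠ 0 :=
      mul_ne_zero (by exact_mod_cast h.ne) Complex.I_ne_zero
    rw [Complex.cpow_def_of_ne_zero h0, log_mul_I_of_neg h, Real.sign_of_neg h,
      Real.rpow_def_of_pos (abs_pos.2 h.ne), Complex.ofReal_exp, sub_mul, sub_eq_add_neg,
      Complex.exp_add]
    push_cast
    congr 1
    rw [show -((Real.pi : ℂ) / 2 * Complex.I * α) = (-(Real.pi * α / 2 : ℂ)) * Complex.I by ring,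
      Complex.exp_mul_I, Complex.cos_neg, Complex.sin_neg]
    ring
  · simp [hα.ne', Real.zero_rpow hα.ne']
  · have h0 : (y * Complex.I : ℂ) ≠ 0 :=
      mul_ne_zero (by exact_mod_cast h.ne') Complex.I_ne_zero
    rw [Complex.cpow_def_of_ne_zero h0, log_mul_I_of_pos h, Real.sign_of_pos h,
      Real.rpow_def_of_pos (abs_pos.2 h.ne'), Complex.ofReal_exp, add_mul, Complex.exp_add,
      abs_of_pos h]
    push_cast
    congr 1
    rw [show ((Real.pi : ℂ) / 2 * Complex.I * α) = (Real.pi * α / 2 : ℂ) * Complex.I by ring,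
      Complex.exp_mul_I]
    ring

lemma mul_I_mul_log (y : ℝ) :
    (y * Complex.I : ℂ) * Complex.log (y * Complex.I) =
      ((-(Real.pi / 2 * |y|) : ℝ) : ℂ) + Complex.I * ((y * Real.log |y| : ℝ) : ℂ) := by
  have hI := Complex.I_sq
  rcases lt_trichotomy y 0 with h | rfl | h
  · rw [log_mul_I_of_neg h, abs_of_neg h]
    push_cast
    linear_combination (-(Real.pi / 2) * y : ℂ) * hI
  · simp
  · rw [log_mul_I_of_pos h, abs_of_pos h]
    push_cast
    linear_combination ((Real.pi / 2) * y : ℂ) * hI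

lemma charFun_neg_eq_exp_stableExponent {α σ μ : ℝ} {ρ : Measure ℝ} (hα₀ : 0 < α) (hα₂ : α ≤ 2)
    (hρ : IsStableLaw α 1 σ μ ρ) (y : ℝ) :
    charFun ρ (-y) = Complex.exp (stableExponent α σ μ (y * Complex.I)) := by
  rw [hρ.charFun_eq, stableExponent]
  have hs : Real.sign (-y) = -Real.sign y := Real.sign_neg
  split_ifs with h1
  · rw [mul_I_mul_log, hs, abs_neg]
    congr 1
    have hpi : (Real.pi : ℂ) ≠ 0 := by exact_mod_cast Real.pi_ne_zero
    have hy : Real.sign y * |y| = y := by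
      rcases lt_trichotomy y 0 with h | rfl | h
      · simp [Real.sign_of_neg h, abs_of_neg h]
      · simp
      · simp [Real.sign_of_pos h, abs_of_pos h]
    have hy' : (Real.sign y : ℂ) * (|y| : ℝ) = y := by exact_mod_cast hy
    push_cast
    field_simp
    linear_combination (2 * σ * Complex.I * Real.log |y|) * hy'
  · rw [mul_I_cpow hα₀, hs, abs_neg, Real.tan_eq_sin_div_cos]
    congr 1
    have hc := cos_pi_mul_div_two_ne_zero hα₀ hα₂ h1
    have hc' : ((Real.cos (Real.pi * α / 2) : ℝ) : ℂ) ≠ 0 := by exact_mod_cast hc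
    push_cast at hc' ⊢
    field_simp
    ring

lemma exp_stableExponent_ofReal (α σ μ : ℝ) {t : ℝ} (ht : 0 ≤ t) :
    Complex.exp (stableExponent α σ μ t) = (stableLaplace α σ μ t : ℝ) := by
  rw [stableExponent, stableLaplace]
  split_ifs
  · rw [← Complex.ofReal_log ht]; push_cast; rfl
  · rw [← Complex.ofReal_cpow ht]; push_cast; rfl

/-- The Laplace transform of the stable law with skewness `1` is finite on the whole half-line. -/
theorem IsStableLaw.laplace {α σ μ : ℝ} {ρ : Measure ℝ} (hα₀ : 0 < α) (hα₂ : α ≤ 2)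
    (hρ : IsStableLaw α 1 σ μ ρ) {t : ℝ} (ht : 0 ≤ t) :
    Integrable (fun x => Real.exp (-t * x)) ρ ∧
      ∫ x, Real.exp (-t * x) ∂ρ = stableLaplace α σ μ t := by
  have := hρ.isProbabilityMeasure
  obtain ⟨B, hB, hb⟩ := exists_norm_stableExponent_le (σ := σ) (μ := μ) hα₀ hα₂
  have h := laplace_of_charFun (ρ := ρ) (ψ := fun z => Complex.exp (stableExponent α σ μ z))
    (A := Real.exp B) (B := B) (continuousOn_stableExponent hα₀).cexp
    differentiableOn_stableExponent.cexp ?_ (Real.exp_pos _).le hB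
    (charFun_neg_eq_exp_stableExponent hα₀ hα₂ hρ) ht
  · refine ⟨h.1, ?_⟩
    have h2 := h.2
    rw [exp_stableExponent_ofReal α σ μ ht] at h2
    exact_mod_cast h2
  · intro z hz
    rw [← Real.exp_add, Complex.norm_exp]
    refine Real.exp_le_exp.2 ?_
    have h1 := (Complex.abs_re_le_norm (stableExponent α σ μ z)).trans (hb z hz)
    have h2 := le_abs_self (stableExponent α σ μ z).re
    linarith

/-- The factor `-(log ℒ)'` for the Laplace transform `ℒ` of the stable law with skewness `1`. -/
noncomputable def stableSlope (α σ μ t : ℝ) : ℝ :=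
  if α = 1 then -(2 * σ / Real.pi) * (Real.log t + 1) + μ
  else σ ^ α * α / Real.cos (Real.pi * α / 2) * t ^ (α - 1) + μ

lemma hasDerivAt_stableLaplace (α σ μ : ℝ) {t : ℝ} (ht : 0 < t) :
    HasDerivAt (stableLaplace α σ μ) (-(stableLaplace α σ μ t * stableSlope α σ μ t)) t := by
  unfold stableLaplace stableSlope
  split_ifs
  · have h1 := ((Real.hasDerivAt_mul_log ht.ne').const_mul (2 * σ / Real.pi)).sub
      ((hasDerivAt_id t).const_mul μ)
    convert! h1.exp using 1
    simp only [Pi.sub_apply, id]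
    ring
  · have h1 := ((Real.hasDerivAt_rpow_const (p := α) (Or.inl ht.ne')).const_mul
      (-(σ ^ α / Real.cos (Real.pi * α / 2)))).sub ((hasDerivAt_id t).const_mul μ)
    convert! h1.exp using 1
    simp only [Pi.sub_apply, id]
    ring

theorem IsStableLaw.integral_mul_exp {α σ μ : ℝ} {ρ : Measure ℝ} (hα₀ : 0 < α) (hα₂ : α ≤ 2)
    (hρ : IsStableLaw α 1 σ μ ρ) {t : ℝ} (ht : 0 < t) :
    Integrable (fun x => x * Real.exp (-t * x)) ρ ∧
      ∫ x, x * Real.exp (-t * x) ∂ρ = stableLaplace α σ μ t * stableSlope α σ μ t := by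
  have hsub : Iic (0 : ℝ) ⊆ integrableExpSet id ρ := by
    intro s hs
    have := (hρ.laplace hα₀ hα₂ (neg_nonneg.2 hs)).1
    simpa [integrableExpSet] using this
  have hint : -t ∈ interior (integrableExpSet id ρ) := by
    refine interior_mono hsub ?_
    rw [interior_Iic]
    simpa using ht
  refine ⟨by simpa using integrable_pow_mul_exp_of_mem_interior_integrableExpSet hint 1, ?_⟩
  have h1 := hasDerivAt_mgf hint
  have h2 := h1.scomp t (hasDerivAt_neg t)
  have h3 : HasDerivAt (mgf id ρ ∘ Neg.neg) (-(stableLaplace α σ μ t * stableSlope α σ μ t)) t := by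
    refine (hasDerivAt_stableLaplace α σ μ ht).congr_of_eventuallyEq ?_
    filter_upwards [lt_mem_nhds ht] with s hs
    exact (hρ.laplace hα₀ hα₂ hs.le).2
  have h4 := h2.unique h3
  simpa using h4

/-! ### Radial integrals in the plane -/

/-- The annulus of the points whose distance from the origin lies in `[b, c)`. -/
def ring (b c : ℝ) : Set Plane := {x | b ≤ ‖x‖ ∧ ‖x‖ < c}

lemma measurableSet_ring (b c : ℝ) : MeasurableSet (ring b c) :=
  (measurableSet_le measurable_const measurable_norm).inter
    (measurableSet_lt measurable_norm measurable_const)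

lemma innerDisc_eq_ring (R : ℝ) : innerDisc R = ring 0 R := by
  ext x; simp [innerDisc, ring]

lemma outerAnnulus_eq_ring (R a : ℝ) : outerAnnulus R a = ring R (a * R) := rfl

lemma measurableSet_innerDisc (R : ℝ) : MeasurableSet (innerDisc R) :=
  innerDisc_eq_ring R ▸ measurableSet_ring _ _

lemma measurableSet_outerAnnulus (R a : ℝ) : MeasurableSet (outerAnnulus R a) :=
  measurableSet_ring _ _

lemma setIntegral_ring {b c : ℝ} (hb : 0 ≤ b) (f : ℝ → ℝ) :
    ∫ x in ring b c, f ‖x‖ = 2 * Real.pi * ∫ y in Ioo b c, y * f y := by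
  have hball : (volume : Measure Plane).real (Metric.ball 0 1) = Real.pi := by
    rw [Measure.real, EuclideanSpace.volume_ball_fin_two]
    simp [Real.pi_pos.le]
  have h1 : ∫ x in ring b c, f ‖x‖ = ∫ x : Plane, (Ico b c).indicator f ‖x‖ := by
    rw [← integral_indicator (measurableSet_ring b c)]
    refine integral_congr_ae (ae_of_all _ fun x => ?_)
    by_cases h : b ≤ ‖x‖ ∧ ‖x‖ < c <;> simp [indicator, ring, h]
  rw [h1, integral_fun_norm_addHaar, hball]
  simp only [finrank_euclideanSpace, Fintype.card_fin, Nat.add_one_sub_one, pow_one, smul_eq_mul,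
    nsmul_eq_mul, Nat.cast_ofNat, ← mul_assoc]
  congr 1
  have h2 : ∀ y, y * (Ico b c).indicator f y = (Ico b c).indicator (fun y => y * f y) y :=
    fun y => (indicator_mul_right _ (fun y => y) f).symm
  simp_rw [h2]
  rw [← integral_Ici_eq_integral_Ioi, setIntegral_indicator measurableSet_Ico,
    inter_eq_right.2 (Ico_subset_Ici_self.trans (Ici_subset_Ici.2 hb)),
    integral_Ico_eq_integral_Ioo]

lemma ring_subset_ball (b c : ℝ) : ring b c ⊆ Metric.ball 0 c := fun x hx => by
  simpa using hx.2

lemma volume_ring_lt_top (b c : ℝ) : volume (ring b c) < ∞ :=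
  (measure_mono (ring_subset_ball b c)).trans_lt measure_ball_lt_top

instance (b c : ℝ) : IsFiniteMeasure (volume.restrict (ring b c)) :=
  ⟨by simpa using volume_ring_lt_top b c⟩

lemma volume_real_ring {b c : ℝ} (hb : 0 ≤ b) (hbc : b ≤ c) :
    volume.real (ring b c) = Real.pi * (c ^ 2 - b ^ 2) := by
  have h := setIntegral_ring (c := c) hb (fun _ => 1)
  rw [setIntegral_const, smul_eq_mul, mul_one] at h
  rw [h]
  simp only [mul_one]
  rw [← integral_Ioc_eq_integral_Ioo, ← intervalIntegral.integral_of_le hbc, integral_id]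
  ring

lemma volume_norm_eq (r : ℝ) : volume {x : Plane | ‖x‖ = r} = 0 := by
  have := Measure.addHaar_sphere (volume : Measure Plane) 0 r
  convert this using 2
  ext x; simp

/-! ### The integral behind `bsXi` -/

lemma integrableOn_rpow_mul_exp_neg (d : ℝ) {x : ℝ} (hx : 0 < x) :
    IntegrableOn (fun t : ℝ => t ^ (d - 1) * Real.exp (-t)) (Ioi x) := by
  refine integrable_of_isBigO_exp_neg (b := 1 / 2) (by norm_num) ?_ ?_
  · refine ContinuousOn.mul (fun t ht => ?_) (by fun_prop)
    exact (Real.continuousAt_rpow_const _ _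
      (Or.inl (hx.trans_le ht).ne')).continuousWithinAt
  · simpa [mul_comm] using (Real.Gamma_integrand_isLittleO (d - 1)).isBigO

lemma hasDerivAt_upperGamma (d : ℝ) {x : ℝ} (hx : 0 < x) :
    HasDerivAt (upperGamma d) (-(x ^ (d - 1) * Real.exp (-x))) x := by
  have hx2 : 0 < x / 2 := by positivity
  have hc : ∀ y, 0 < y → ContinuousAt (fun t : ℝ => t ^ (d - 1) * Real.exp (-t)) y := fun y hy =>
    (Real.continuousAt_rpow_const _ _ (Or.inl hy.ne')).mul (by fun_prop)
  have h1 : HasDerivAt (fun y => ∫ t in (x / 2)..y, t ^ (d - 1) * Real.exp (-t))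
      (x ^ (d - 1) * Real.exp (-x)) x := by
    refine intervalIntegral.integral_hasDerivAt_right ?_ ?_ (hc x hx)
    · refine ContinuousOn.intervalIntegrable fun y hy => (hc y ?_).continuousWithinAt
      rw [uIcc_of_le (by linarith)] at hy
      exact hx2.trans_le hy.1
    · exact (Measurable.stronglyMeasurable (by fun_prop)).stronglyMeasurableAtFilter
  have h2 := h1.const_sub (upperGamma d (x / 2))
  refine h2.congr_of_eventuallyEq ?_
  filter_upwards [lt_mem_nhds (half_lt_self hx)] with y hy
  rw [← intervalIntegral.integral_Ioi_sub_Ioi (integrableOn_rpow_mul_exp_neg d hx2) hy.le]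
  simp [upperGamma]

/-- The function `Λ - Θ` integrates `2 y (1 - exp (-s g y ^ (-δ)))` between the radii. -/
lemma bsLambda_sub_bsTheta {δ s b c g : ℝ} (hδ : 0 < δ) (hs : 0 < s) (hb : 0 < b) (hbc : b ≤ c)
    (hg : 0 ≤ g) :
    bsLambda δ s b c g - bsTheta δ s b c g =
      ∫ y in b..c, 2 * y * (1 - Real.exp (-(s * g * y ^ (-δ)))) := by
  rcases hg.eq_or_lt with rfl | hg
  · have : (0 : ℝ) ^ (2 / δ) = 0 := Real.zero_rpow (by positivity)
    simp [bsLambda, bsTheta, this]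
  have hu : 0 < s * g := by positivity
  set u := s * g with hu'
  have hpos : ∀ y ∈ uIcc b c, 0 < y := fun y hy => by
    rw [uIcc_of_le hbc] at hy
    exact hb.trans_le hy.1
  have hd : ∀ y ∈ uIcc b c, HasDerivAt (fun y : ℝ => y ^ 2 * (1 - Real.exp (-(u * y ^ (-δ)))) +
      u ^ (2 / δ) * upperGamma (-(2 / δ) + 1) (u * y ^ (-δ)))
      (2 * y * (1 - Real.exp (-(u * y ^ (-δ))))) y := by
    intro y hy
    have hy := hpos y hy
    have h1 : HasDerivAt (fun y : ℝ => u * y ^ (-δ)) (u * (-δ * y ^ (-δ - 1))) y :=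
      (Real.hasDerivAt_rpow_const (Or.inl hy.ne')).const_mul u
    have hx : 0 < u * y ^ (-δ) := by positivity
    have h2 := (hasDerivAt_upperGamma (-(2 / δ) + 1) hx).comp y h1
    have h3 := ((hasDerivAt_pow 2 y).mul (h1.neg.exp.const_sub 1)).add (h2.const_mul (u ^ (2 / δ)))
    refine h3.congr_deriv ?_
    have e1 : (u * y ^ (-δ)) ^ (-(2 / δ) + 1 - 1) = (u ^ (2 / δ))⁻¹ * y ^ 2 := by
      rw [add_sub_cancel_right, Real.mul_rpow hu.le (by positivity), ← Real.rpow_mul hy.le,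
        Real.rpow_neg hu.le, show -δ * -(2 / δ) = 2 by field_simp, Real.rpow_two]
    have e2 : u ^ (2 / δ) ≠ 0 := by positivity
    rw [e1]
    simp only [Pi.neg_apply]
    field_simp
    ring
  rw [intervalIntegral.integral_eq_sub_of_hasDerivAt hd]
  · simp only [bsLambda, bsTheta, ← hu']
    ring
  · refine ContinuousOn.intervalIntegrable fun y hy => ContinuousAt.continuousWithinAt ?_
    have : ContinuousAt (fun y : ℝ => y ^ (-δ)) y :=
      Real.continuousAt_rpow_const _ _ (Or.inl (hpos y hy).ne')
    fun_prop

/-- The Laplace transform of the interfering fading. -/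
noncomputable def fadingLaplace (ν : Measure ℝ) (s : ℝ) : ℝ := ∫ g, Real.exp (-(s * g)) ∂ν

lemma integrable_exp_neg_fading {ν : Measure ℝ} [IsProbabilityMeasure ν] (hν : ∀ᵐ g ∂ν, 0 ≤ g)
    {s : ℝ} (hs : 0 ≤ s) :
    Integrable (fun g => Real.exp (-(s * g))) ν := by
  refine Integrable.mono' (integrable_const 1) (by fun_prop) ?_
  filter_upwards [hν] with g hg
  rw [Real.norm_of_nonneg (Real.exp_pos _).le]
  exact Real.exp_le_one_iff.2 (by nlinarith [mul_nonneg hs hg])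

lemma fadingLaplace_nonneg {ν : Measure ℝ} (s : ℝ) : 0 ≤ fadingLaplace ν s :=
  integral_nonneg fun _ => (Real.exp_pos _).le

lemma fadingLaplace_le_one {ν : Measure ℝ} [IsProbabilityMeasure ν] (hν : ∀ᵐ g ∂ν, 0 ≤ g)
    {s : ℝ} (hs : 0 ≤ s) : fadingLaplace ν s ≤ 1 := by
  have : fadingLaplace ν s ≤ ∫ _, (1 : ℝ) ∂ν := by
    refine integral_mono_ae (integrable_exp_neg_fading hν hs) (integrable_const 1) ?_
    filter_upwards [hν] with g hg
    exact Real.exp_le_one_iff.2 (by nlinarith [mul_nonneg hs hg])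
  simpa using this

lemma measurable_fadingLaplace {ν : Measure ℝ} [SFinite ν] : Measurable (fadingLaplace ν) := by
  refine StronglyMeasurable.measurable ?_
  refine StronglyMeasurable.integral_prod_right (f := fun s g => Real.exp (-(s * g)))
    (Measurable.stronglyMeasurable ?_)
  simp only [Function.uncurry_def]
  fun_prop

lemma continuousOn_fadingLaplace {ν : Measure ℝ} [IsProbabilityMeasure ν] (hν : ∀ᵐ g ∂ν, 0 ≤ g) :
    ContinuousOn (fadingLaplace ν) (Ici 0) := by
  refine continuousOn_of_dominated (bound := fun _ => 1)
    (fun s _ => Measurable.aestronglyMeasurable (by fun_prop)) (fun s hs => ?_) (integrable_const 1)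
    (ae_of_all _ fun g => by fun_prop)
  filter_upwards [hν] with g hg
  rw [Real.norm_of_nonneg (Real.exp_pos _).le]
  exact Real.exp_le_one_iff.2 (by nlinarith [mul_nonneg (mem_Ici.1 hs) hg])

/-- `bsXi` is the area between the radii, weighted by the mean probability that an interferer
there prevents the coverage. -/
lemma bsXi_eq_setIntegral {ν : Measure ℝ} [IsProbabilityMeasure ν] {δ s b c : ℝ}
    (hν : ∀ᵐ g ∂ν, 0 ≤ g) (hδ : 0 < δ) (hs : 0 < s) (hb : 0 < b) (hbc : b ≤ c) :
    bsXi ν δ s b c = 2 * Real.pi * ∫ y in Ioo b c, y * (1 - fadingLaplace ν (s * y ^ (-δ))) := by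
  have h1 : ∫ g, (bsLambda δ s b c g - bsTheta δ s b c g) ∂ν =
      ∫ g, (∫ y in Ioo b c, 2 * y * (1 - Real.exp (-(s * g * y ^ (-δ))))) ∂ν := by
    refine integral_congr_ae ?_
    filter_upwards [hν] with g hg
    rw [bsLambda_sub_bsTheta hδ hs hb hbc hg, intervalIntegral.integral_of_le hbc,
      integral_Ioc_eq_integral_Ioo]
  have hint : Integrable (Function.uncurry fun g y : ℝ =>
      2 * y * (1 - Real.exp (-(s * g * y ^ (-δ))))) (ν.prod (volume.restrict (Ioo b c))) := by
    refine Integrable.mono' (integrable_const (2 * c))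
      (Measurable.aestronglyMeasurable (by simp only [Function.uncurry_def]; fun_prop)) ?_
    have hg := (Measure.quasiMeasurePreserving_fst (μ := ν)
      (ν := volume.restrict (Ioo b c))).ae hν
    have hy := (Measure.quasiMeasurePreserving_snd (μ := ν) (ν := volume.restrict (Ioo b c))).ae
      (ae_restrict_mem measurableSet_Ioo)
    filter_upwards [hg, hy] with p hp1 hp2
    have hy0 : 0 < p.2 := hb.trans hp2.1
    have h0 : 0 ≤ s * p.1 * p.2 ^ (-δ) := by positivity
    have h2 := Real.exp_le_one_iff.2 (neg_nonpos.2 h0)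
    have h3 := Real.exp_pos (-(s * p.1 * p.2 ^ (-δ)))
    simp only [Function.uncurry_def]
    rw [Real.norm_of_nonneg (mul_nonneg (by positivity) (by linarith))]
    have := hp2.2
    nlinarith
  rw [bsXi, h1, integral_integral_swap hint, mul_comm (2 : ℝ) Real.pi, mul_assoc]
  congr 1
  rw [← integral_const_mul]
  refine setIntegral_congr_fun measurableSet_Ioo fun y hy => ?_
  have hy0 : 0 < y := hb.trans hy.1
  have h0 : 0 ≤ s * y ^ (-δ) := by positivity
  rw [integral_const_mul, integral_sub (integrable_const 1), integral_const]
  · simp only [probReal_univ, smul_eq_mul, mul_one, fadingLaplace, mul_assoc]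
    congr! 8
    ring
  · refine (integrable_exp_neg_fading hν h0).congr (ae_of_all _ fun g => ?_)
    simp only
    congr 2
    ring

/-! ### Screened areas -/

/-- The weight with which a station at distance `x` lowers the coverage by a station at distance
`r`, when the interference acts through the factor `G r x`: full weight if the station is the
nearer one, and `1 - G r x` otherwise. -/
noncomputable def screen (G : ℝ → ℝ → ℝ) (r x : ℝ) : ℝ := if x ≤ r then 1 else 1 - G r x

/-- The integral of the weight `screen` over a region of the plane. -/
noncomputable def screenedArea (G : ℝ → ℝ → ℝ) (B : Set Plane) (r : ℝ) : ℝ :=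
  ∫ y in B, screen G r ‖y‖

/-- A measurable function of two distances with values in `[0, 1]`. -/
structure IsInterferenceFactor (G : ℝ → ℝ → ℝ) : Prop where
  measurable : Measurable (Function.uncurry G)
  nonneg : ∀ r x, 0 ≤ r → 0 ≤ x → 0 ≤ G r x
  le_one : ∀ r x, 0 ≤ r → 0 ≤ x → G r x ≤ 1

/-- The Laplace factor by which an interferer at distance `x` lowers the coverage by a station at
distance `r`. -/
noncomputable def linkFactor (ν : Measure ℝ) (δ q r x : ℝ) : ℝ :=
  fadingLaplace ν (q * r ^ δ * x ^ (-δ))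

/-- The factor by which the noise lowers the coverage by a station at distance `r`. -/
noncomputable def noiseFactor (q δ N₀ r : ℝ) : ℝ := Real.exp (-(q * r ^ δ * N₀))

lemma isInterferenceFactor_linkFactor {ν : Measure ℝ} [IsProbabilityMeasure ν]
    (hν : ∀ᵐ g ∂ν, 0 ≤ g) (δ : ℝ) {q : ℝ} (hq : 0 ≤ q) :
    IsInterferenceFactor (linkFactor ν δ q) where
  measurable := by
    simp only [Function.uncurry_def, linkFactor]
    exact measurable_fadingLaplace.comp (by fun_prop)
  nonneg _ _ _ _ := fadingLaplace_nonneg _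
  le_one _ _ hr hx := fadingLaplace_le_one hν (by positivity)

lemma isInterferenceFactor_one : IsInterferenceFactor fun _ _ => 1 where
  measurable := measurable_const
  nonneg _ _ _ _ := zero_le_one
  le_one _ _ _ _ := le_rfl

namespace IsInterferenceFactor

variable {G : ℝ → ℝ → ℝ}

lemma measurable_screen (hG : IsInterferenceFactor G) :
    Measurable (Function.uncurry (screen G)) := by
  simp only [Function.uncurry_def, screen]
  exact Measurable.ite (measurableSet_le measurable_snd measurable_fst) measurable_const
    (measurable_const.sub hG.measurable)

lemma screen_nonneg (hG : IsInterferenceFactor G) {r x : ℝ} (hr : 0 ≤ r) (hx : 0 ≤ x) :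
    0 ≤ screen G r x := by
  rw [screen]
  split_ifs
  · exact zero_le_one
  · linarith [hG.le_one r x hr hx]

lemma screen_le_one (hG : IsInterferenceFactor G) {r x : ℝ} (hr : 0 ≤ r) (hx : 0 ≤ x) :
    screen G r x ≤ 1 := by
  rw [screen]
  split_ifs
  · exact le_rfl
  · linarith [hG.nonneg r x hr hx]

lemma integrableOn_screen (hG : IsInterferenceFactor G) {r : ℝ} (hr : 0 ≤ r) (b c : ℝ) :
    IntegrableOn (fun y : Plane => screen G r ‖y‖) (ring b c) := by
  refine Integrable.mono' (integrable_const 1) ?_ (ae_of_all _ fun y => ?_)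
  · have := hG.measurable_screen.comp
      ((measurable_const (a := r)).prodMk (measurable_norm (α := Plane)))
    exact this.aestronglyMeasurable
  · rw [Real.norm_of_nonneg (hG.screen_nonneg hr (norm_nonneg y))]
    exact hG.screen_le_one hr (norm_nonneg y)

lemma measurable_screenedArea (hG : IsInterferenceFactor G) (B : Set Plane) :
    Measurable (screenedArea G B) := by
  refine StronglyMeasurable.measurable ?_
  refine StronglyMeasurable.integral_prod_right (f := fun r (y : Plane) => screen G r ‖y‖)
    (Measurable.stronglyMeasurable ?_)
  exact hG.measurable_screen.comp (measurable_fst.prodMk measurable_snd.norm)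

lemma screenedArea_nonneg (hG : IsInterferenceFactor G) {r : ℝ} (hr : 0 ≤ r) (B : Set Plane) :
    0 ≤ screenedArea G B r :=
  integral_nonneg fun y => hG.screen_nonneg hr (norm_nonneg y)

lemma screenedArea_le (hG : IsInterferenceFactor G) {r : ℝ} (hr : 0 ≤ r) (b c : ℝ) :
    screenedArea G (ring b c) r ≤ volume.real (ring b c) := by
  have := setIntegral_mono (hG.integrableOn_screen hr b c) (integrable_const (1 : ℝ))
    fun y => hG.screen_le_one hr (norm_nonneg y)
  simpa [screenedArea] using this

lemma le_screenedArea (hG : IsInterferenceFactor G) {r R : ℝ} (hr : 0 ≤ r) (hrR : r ≤ R) :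
    Real.pi * r ^ 2 ≤ screenedArea G (innerDisc R) r := by
  rw [innerDisc_eq_ring]
  have h1 : ∫ y in ring 0 r, screen G r ‖y‖ = Real.pi * r ^ 2 := by
    have : ∫ y in ring 0 r, screen G r ‖y‖ = ∫ y in ring 0 r, (1 : ℝ) :=
      setIntegral_congr_fun (measurableSet_ring _ _) fun y hy => by
        simp [screen, hy.2.le]
    rw [this, setIntegral_const, volume_real_ring le_rfl hr]
    simp
  rw [← h1]
  refine setIntegral_mono_set (hG.integrableOn_screen hr 0 R)
    (ae_of_all _ fun y => hG.screen_nonneg hr (norm_nonneg y)) (ae_of_all _ fun y hy => ?_)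
  exact ⟨hy.1, lt_of_lt_of_le hy.2 hrR⟩

end IsInterferenceFactor

lemma screenedArea_annulus {ν : Measure ℝ} [IsProbabilityMeasure ν] (hν : ∀ᵐ g ∂ν, 0 ≤ g)
    {δ q r R a : ℝ} (hδ : 0 < δ) (hq : 0 < q) (hr : 0 < r) (hrR : r < R) (ha : 1 ≤ a) :
    screenedArea (linkFactor ν δ q) (outerAnnulus R a) r = bsXi ν δ (q * r ^ δ) R (a * R) := by
  have hR : 0 < R := hr.trans hrR
  rw [screenedArea, outerAnnulus_eq_ring, setIntegral_ring hR.le,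
    bsXi_eq_setIntegral hν hδ (by positivity) hR (le_mul_of_one_le_left hR.le ha)]
  congr 1
  refine setIntegral_congr_fun measurableSet_Ioo fun y hy => ?_
  have : ¬ y ≤ r := not_le.2 (hrR.trans hy.1)
  simp [screen, this, linkFactor]

lemma screenedArea_disc {ν : Measure ℝ} [IsProbabilityMeasure ν] (hν : ∀ᵐ g ∂ν, 0 ≤ g)
    {δ q r R : ℝ} (hδ : 0 < δ) (hq : 0 < q) (hr : 0 < r) (hrR : r < R) :
    screenedArea (linkFactor ν δ q) (innerDisc R) r =
      bsXi ν δ (q * r ^ δ) r R + Real.pi * r ^ 2 := by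
  have hG := isInterferenceFactor_linkFactor hν δ hq.le
  have hun : ring 0 R = ring 0 r ∪ ring r R := by
    ext y
    simp only [ring, mem_ofPred_eq, mem_union]
    constructor
    · rintro ⟨h1, h2⟩
      rcases lt_or_ge ‖y‖ r with h | h
      · exact Or.inl ⟨h1, h⟩
      · exact Or.inr ⟨h, h2⟩
    · rintro (⟨h1, h2⟩ | ⟨h1, h2⟩)
      · exact ⟨h1, h2.trans hrR⟩
      · exact ⟨hr.le.trans h1, h2⟩
  have hdisj : Disjoint (ring 0 r) (ring r R) :=
    disjoint_left.2 fun y h1 h2 => absurd h2.1 (not_le.2 h1.2)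
  rw [screenedArea, innerDisc_eq_ring, hun, setIntegral_union hdisj (measurableSet_ring _ _)
    (hG.integrableOn_screen hr.le _ _) (hG.integrableOn_screen hr.le _ _), add_comm]
  congr 1
  · rw [setIntegral_ring hr.le, bsXi_eq_setIntegral hν hδ (by positivity) hr hrR.le]
    congr 1
    refine setIntegral_congr_fun measurableSet_Ioo fun y hy => ?_
    have : ¬ y ≤ r := not_le.2 hy.1
    simp [screen, this, linkFactor]
  · have : ∫ y in ring 0 r, screen (linkFactor ν δ q) r ‖y‖ = ∫ y in ring 0 r, (1 : ℝ) :=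
      setIntegral_congr_fun (measurableSet_ring _ _) fun y hy => by
        simp [screen, hy.2.le]
    rw [this, setIntegral_const, volume_real_ring le_rfl hr.le]
    simp

/-! ### Coverage for fixed positions of the stations -/

/-- The sum over the stations `i` of the inner disc that are strictly nearest (there is at most
one) of `F ‖x i‖ ∏ G ‖x i‖ ‖x j‖`, the product extending over the other stations. -/
noncomputable def nearestSum {ι : Type*} [Fintype ι] (F : ℝ → ℝ) (G : ℝ → ℝ → ℝ) (R : ℝ)
    (x : ι → Plane) : ℝ :=
  open Classical in ∑ i, if (∀ j, j ≠ i → ‖x i‖ < ‖x j‖) ∧ x i ∈ innerDisc R then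
    F ‖x i‖ * ∏ j ∈ Finset.univ.erase i, G ‖x i‖ ‖x j‖ else 0

lemma nearestSum_eq_of_nearest {ι : Type*} [Fintype ι] [DecidableEq ι] {F : ℝ → ℝ}
    {G : ℝ → ℝ → ℝ} {R : ℝ} {x : ι → Plane} {i : ι} (hi : ∀ j, j ≠ i → ‖x i‖ < ‖x j‖)
    (hR : x i ∈ innerDisc R) :
    nearestSum F G R x = F ‖x i‖ * ∏ j ∈ Finset.univ.erase i, G ‖x i‖ ‖x j‖ := by
  classical
  rw [nearestSum, Finset.sum_eq_single i]
  · rw [if_pos ⟨hi, hR⟩]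
    congr!
  · intro k _ hk
    exact if_neg fun h => lt_asymm (hi k hk) (h.1 i hk.symm)
  · simp

lemma nearestSum_eq_zero {ι : Type*} [Fintype ι] {F : ℝ → ℝ}
    {G : ℝ → ℝ → ℝ} {R : ℝ} {x : ι → Plane}
    (h : ∀ i, (∀ j, j ≠ i → ‖x i‖ < ‖x j‖) → x i ∉ innerDisc R) :
    nearestSum F G R x = 0 := by
  classical
  rw [nearestSum]
  exact Finset.sum_eq_zero fun i _ => if_neg fun hi => h i hi.1 hi.2

lemma measurable_interference {ι : Type*} [Fintype ι] (δ : ℝ) (i : ι) :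
    Measurable fun p : (ι → Plane) × (ι → ℝ) => interference δ p.1 p.2 i := by
  unfold interference
  fun_prop

lemma measurableSet_covered {ι : Type*} [Fintype ι] (R δ N₀ T : ℝ) :
    MeasurableSet {p : (ι → Plane) × (ι → ℝ) × ℝ | Covered R δ N₀ T p.1 p.2.1 p.2.2} := by
  have hx : ∀ i, Measurable fun p : (ι → Plane) × (ι → ℝ) × ℝ => p.1 i := fun i => by fun_prop
  have hs : ∀ i, Measurable fun p : (ι → Plane) × (ι → ℝ) × ℝ => sinr δ N₀ p.1 p.2.1 p.2.2 i := by
    intro i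
    refine Measurable.div ?_ ?_
    · exact (measurable_snd.snd.mul ((hx i).norm.pow_const _)).ennreal_ofReal
    · have := (measurable_interference δ i).comp
        (measurable_fst.prodMk measurable_snd.fst :
          Measurable fun p : (ι → Plane) × (ι → ℝ) × ℝ => (p.1, p.2.1))
      exact (measurable_const.add this).ennreal_ofReal
  have : {p : (ι → Plane) × (ι → ℝ) × ℝ | Covered R δ N₀ T p.1 p.2.1 p.2.2} =
      ⋃ i, {p | p.1 i ∈ innerDisc R} ∩ ((⋂ j, {p | ‖p.1 i‖ ≤ ‖p.1 j‖}) ∩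
        {p | ENNReal.ofReal T < sinr δ N₀ p.1 p.2.1 p.2.2 i}) := by
    ext p
    simp [Covered]
  rw [this]
  refine MeasurableSet.iUnion fun i => ?_
  refine MeasurableSet.inter (hx i (measurableSet_innerDisc R)) (MeasurableSet.inter ?_ ?_)
  · exact MeasurableSet.iInter fun j => measurableSet_le (hx i).norm (hx j).norm
  · exact measurableSet_lt measurable_const (hs i)

lemma expMeasure_real_Ioi {ζ : ℝ} (hζ : 0 < ζ) {c : ℝ} (hc : 0 ≤ c) :
    (expMeasure ζ).real (Ioi c) = Real.exp (-(ζ * c)) := by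
  have := isProbabilityMeasure_expMeasure hζ
  have h := cdf_expMeasure_eq hζ c
  rw [cdf_eq_real, if_pos hc] at h
  rw [← compl_Iic, probReal_compl_eq_one_sub measurableSet_Iic, h]
  ring

lemma interference_nonneg {ι : Type*} [Fintype ι] {δ : ℝ} {x : ι → Plane} {g : ι → ℝ}
    (hg : ∀ j, 0 ≤ g j) (i : ι) : 0 ≤ interference δ x g i := by
  unfold interference
  exact Finset.sum_nonneg fun j _ => mul_nonneg (hg j) (by positivity)

/-- The SINR condition is a lower bound for the fading of the serving link. -/
lemma lt_sinr_iff {ι : Type*} [Fintype ι] {δ N₀ T : ℝ} (hT : 0 < T) (hN : 0 ≤ N₀)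
    {x : ι → Plane} {g : ι → ℝ} (hg : ∀ j, 0 ≤ g j) {h : ℝ} {i : ι} (hi : x i ≠ 0) :
    ENNReal.ofReal T < sinr δ N₀ x g h i ↔
      T * ‖x i‖ ^ δ * (N₀ + interference δ x g i) < h := by
  have hI : 0 ≤ interference δ x g i := interference_nonneg hg i
  have hr : 0 < ‖x i‖ := norm_pos_iff.2 hi
  have hrd : 0 < ‖x i‖ ^ δ := by positivity
  have key : T * ‖x i‖ ^ δ * (N₀ + interference δ x g i) < h ↔
      T * (N₀ + interference δ x g i) < h * ‖x i‖ ^ (-δ) := by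
    rw [Real.rpow_neg hr.le, ← div_eq_mul_inv, lt_div_iff₀ hrd]
    ring_nf
  rw [key, sinr]
  rcases (add_nonneg hN hI).eq_or_lt with h0 | h0
  -- without noise and interference the SINR is `∞` or `0`, according to the sign of the signal
  · rw [← h0, mul_zero, ENNReal.ofReal_zero]
    rcases lt_or_ge 0 (h * ‖x i‖ ^ (-δ)) with hp | hp
    · rw [ENNReal.div_zero (ENNReal.ofReal_pos.2 hp).ne']
      simp [hp]
    · rw [ENNReal.ofReal_of_nonpos hp]
      simp [hp.not_gt]
  · rw [← ENNReal.ofReal_div_of_pos h0, ENNReal.ofReal_lt_ofReal_iff_of_nonneg hT.le,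
      lt_div_iff₀ h0]

lemma exp_neg_mul_interference {ι : Type*} [Fintype ι] [DecidableEq ι] (c δ : ℝ) (x : ι → Plane)
    (g : ι → ℝ) (i : ι) :
    Real.exp (-(c * interference δ x g i)) =
      ∏ j, if j = i then (1 : ℝ) else Real.exp (-(c * ‖x j‖ ^ (-δ) * g j)) := by
  rw [← Finset.prod_erase Finset.univ (a := i) (by simp), interference, Finset.mul_sum,
    ← Finset.sum_neg_distrib, Real.exp_sum]
  refine Finset.prod_congr (by congr!) fun j hj => ?_
  rw [if_neg (Finset.ne_of_mem_erase hj)]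
  congr 2
  ring

lemma integral_prod_fading {ι : Type*} [Fintype ι] [DecidableEq ι] (ν : Measure ℝ)
    [IsProbabilityMeasure ν] (c : ι → ℝ) (i : ι) :
    ∫ g, (∏ j, if j = i then (1 : ℝ) else Real.exp (-(c j * g j))) ∂(Measure.pi fun _ : ι => ν) =
      ∏ j ∈ Finset.univ.erase i, fadingLaplace ν (c j) := by
  rw [integral_fintype_prod_eq_prod
    (f := fun j (g : ℝ) => if j = i then (1 : ℝ) else Real.exp (-(c j * g))),
    ← Finset.prod_erase Finset.univ (a := i) (by simp)]
  refine Finset.prod_congr rfl fun j hj => ?_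
  simp only [if_neg (Finset.ne_of_mem_erase hj)]
  rfl

/-- Only the strictly nearest station can cover the user, and it does so when the fading of its
link exceeds a threshold. -/
lemma covered_iff_of_nearest {ι : Type*} [Fintype ι] {R δ T N₀ : ℝ} (hT : 0 < T) (hN : 0 ≤ N₀)
    {x : ι → Plane} {i : ι} (hxi : x i ≠ 0) (hi : ∀ j, j ≠ i → ‖x i‖ < ‖x j‖)
    (hiR : x i ∈ innerDisc R) {g : ι → ℝ} (hg : ∀ j, 0 ≤ g j) (h : ℝ) :
    Covered R δ N₀ T x g h ↔ T * ‖x i‖ ^ δ * (N₀ + interference δ x g i) < h := by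
  rw [← lt_sinr_iff hT hN hg hxi]
  constructor
  · rintro ⟨k, -, hk, hs⟩
    have : k = i := by
      by_contra hne
      exact (hi k hne).not_ge (hk i)
    exact this ▸ hs
  · refine fun hs => ⟨i, hiR, fun j => ?_, hs⟩
    by_cases h : j = i
    · rw [h]
    · exact (hi j h).le

lemma measureReal_prod_eq {α β : Type*} [MeasurableSpace α] [MeasurableSpace β] {μ : Measure α}
    {ρ : Measure β} [IsFiniteMeasure μ] [IsFiniteMeasure ρ] {s : Set (α × β)}
    (hs : MeasurableSet s) : (μ.prod ρ).real s = ∫ x, ρ.real (Prod.mk x ⁻¹' s) ∂μ := by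
  rw [Measure.real, Measure.prod_apply hs, integral_eq_lintegral_of_nonneg_ae
    (ae_of_all _ fun _ => measureReal_nonneg)
    (measurable_measure_prodMk_left hs).ennreal_toReal.aestronglyMeasurable]
  congr 1
  refine lintegral_congr fun x => ?_
  simp [Measure.real]

/-- The coverage probability when only the fadings are random. -/
theorem coverage_of_positions {ι : Type*} [Fintype ι] {R δ ζ T N₀ : ℝ} {ν : Measure ℝ}
    (hζ : 0 < ζ) (hT : 0 < T) (hN : 0 ≤ N₀) [IsProbabilityMeasure ν] (hν : ∀ᵐ g ∂ν, 0 ≤ g)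
    {x : ι → Plane} (hx : ∀ i, x i ≠ 0)
    (htie : ∀ i, x i ∈ innerDisc R → (∀ j, ‖x i‖ ≤ ‖x j‖) → ∀ j, j ≠ i → ‖x i‖ < ‖x j‖) :
    ((Measure.pi fun _ : ι => ν).prod (expMeasure ζ)).real {p | Covered R δ N₀ T x p.1 p.2} =
      nearestSum (noiseFactor (ζ * T) δ N₀) (linkFactor ν δ (ζ * T)) R x := by
  classical
  have := isProbabilityMeasure_expMeasure hζ
  by_cases hex : ∃ i, (∀ j, j ≠ i → ‖x i‖ < ‖x j‖) ∧ x i ∈ innerDisc R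
  swap
  · push Not at hex
    rw [nearestSum_eq_zero hex]
    have : {p : (ι → ℝ) × ℝ | Covered R δ N₀ T x p.1 p.2} = ∅ := by
      refine eq_empty_of_forall_notMem ?_
      rintro p ⟨i, hi, hn, -⟩
      exact hex i (htie i hi hn) hi
    simp [this]
  obtain ⟨i, hi, hiR⟩ := hex
  rw [nearestSum_eq_of_nearest hi hiR]
  have hmeas : MeasurableSet {p : (ι → ℝ) × ℝ | Covered R δ N₀ T x p.1 p.2} :=
    measurable_prodMk_left (x := x) (measurableSet_covered (ι := ι) R δ N₀ T)
  have hpos : ∀ᵐ g ∂(Measure.pi fun _ : ι => ν), ∀ j, 0 ≤ g j :=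
    ae_all_iff.2 fun j => (Measure.quasiMeasurePreserving_eval (fun _ : ι => ν) j).ae hν
  have hsec : ∀ᵐ g ∂(Measure.pi fun _ : ι => ν),
      (expMeasure ζ).real (Prod.mk g ⁻¹' {p : (ι → ℝ) × ℝ | Covered R δ N₀ T x p.1 p.2}) =
      noiseFactor (ζ * T) δ N₀ ‖x i‖ * ∏ j, if j = i then (1 : ℝ) else
        Real.exp (-(ζ * T * ‖x i‖ ^ δ * ‖x j‖ ^ (-δ) * g j)) := by
    filter_upwards [hpos] with g hg
    have hI := interference_nonneg (δ := δ) (x := x) hg i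
    have e1 : Prod.mk g ⁻¹' {p : (ι → ℝ) × ℝ | Covered R δ N₀ T x p.1 p.2} =
        Ioi (T * ‖x i‖ ^ δ * (N₀ + interference δ x g i)) :=
      Set.ext fun h => covered_iff_of_nearest hT hN (hx i) hi hiR hg h
    rw [e1, expMeasure_real_Ioi hζ (by positivity), ← exp_neg_mul_interference, noiseFactor,
      ← Real.exp_add]
    congr 1
    ring
  rw [measureReal_prod_eq hmeas, integral_congr_ae hsec, integral_const_mul, integral_prod_fading]
  rfl

/-! ### Independent stations -/

lemma one_sub_screen (G : ℝ → ℝ → ℝ) (r x : ℝ) :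
    1 - screen G r x = if r < x then G r x else 0 := by
  rw [screen]
  by_cases h : x ≤ r
  · simp [h, not_lt.2 h]
  · simp [h, not_le.1 h]

/-- The indicator of being the strictly nearest station factorises over the other stations. -/
lemma nearestSum_eq_sum {ι : Type*} [Fintype ι] [DecidableEq ι] (F : ℝ → ℝ) (G : ℝ → ℝ → ℝ)
    (R : ℝ) (x : ι → Plane) :
    nearestSum F G R x = ∑ i, (innerDisc R).indicator (fun y => F ‖y‖) (x i) *
      ∏ j : {j // ¬ j = i}, (1 - screen G ‖x i‖ ‖x j‖) := by
  classical
  rw [nearestSum]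
  refine Finset.sum_congr rfl fun i _ => ?_
  have hprod : ∏ j : {j // ¬ j = i}, (1 - screen G ‖x i‖ ‖x j‖) =
      ∏ j ∈ Finset.univ.erase i, (1 - screen G ‖x i‖ ‖x j‖) := by
    exact (Finset.prod_subtype (p := fun j => ¬ j = i) (Finset.univ.erase i)
      (fun j => by simp) fun j => 1 - screen G ‖x i‖ ‖x j‖).symm
  rw [hprod]
  simp_rw [one_sub_screen]
  split_ifs with h
  · rw [indicator_of_mem h.2]
    congr 1
    refine Finset.prod_congr (by congr!) fun j hj => ?_
    rw [if_pos (h.1 j (Finset.ne_of_mem_erase hj))]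
  · by_cases hR : x i ∈ innerDisc R
    · have : ∃ j, j ≠ i ∧ ¬ ‖x i‖ < ‖x j‖ := by
        by_contra hc
        push Not at hc
        exact h ⟨hc, hR⟩
      obtain ⟨j, hj, hlt⟩ := this
      rw [Finset.prod_eq_zero (i := j) (by simp [hj]) (if_neg hlt), mul_zero]
    · rw [indicator_of_notMem hR, zero_mul]

/-- Integration over independent points, separating those with the property `p`, the integrand
depending on only one of these. -/
lemma integral_pi_single_out {ι : Type*} [Fintype ι] {X : Type*}
    [MeasurableSpace X] (κ : ι → Measure X) [∀ i, IsProbabilityMeasure (κ i)] {p : ι → Prop}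
    [DecidablePred p] {i : ι} (hi : p i) {u : X → ℝ}
    {v : X → X → ℝ} (hu : Measurable u) (hv : Measurable (Function.uncurry v))
    (hu1 : ∀ y, |u y| ≤ 1) (hv1 : ∀ y z, |v y z| ≤ 1) :
    ∫ x, u (x i) * ∏ j : {j // ¬ p j}, v (x i) (x j) ∂(Measure.pi κ) =
      ∫ y, u y * ∏ j : {j // ¬ p j}, ∫ z, v y z ∂(κ j) ∂(κ i) := by
  have hmp := measurePreserving_piEquivPiSubtypeProd κ (p)
  have hm : Measurable fun q : ({j // p j} → X) × ({j // ¬ p j} → X) =>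
      u (q.1 ⟨i, hi⟩) * ∏ j, v (q.1 ⟨i, hi⟩) (q.2 j) := by
    have h1 : Measurable fun q : ({j // p j} → X) × ({j // ¬ p j} → X) => q.1 ⟨i, hi⟩ :=
      (measurable_pi_apply _).comp measurable_fst
    refine (hu.comp h1).mul (Finset.measurable_prod _ fun j _ => ?_)
    exact hv.comp (h1.prodMk ((measurable_pi_apply j).comp measurable_snd))
  have h := hmp.integral_comp' (fun q : ({j // p j} → X) × ({j // ¬ p j} → X) =>
    u (q.1 ⟨i, hi⟩) * ∏ j, v (q.1 ⟨i, hi⟩) (q.2 j))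
  rw [integral_prod] at h
  · refine h.trans ?_
    simp_rw [integral_const_mul]
    have h2 : ∀ a : {j // p j} → X, ∫ b, ∏ j, v (a ⟨i, hi⟩) (b j)
        ∂(Measure.pi fun j : {j // ¬ p j} => κ j) = ∏ j : {j // ¬ p j},
          ∫ z, v (a ⟨i, hi⟩) z ∂(κ j) := fun a =>
      integral_fintype_prod_eq_prod (fun (j : {j // ¬ p j}) z => v (a ⟨i, hi⟩) z)
    simp_rw [h2]
    have h3 := (measurePreserving_eval (fun j : {j // p j} => κ j) ⟨i, hi⟩)
    have h4 : Measurable fun y => u y * ∏ j : {j // ¬ p j}, ∫ z, v y z ∂(κ j) := by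
      refine hu.mul (Finset.measurable_prod _ fun j _ => ?_)
      exact (StronglyMeasurable.integral_prod_right hv.stronglyMeasurable).measurable
    have h5 := integral_map (μ := Measure.pi fun j : {j // p j} => κ j)
      h3.measurable.aemeasurable (f := fun y => u y * ∏ j : {j // ¬ p j}, ∫ z, v y z ∂(κ j))
      h4.aestronglyMeasurable
    rw [h3.map_eq] at h5
    exact h5.symm
  · refine Integrable.mono' (integrable_const 1) hm.aestronglyMeasurable (ae_of_all _ fun q => ?_)
    rw [Real.norm_eq_abs, abs_mul, Finset.abs_prod]
    exact mul_le_one₀ (hu1 _) (by positivity)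
      (Finset.prod_le_one (fun _ _ => abs_nonneg _) fun _ _ => hv1 _ _)

lemma integrable_pi_single_out {ι : Type*} [Fintype ι] {X : Type*} [MeasurableSpace X]
    (κ : ι → Measure X) [∀ i, IsProbabilityMeasure (κ i)] (p : ι → Prop) [DecidablePred p] (i : ι)
    {u : X → ℝ} {v : X → X → ℝ} (hu : Measurable u) (hv : Measurable (Function.uncurry v))
    (hu1 : ∀ y, |u y| ≤ 1) (hv1 : ∀ y z, |v y z| ≤ 1) :
    Integrable (fun x : ι → X => u (x i) * ∏ j : {j // p j}, v (x i) (x j)) (Measure.pi κ) := by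
  have hm : Measurable fun x : ι → X => u (x i) * ∏ j : {j // p j}, v (x i) (x j) := by
    refine (hu.comp (measurable_pi_apply i)).mul (Finset.measurable_fun_prod _ fun j _ => ?_)
    have h3 : Measurable fun x : ι → X => (x i, x j.1) :=
      (measurable_pi_apply i).prodMk (measurable_pi_apply j.1)
    exact hv.comp h3
  refine Integrable.mono' (integrable_const 1) hm.aestronglyMeasurable (ae_of_all _ fun x => ?_)
  rw [Real.norm_eq_abs, abs_mul, Finset.abs_prod]
  exact mul_le_one₀ (hu1 _) (by positivity)
    (Finset.prod_le_one (fun _ _ => abs_nonneg _) fun _ _ => hv1 _ _)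

lemma ae_norm_ne_of_pi_aux {ι : Type*} [Fintype ι] (κ : ι → Measure Plane)
    [∀ i, IsProbabilityMeasure (κ i)] (hκ : ∀ i, κ i ≪ volume) {p : ι → Prop} [DecidablePred p]
    {i j : ι} (hi : p i) (hij : ¬ p j) : ∀ᵐ x ∂(Measure.pi κ), ‖x i‖ ≠ ‖x j‖ := by
  have hmp := measurePreserving_piEquivPiSubtypeProd κ (p)
  have hs : MeasurableSet {q : ({j // p j} → Plane) × ({j // ¬ p j} → Plane) |
      ‖q.1 ⟨i, hi⟩‖ ≠ ‖q.2 ⟨j, hij⟩‖} :=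
    (measurableSet_eq_fun ((measurable_pi_apply _).comp measurable_fst).norm
      ((measurable_pi_apply _).comp measurable_snd).norm).compl
  have h1 : ∀ᵐ q ∂((Measure.pi fun j : {j // p j} => κ j).prod
      (Measure.pi fun j : {j // ¬ p j} => κ j)), ‖q.1 ⟨i, hi⟩‖ ≠ ‖q.2 ⟨j, hij⟩‖ := by
    rw [Measure.ae_prod_iff_ae_ae hs]
    refine ae_of_all _ fun a => ?_
    have h0 : ∀ᵐ z ∂(κ j), ‖a ⟨i, hi⟩‖ ≠ ‖z‖ := by
      have := volume_norm_eq ‖a ⟨i, hi⟩‖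
      refine (hκ j).ae_le (ae_iff.2 ?_)
      simpa [eq_comm] using this
    exact (Measure.quasiMeasurePreserving_eval (fun j : {j // ¬ p j} => κ j) ⟨j, hij⟩).ae h0
  filter_upwards [hmp.quasiMeasurePreserving.ae h1] with x hx
  exact hx

/-- Independent points with diffuse laws have different distances from the origin. -/
lemma ae_norm_ne_of_pi {ι : Type*} [Fintype ι] (κ : ι → Measure Plane)
    [∀ i, IsProbabilityMeasure (κ i)] (hκ : ∀ i, κ i ≪ volume) :
    ∀ᵐ x ∂(Measure.pi κ), ∀ i j, j ≠ i → ‖x i‖ ≠ ‖x j‖ := by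
  classical
  refine ae_all_iff.2 fun i => ae_all_iff.2 fun j => ?_
  by_cases hij : j = i
  · exact ae_of_all _ fun x h => absurd hij h
  filter_upwards [ae_norm_ne_of_pi_aux κ hκ (p := fun k => k = i) rfl hij] with x hx _
  exact hx

lemma ae_ne_zero_of_pi {ι : Type*} [Fintype ι] (κ : ι → Measure Plane)
    [∀ i, IsProbabilityMeasure (κ i)] (hκ : ∀ i, κ i ≪ volume) :
    ∀ᵐ x ∂(Measure.pi κ), ∀ i, x i ≠ 0 := by
  refine ae_all_iff.2 fun i => ?_
  have h0 : ∀ᵐ z ∂(κ i), z ≠ 0 := (hκ i).ae_le (ae_iff.2 (by simp))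
  exact (Measure.quasiMeasurePreserving_eval κ i).ae h0

lemma integral_cond_ring {b c : ℝ} (f : Plane → ℝ) :
    ∫ y, f y ∂(ProbabilityTheory.cond volume (ring b c)) =
      (volume.real (ring b c))⁻¹ * ∫ y in ring b c, f y := by
  rw [ProbabilityTheory.cond, integral_smul_measure, ENNReal.toReal_inv, smul_eq_mul]
  rfl

lemma isProbabilityMeasure_cond_ring {b c : ℝ} (hb : 0 ≤ b) (hbc : b < c) :
    IsProbabilityMeasure (ProbabilityTheory.cond (volume : Measure Plane) (ring b c)) := by
  have hpos : 0 < volume.real (ring b c) := by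
    rw [volume_real_ring hb hbc.le]
    have : b ^ 2 < c ^ 2 := by nlinarith
    have := Real.pi_pos
    nlinarith
  exact cond_isProbabilityMeasure_of_finite
    (fun h => by simp [Measure.real, h] at hpos) (volume_ring_lt_top b c).ne

/-- The probability that a uniform station of the region `B` is farther than `r` and does not
prevent the coverage. -/
lemma integral_cond_one_sub_screen {G : ℝ → ℝ → ℝ} (hG : IsInterferenceFactor G) {r b c : ℝ}
    (hr : 0 ≤ r) (hb : 0 ≤ b) (hbc : b < c) :
    ∫ y, (1 - screen G r ‖y‖) ∂(ProbabilityTheory.cond volume (ring b c)) =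
      1 - screenedArea G (ring b c) r / volume.real (ring b c) := by
  have := isProbabilityMeasure_cond_ring hb hbc
  have hi : Integrable (fun y : Plane => screen G r ‖y‖)
      (ProbabilityTheory.cond volume (ring b c)) := by
    refine Integrable.mono' (integrable_const 1) ?_ (ae_of_all _ fun y => ?_)
    · exact (hG.measurable_screen.comp
        ((measurable_const (a := r)).prodMk (measurable_norm (α := Plane)))).aestronglyMeasurable
    · rw [Real.norm_of_nonneg (hG.screen_nonneg hr (norm_nonneg y))]
      exact hG.screen_le_one hr (norm_nonneg y)
  rw [integral_sub (integrable_const 1) hi, integral_const, integral_cond_ring, probReal_univ,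
    screenedArea, div_eq_inv_mul, one_smul]

lemma IsInterferenceFactor.abs_one_sub_screen_le {G : ℝ → ℝ → ℝ} (hG : IsInterferenceFactor G)
    {r x : ℝ} (hr : 0 ≤ r) (hx : 0 ≤ x) : |1 - screen G r x| ≤ 1 := by
  have := hG.screen_nonneg hr hx
  have := hG.screen_le_one hr hx
  rw [abs_le]
  constructor <;> linarith

/-- A measurable function of a distance with values in `[0, 1]`. -/
structure IsDistanceFactor (F : ℝ → ℝ) : Prop where
  measurable : Measurable F
  nonneg : ∀ r, 0 ≤ r → 0 ≤ F r
  le_one : ∀ r, 0 ≤ r → F r ≤ 1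

lemma isDistanceFactor_noiseFactor {q δ N₀ : ℝ} (hq : 0 ≤ q) (hN : 0 ≤ N₀) :
    IsDistanceFactor (noiseFactor q δ N₀) where
  measurable := by unfold noiseFactor; fun_prop
  nonneg _ _ := (Real.exp_pos _).le
  le_one _ hr := Real.exp_le_one_iff.2 (neg_nonpos.2 (by positivity))

lemma isDistanceFactor_one : IsDistanceFactor fun _ => 1 where
  measurable := measurable_const
  nonneg _ _ := zero_le_one
  le_one _ _ := le_rfl

lemma IsDistanceFactor.abs_indicator_le {F : ℝ → ℝ} (hF : IsDistanceFactor F) (R : ℝ) (y : Plane) :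
    |(innerDisc R).indicator (fun y => F ‖y‖) y| ≤ 1 := by
  by_cases h : y ∈ innerDisc R
  · rw [indicator_of_mem h, abs_of_nonneg (hF.nonneg _ (norm_nonneg y))]
    exact hF.le_one _ (norm_nonneg y)
  · simp [indicator_of_notMem h]

/-- The mean of `nearestSum` over independent positions. -/
lemma integral_nearestSum {ι : Type*} [Fintype ι] [DecidableEq ι] (κ : ι → Measure Plane)
    [∀ i, IsProbabilityMeasure (κ i)] {F : ℝ → ℝ} {G : ℝ → ℝ → ℝ} (hF : IsDistanceFactor F)
    (hG : IsInterferenceFactor G) (R : ℝ) :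
    ∫ x, nearestSum F G R x ∂(Measure.pi κ) =
      ∑ i, ∫ y, (innerDisc R).indicator (fun y => F ‖y‖) y *
        ∏ j : {j // ¬ j = i}, ∫ z, (1 - screen G ‖y‖ ‖z‖) ∂(κ j) ∂(κ i) := by
  have hum : Measurable ((innerDisc R).indicator fun y => F ‖y‖) :=
    (hF.measurable.comp measurable_norm).indicator (measurableSet_innerDisc R)
  have hvm : Measurable (Function.uncurry fun y z : Plane => 1 - screen G ‖y‖ ‖z‖) :=
    measurable_const.sub
      (hG.measurable_screen.comp (measurable_fst.norm.prodMk measurable_snd.norm))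
  have hv1 : ∀ y z : Plane, |1 - screen G ‖y‖ ‖z‖| ≤ 1 := fun y z =>
    hG.abs_one_sub_screen_le (norm_nonneg y) (norm_nonneg z)
  simp_rw [nearestSum_eq_sum]
  rw [integral_finsetSum]
  · exact Finset.sum_congr rfl fun i _ =>
      integral_pi_single_out κ (p := fun j => j = i) rfl hum hvm (hF.abs_indicator_le R) hv1
  · exact fun i _ => integrable_pi_single_out κ (fun j => ¬ j = i) i hum hvm
      (hF.abs_indicator_le R) hv1

/-- The coverage probability for fixed numbers of uniform stations, as an integral over the
position of the serving station. -/
theorem fixedCountCoverage_eq {a R δ ζ T N₀ : ℝ} {ν : Measure ℝ} (ha : 1 < a) (hR : 0 < R)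
    (hζ : 0 < ζ) (hT : 0 < T) (hN : 0 ≤ N₀) [IsProbabilityMeasure ν] (hν : ∀ᵐ g ∂ν, 0 ≤ g)
    (n m : ℕ) :
    fixedCountCoverage a R δ ζ T N₀ ν n m = n * ((volume.real (innerDisc R))⁻¹ *
      ∫ y in innerDisc R, noiseFactor (ζ * T) δ N₀ ‖y‖ *
        ((1 - screenedArea (linkFactor ν δ (ζ * T)) (innerDisc R) ‖y‖ /
          volume.real (innerDisc R)) ^ (n - 1) *
        (1 - screenedArea (linkFactor ν δ (ζ * T)) (outerAnnulus R a) ‖y‖ /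
          volume.real (outerAnnulus R a)) ^ m)) := by
  classical
  have hG := isInterferenceFactor_linkFactor hν δ (mul_pos hζ hT).le
  have := isProbabilityMeasure_expMeasure hζ
  have hRa : R < a * R := by nlinarith
  have hp1 : IsProbabilityMeasure (ProbabilityTheory.cond (volume : Measure Plane) (innerDisc R)) :=
    innerDisc_eq_ring R ▸ isProbabilityMeasure_cond_ring le_rfl hR
  have hp2 : IsProbabilityMeasure
      (ProbabilityTheory.cond (volume : Measure Plane) (outerAnnulus R a)) :=
    isProbabilityMeasure_cond_ring hR.le hRa
  set κ : Fin n ⊕ Fin m → Measure Plane := fun i =>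
      Sum.elim (fun _ => ProbabilityTheory.cond (volume : Measure Plane) (innerDisc R))
        (fun _ => ProbabilityTheory.cond (volume : Measure Plane) (outerAnnulus R a)) i with hκ
  have hprob : ∀ i, IsProbabilityMeasure (κ i) := by
    rintro (i | i)
    · exact hp1
    · exact hp2
  have hac : ∀ i, κ i ≪ volume := by
    rintro (i | i) <;> exact cond_absolutelyContinuous
  have hF := isDistanceFactor_noiseFactor (δ := δ) (mul_pos hζ hT).le hN
  have h1 : ∀ᵐ x ∂(Measure.pi κ),
      ((Measure.pi fun _ : Fin n ⊕ Fin m => ν).prod (expMeasure ζ)).real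
        (Prod.mk x ⁻¹' {p | Covered R δ N₀ T p.1 p.2.1 p.2.2}) =
      nearestSum (noiseFactor (ζ * T) δ N₀) (linkFactor ν δ (ζ * T)) R x := by
    filter_upwards [ae_norm_ne_of_pi κ hac, ae_ne_zero_of_pi κ hac] with x hx1 hx2
    exact coverage_of_positions hζ hT hN hν hx2 fun i _ hi j hj => (hi j).lt_of_ne (hx1 i j hj)
  rw [fixedCountCoverage, measureReal_prod_eq (measurableSet_covered R δ N₀ T),
    integral_congr_ae h1, integral_nearestSum κ hF hG]
  generalize noiseFactor (ζ * T) δ N₀ = F at *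
  generalize linkFactor ν δ (ζ * T) = G at *
  rw [Fintype.sum_sum_type]
  have hinr : ∀ i : Fin m, ∫ y, (innerDisc R).indicator (fun y => F ‖y‖) y *
      ∏ j : {j : Fin n ⊕ Fin m // ¬ j = Sum.inr i}, ∫ z, (1 - screen G ‖y‖ ‖z‖) ∂(κ j)
        ∂(κ (Sum.inr i)) = 0 := by
    intro i
    refine integral_eq_zero_of_ae ?_
    have : ∀ᵐ y ∂(κ (Sum.inr i)), y ∈ outerAnnulus R a :=
      ae_cond_mem (measurableSet_outerAnnulus R a)
    filter_upwards [this] with y hy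
    have : y ∉ innerDisc R := fun h => (lt_irrefl R) (hy.1.trans_lt h)
    simp [indicator_of_notMem this]
  have hinl : ∀ i : Fin n, ∫ y, (innerDisc R).indicator (fun y => F ‖y‖) y *
      ∏ j : {j : Fin n ⊕ Fin m // ¬ j = Sum.inl i}, ∫ z, (1 - screen G ‖y‖ ‖z‖) ∂(κ j)
        ∂(κ (Sum.inl i)) = (volume.real (innerDisc R))⁻¹ *
      ∫ y in innerDisc R, F ‖y‖ *
        ((1 - screenedArea G (innerDisc R) ‖y‖ / volume.real (innerDisc R)) ^ (n - 1) *
        (1 - screenedArea G (outerAnnulus R a) ‖y‖ / volume.real (outerAnnulus R a)) ^ m) := by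
    intro i
    have hprod : ∀ y : Plane, ∏ j : {j : Fin n ⊕ Fin m // ¬ j = Sum.inl i},
        ∫ z, (1 - screen G ‖y‖ ‖z‖) ∂(κ j) =
        (1 - screenedArea G (innerDisc R) ‖y‖ / volume.real (innerDisc R)) ^ (n - 1) *
        (1 - screenedArea G (outerAnnulus R a) ‖y‖ / volume.real (outerAnnulus R a)) ^ m := by
      intro y
      rw [← Finset.prod_subtype ((Finset.univ.erase i).disjSum Finset.univ)
        (fun j => by rcases j with j | j <;> simp) (fun j => ∫ z, (1 - screen G ‖y‖ ‖z‖) ∂(κ j)),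
        Finset.prod_disjSum]
      simp only [hκ, Sum.elim_inl, Sum.elim_inr, Finset.prod_const, Finset.card_univ,
        Fintype.card_fin, Finset.card_erase_of_mem (Finset.mem_univ i)]
      rw [innerDisc_eq_ring, outerAnnulus_eq_ring,
        integral_cond_one_sub_screen hG (norm_nonneg y) le_rfl hR,
        integral_cond_one_sub_screen hG (norm_nonneg y) hR.le hRa]
    simp_rw [hprod]
    simp only [hκ, Sum.elim_inl]
    rw [innerDisc_eq_ring, integral_cond_ring]
    congr 1
    refine setIntegral_congr_fun (measurableSet_ring _ _) fun y hy => ?_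
    simp only [indicator_of_mem hy]
  simp only [hinr, hinl, Finset.sum_const_zero, add_zero, Finset.sum_const, Finset.card_univ,
    Fintype.card_fin, nsmul_eq_mul]

/-! ### The mixture over Poisson numbers of stations -/

/-- The contribution of serving stations at distance `r` to the coverage probability, for
the densities `l` and `lS`. -/
noncomputable def coverageDensity (F : ℝ → ℝ) (G : ℝ → ℝ → ℝ) (R a l lS r : ℝ) : ℝ :=
  l * F r *
    Real.exp (-(l * screenedArea G (innerDisc R) r) - lS * screenedArea G (outerAnnulus R a) r)

lemma hasSum_poissonWeight_mul_pow (t z : ℝ) :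
    HasSum (fun n => poissonWeight t n * z ^ n) (Real.exp (-(t * (1 - z)))) := by
  have h := (NormedSpace.expSeries_div_hasSum_exp (t * z)).mul_left (Real.exp (-t))
  rw [← Real.exp_eq_exp_ℝ, ← Real.exp_add] at h
  convert! h using 1
  · ext n
    rw [poissonWeight, mul_pow]
    ring
  · congr 1
    ring

lemma poissonWeight_succ_mul (t : ℝ) (n : ℕ) :
    poissonWeight t (n + 1) * (n + 1 : ℕ) = t * poissonWeight t n := by
  have : ((n + 1 : ℕ) : ℝ) ≠ 0 := by positivity
  rw [poissonWeight, poissonWeight, Nat.factorial_succ, pow_succ]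
  push_cast at this ⊢
  field_simp

lemma hasSum_poissonWeight_mul_nat_mul_pow (t z : ℝ) :
    HasSum (fun n : ℕ => poissonWeight t n * (n * z ^ (n - 1)))
      (t * Real.exp (-(t * (1 - z)))) := by
  have h := (hasSum_poissonWeight_mul_pow t z).mul_left t
  rw [← hasSum_nat_add_iff' 1]
  simp only [Finset.range_one, Finset.sum_singleton, Nat.cast_zero, zero_mul, mul_zero, sub_zero]
  refine h.congr_fun fun n => ?_
  rw [← mul_assoc, ← mul_assoc, poissonWeight_succ_mul, Nat.add_sub_cancel]

lemma summable_abs_poissonWeight (t : ℝ) : Summable fun n => |poissonWeight t n| := by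
  have h := (hasSum_poissonWeight_mul_pow t 1).summable
  simpa using h.abs

lemma summable_abs_poissonWeight_mul_nat (t : ℝ) :
    Summable fun n : ℕ => |poissonWeight t n * n| := by
  have h := (hasSum_poissonWeight_mul_nat_mul_pow t 1).summable
  simpa using h.abs

/-- The mixture over the numbers of stations, for densities of either sign. -/
theorem hasSum_coverageTerm {a R δ ζ T N₀ : ℝ} {ν : Measure ℝ} (ha : 1 < a) (hR : 0 < R)
    (hζ : 0 < ζ) (hT : 0 < T) (hN : 0 ≤ N₀) [IsProbabilityMeasure ν] (hν : ∀ᵐ g ∂ν, 0 ≤ g)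
    (l lS : ℝ) :
    HasSum (coverageTerm a R δ ζ T N₀ ν l lS)
      (∫ y in innerDisc R, coverageDensity (noiseFactor (ζ * T) δ N₀) (linkFactor ν δ (ζ * T))
        R a l lS ‖y‖) := by
  have hG := isInterferenceFactor_linkFactor hν δ (mul_pos hζ hT).le
  have hF := isDistanceFactor_noiseFactor (δ := δ) (mul_pos hζ hT).le hN
  have hRa : R < a * R := by nlinarith
  have hV : 0 < volume.real (innerDisc R) := by
    rw [innerDisc_eq_ring, volume_real_ring le_rfl hR.le]
    have := Real.pi_pos
    have : 0 < R ^ 2 := by positivity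
    nlinarith
  have hVS : 0 < volume.real (outerAnnulus R a) := by
    rw [outerAnnulus_eq_ring, volume_real_ring hR.le hRa.le]
    have : R ^ 2 < (a * R) ^ 2 := by nlinarith
    have := Real.pi_pos
    nlinarith
  have hfc := fixedCountCoverage_eq (δ := δ) ha hR hζ hT hN hν
  generalize noiseFactor (ζ * T) δ N₀ = F at *
  generalize linkFactor ν δ (ζ * T) = G at *
  set V := volume.real (innerDisc R)
  set VS := volume.real (outerAnnulus R a)
  set A : Plane → ℝ := fun y => 1 - screenedArea G (innerDisc R) ‖y‖ / V with hA
  set B : Plane → ℝ := fun y => 1 - screenedArea G (outerAnnulus R a) ‖y‖ / VS with hB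
  have hA0 : ∀ y, |A y| ≤ 1 := fun y => by
    have h1 := hG.screenedArea_nonneg (norm_nonneg y) (innerDisc R)
    have h2 : screenedArea G (innerDisc R) ‖y‖ ≤ V := by
      simp only [V, innerDisc_eq_ring]
      exact hG.screenedArea_le (norm_nonneg y) _ _
    have h3 := div_nonneg h1 hV.le
    have h4 := (div_le_one hV).2 h2
    rw [abs_le]
    constructor <;> simp only [hA] <;> linarith
  have hB0 : ∀ y, |B y| ≤ 1 := fun y => by
    have h1 := hG.screenedArea_nonneg (norm_nonneg y) (outerAnnulus R a)
    have h2 : screenedArea G (outerAnnulus R a) ‖y‖ ≤ VS :=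
      hG.screenedArea_le (norm_nonneg y) _ _
    have h3 := div_nonneg h1 hVS.le
    have h4 := (div_le_one hVS).2 h2
    rw [abs_le]
    constructor <;> simp only [hB] <;> linarith
  have hAm : Measurable A :=
    measurable_const.sub (((hG.measurable_screenedArea _).comp measurable_norm).div_const _)
  have hBm : Measurable B :=
    measurable_const.sub (((hG.measurable_screenedArea _).comp measurable_norm).div_const _)
  have hFm : Measurable fun y : Plane => F ‖y‖ := hF.measurable.comp measurable_norm
  -- the summands, as functions of the position `y` of the serving station
  set f : ℕ × ℕ → Plane → ℝ := fun k y =>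
    (poissonWeight (l * V) k.1 * (k.1 * A y ^ (k.1 - 1))) *
      (poissonWeight (lS * VS) k.2 * B y ^ k.2) * (V⁻¹ * F ‖y‖) with hf
  have hbound : ∀ k y, ‖f k y‖ ≤
      |poissonWeight (l * V) k.1 * k.1| * |poissonWeight (lS * VS) k.2| * V⁻¹ := by
    intro k y
    have h1 : |A y ^ (k.1 - 1)| ≤ 1 := by
      rw [abs_pow]; exact pow_le_one₀ (abs_nonneg _) (hA0 y)
    have h2 : |B y ^ k.2| ≤ 1 := by
      rw [abs_pow]; exact pow_le_one₀ (abs_nonneg _) (hB0 y)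
    have h3 : |F ‖y‖| ≤ 1 := by
      rw [abs_of_nonneg (hF.nonneg _ (norm_nonneg y))]; exact hF.le_one _ (norm_nonneg y)
    rw [Real.norm_eq_abs, hf]
    simp only [abs_mul, ← mul_assoc]
    rw [abs_of_pos (inv_pos.2 hV)]
    calc _ = |poissonWeight (l * V) k.1| * |(k.1 : ℝ)| * |poissonWeight (lS * VS) k.2| * V⁻¹ *
          (|A y ^ (k.1 - 1)| * |B y ^ k.2| * |F ‖y‖|) := by ring
      _ ≤ _ := mul_le_of_le_one_right (by positivity)
          (mul_le_one₀ (mul_le_one₀ h1 (abs_nonneg _) h2) (abs_nonneg _) h3)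
  have hfm : ∀ k, Measurable (f k) := fun k =>
    (((hAm.pow_const _).const_mul _).const_mul _ |>.mul ((hBm.pow_const _).const_mul _)).mul
      (hFm.const_mul _)
  have hfin : IsFiniteMeasure ((volume : Measure Plane).restrict (innerDisc R)) := by
    rw [innerDisc_eq_ring]; infer_instance
  have hint : ∀ k, Integrable (f k) (volume.restrict (innerDisc R)) := fun k =>
    Integrable.mono' (integrable_const _) (hfm k).aestronglyMeasurable (ae_of_all _ (hbound k))
  have hsum : Summable fun k => ∫ y in innerDisc R, ‖f k y‖ := by
    have h1 : Summable fun k : ℕ × ℕ =>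
        |poissonWeight (l * V) k.1 * k.1| * |poissonWeight (lS * VS) k.2| * V⁻¹ * V :=
      (((summable_abs_poissonWeight_mul_nat (l * V)).mul_of_nonneg
        (summable_abs_poissonWeight (lS * VS)) (fun _ => abs_nonneg _)
        fun _ => abs_nonneg _).mul_right _).mul_right _
    refine Summable.of_nonneg_of_le (fun k => integral_nonneg fun _ => norm_nonneg _)
      (fun k => ?_) h1
    have := integral_mono (hint k).norm (integrable_const _) (hbound k)
    rw [integral_const, smul_eq_mul, mul_comm, measureReal_restrict_apply_univ] at this
    exact this
  have hS := hasSum_integral_of_summable_integral_norm hint hsum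
  have hterm : ∀ k, ∫ y in innerDisc R, f k y = coverageTerm a R δ ζ T N₀ ν l lS k := by
    intro k
    rw [coverageTerm, hfc, ← integral_const_mul, ← integral_const_mul, ← integral_const_mul]
    refine integral_congr_ae (ae_of_all _ fun y => ?_)
    simp only [hf]
    ring
  simp_rw [hterm] at hS
  convert! hS using 1
  refine integral_congr_ae (ae_of_all _ fun y => ?_)
  simp only
  have h1 := hasSum_poissonWeight_mul_nat_mul_pow (l * V) (A y)
  have h2 := hasSum_poissonWeight_mul_pow (lS * VS) (B y)
  have h3 : Summable fun k : ℕ × ℕ => (poissonWeight (l * V) k.1 * (k.1 * A y ^ (k.1 - 1))) *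
      (poissonWeight (lS * VS) k.2 * B y ^ k.2) :=
    summable_mul_of_summable_norm h1.summable.norm h2.summable.norm
  have h4 := ((h1.mul h2 h3).mul_right (V⁻¹ * F ‖y‖)).tsum_eq
  rw [h4, coverageDensity, sub_eq_add_neg, Real.exp_add]
  have e1 : l * V * (1 - A y) = l * screenedArea G (innerDisc R) ‖y‖ := by
    simp only [hA]; field_simp; ring
  have e2 : lS * VS * (1 - B y) = lS * screenedArea G (outerAnnulus R a) ‖y‖ := by
    simp only [hB]; field_simp; ring
  rw [e1, e2]
  field_simp

/-! ### Discretised distances -/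

/-- The upper end of the interval `[k / (n + 1), (k + 1) / (n + 1))`. -/
noncomputable def cellRadius (n k : ℕ) : ℝ := (k + 1) / (n + 1)

/-- The index of the cell of mesh `1 / (n + 1)` that contains the distance `x`. -/
noncomputable def cellIndex (n : ℕ) (x : ℝ) : ℕ := ⌊(n + 1) * x⌋₊

/-- The distance `x` moved to the upper end of its cell. -/
noncomputable def roundUp (n : ℕ) (x : ℝ) : ℝ := cellRadius n (cellIndex n x)

lemma cellRadius_nonneg (n k : ℕ) : 0 ≤ cellRadius n k := by unfold cellRadius; positivity

lemma lt_roundUp (n : ℕ) (x : ℝ) : x < roundUp n x := by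
  have : (0 : ℝ) < n + 1 := by positivity
  rw [roundUp, cellRadius, lt_div_iff₀ this, mul_comm]
  exact Nat.lt_floor_add_one _

lemma roundUp_le (n : ℕ) {x : ℝ} (hx : 0 ≤ x) : roundUp n x ≤ x + 1 / (n + 1) := by
  have h : (0 : ℝ) < n + 1 := by positivity
  rw [roundUp, cellRadius, div_le_iff₀ h, add_mul, one_div, inv_mul_cancel₀ h.ne', mul_comm x]
  have := Nat.floor_le (mul_nonneg h.le hx)
  simp only [cellIndex]
  linarith

lemma roundUp_mono (n : ℕ) {x y : ℝ} (hxy : x ≤ y) : roundUp n x ≤ roundUp n y := by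
  have h : (0 : ℝ) < n + 1 := by positivity
  have : cellIndex n x ≤ cellIndex n y := Nat.floor_le_floor (by gcongr)
  have : (cellIndex n x : ℝ) ≤ cellIndex n y := by exact_mod_cast this
  unfold roundUp cellRadius
  gcongr

lemma tendsto_roundUp {x : ℝ} (hx : 0 ≤ x) :
    Tendsto (fun n => roundUp n x) atTop (𝓝 x) := by
  refine tendsto_of_tendsto_of_tendsto_of_le_of_le tendsto_const_nhds ?_
    (fun n => (lt_roundUp n x).le) (fun n => roundUp_le n hx)
  simpa using (tendsto_one_div_add_atTop_nhds_zero_nat (𝕜 := ℝ)).const_add x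

@[fun_prop]
lemma measurable_cellIndex (n : ℕ) : Measurable (cellIndex n) :=
  Nat.measurable_floor.comp (measurable_id.const_mul _)

lemma measurable_roundUp (n : ℕ) : Measurable (roundUp n) :=
  (measurable_from_nat (f := cellRadius n)).comp (measurable_cellIndex n)

/-- The indicator of `[0, R)` times a continuous function is right-continuous. -/
lemma tendsto_indicator_roundUp {F : ℝ → ℝ} (hF : ContinuousOn F (Ici 0)) (R : ℝ) {x : ℝ}
    (hx : 0 ≤ x) :
    Tendsto (fun n => (Iio R).indicator F (roundUp n x)) atTop (𝓝 ((Iio R).indicator F x)) := by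
  by_cases h : x < R
  · have h1 : Tendsto (fun n => F (roundUp n x)) atTop (𝓝 (F x)) :=
      (hF x hx).tendsto.comp (tendsto_nhdsWithin_iff.2 ⟨tendsto_roundUp hx,
        Eventually.of_forall fun n => hx.trans (lt_roundUp n x).le⟩)
    rw [indicator_of_mem (mem_Iio.2 h)]
    refine h1.congr' ?_
    filter_upwards [(tendsto_roundUp hx).eventually (gt_mem_nhds h)] with n hn
    exact (indicator_of_mem (mem_Iio.2 hn) F).symm
  · rw [indicator_of_notMem (by simpa using h)]
    refine tendsto_const_nhds.congr fun n => ?_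
    rw [indicator_of_notMem]
    exact fun hn => h ((lt_roundUp n x).trans hn)

/-- Rounding distances up preserves their order, ties included, so `screen` is continuous along
the discretisation in spite of its jump. -/
lemma tendsto_screen_roundUp {G : ℝ → ℝ → ℝ}
    (hG : ContinuousOn (Function.uncurry G) (Ici 0 ×ˢ Ioi 0)) {r x : ℝ} (hr : 0 ≤ r) (hx : 0 < x) :
    Tendsto (fun n => screen G (roundUp n r) (roundUp n x)) atTop (𝓝 (screen G r x)) := by
  by_cases h : x ≤ r
  · refine tendsto_const_nhds.congr fun n => ?_
    rw [screen, screen, if_pos h, if_pos (roundUp_mono n h)]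
  · push Not at h
    have h1 : Tendsto (fun n => G (roundUp n r) (roundUp n x)) atTop (𝓝 (G r x)) := by
      have h2 := hG (r, x) ⟨hr, hx⟩
      refine h2.tendsto.comp (tendsto_nhdsWithin_iff.2
        ⟨(tendsto_roundUp hr).prodMk_nhds (tendsto_roundUp hx.le), Eventually.of_forall fun n =>
          ⟨hr.trans (lt_roundUp n r).le, hx.trans (lt_roundUp n x)⟩⟩)
    rw [screen, if_neg (not_le.2 h)]
    refine (h1.const_sub 1).congr' ?_
    obtain ⟨m, hm1, hm2⟩ := exists_between h
    filter_upwards [(tendsto_roundUp hr).eventually (gt_mem_nhds hm1)] with n hn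
    rw [screen, if_neg (not_le.2 (hn.trans (hm2.trans (lt_roundUp n x))))]

/-- The sum `nearestSum` as a function of the distances of the stations. -/
noncomputable def distanceSum {ι : Type*} [Fintype ι] [DecidableEq ι] (f : ℝ → ℝ)
    (G : ℝ → ℝ → ℝ) (d : ι → ℝ) : ℝ :=
  ∑ i, f (d i) * ∏ j : {j // ¬ j = i}, (1 - screen G (d i) (d j))

lemma nearestSum_eq_distanceSum {ι : Type*} [Fintype ι] [DecidableEq ι] (F : ℝ → ℝ)
    (G : ℝ → ℝ → ℝ) (R : ℝ) (x : ι → Plane) :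
    nearestSum F G R x = distanceSum ((Iio R).indicator F) G fun i => ‖x i‖ := by
  rw [nearestSum_eq_sum, distanceSum]
  rfl

lemma IsDistanceFactor.indicator {F : ℝ → ℝ} (hF : IsDistanceFactor F) (R : ℝ) :
    IsDistanceFactor ((Iio R).indicator F) where
  measurable := hF.measurable.indicator measurableSet_Iio
  nonneg r hr := by
    by_cases h : r ∈ Iio R
    · rw [indicator_of_mem h]; exact hF.nonneg r hr
    · rw [indicator_of_notMem h]
  le_one r hr := by
    by_cases h : r ∈ Iio R
    · rw [indicator_of_mem h]; exact hF.le_one r hr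
    · rw [indicator_of_notMem h]; exact zero_le_one

/-- At most one term of `distanceSum` is nonzero. -/
lemma distanceSum_mem_Icc {ι : Type*} [Fintype ι] [DecidableEq ι] {f : ℝ → ℝ}
    {G : ℝ → ℝ → ℝ} (hf : IsDistanceFactor f) (hG : IsInterferenceFactor G) {d : ι → ℝ}
    (hd : ∀ i, 0 ≤ d i) : distanceSum f G d ∈ Icc (0 : ℝ) 1 := by
  have h0 : ∀ i j, 0 ≤ 1 - screen G (d i) (d j) := fun i j =>
    sub_nonneg.2 (hG.screen_le_one (hd i) (hd j))
  have h1 : ∀ i j, 1 - screen G (d i) (d j) ≤ 1 := fun i j => by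
    linarith [hG.screen_nonneg (hd i) (hd j)]
  by_cases hex : ∃ i, ∀ j, j ≠ i → d i < d j
  · obtain ⟨i, hi⟩ := hex
    rw [distanceSum, Finset.sum_eq_single i]
    · exact ⟨mul_nonneg (hf.nonneg _ (hd i)) (Finset.prod_nonneg fun j _ => h0 i j),
        mul_le_one₀ (hf.le_one _ (hd i)) (Finset.prod_nonneg fun j _ => h0 i j)
          (Finset.prod_le_one (fun j _ => h0 i j) fun j _ => h1 i j)⟩
    · intro k _ hk
      rw [Finset.prod_eq_zero (i := ⟨i, hk.symm⟩) (Finset.mem_univ _), mul_zero]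
      rw [screen, if_pos (hi k hk).le, sub_self]
    · simp
  · push Not at hex
    rw [distanceSum, Finset.sum_eq_zero]
    · simp
    intro i _
    obtain ⟨j, hj, hle⟩ := hex i
    rw [Finset.prod_eq_zero (i := ⟨j, hj⟩) (Finset.mem_univ _), mul_zero]
    rw [screen, if_pos hle, sub_self]

lemma tendsto_distanceSum_roundUp {ι : Type*} [Fintype ι] [DecidableEq ι] {F : ℝ → ℝ}
    {G : ℝ → ℝ → ℝ} (hF : ContinuousOn F (Ici 0))
    (hG : ContinuousOn (Function.uncurry G) (Ici 0 ×ˢ Ioi 0)) (R : ℝ) {d : ι → ℝ}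
    (hd : ∀ i, 0 < d i) :
    Tendsto (fun n => distanceSum ((Iio R).indicator F) G fun i => roundUp n (d i)) atTop
      (𝓝 (distanceSum ((Iio R).indicator F) G d)) := by
  unfold distanceSum
  refine tendsto_finsetSum _ fun i _ => ?_
  refine (tendsto_indicator_roundUp hF R (hd i).le).mul (tendsto_finsetProd _ fun j _ => ?_)
  exact (tendsto_screen_roundUp hG (hd i).le (hd j)).const_sub 1

/-- For discretised distances, `distanceSum` depends only on the numbers of stations in the
cells, and each of its terms is a product over the cells. -/
lemma distanceSum_cells {ι : Type*} [Fintype ι] [DecidableEq ι] (f : ℝ → ℝ) (G : ℝ → ℝ → ℝ)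
    (n M : ℕ) (c : ι → Fin M) :
    distanceSum f G (fun i => cellRadius n (c i)) =
      ∑ k : Fin M, f (cellRadius n k) * ∏ l : Fin M, if l = k then
        (((Finset.univ.filter fun i => c i = l).card : ℝ)) *
          (1 - screen G (cellRadius n k) (cellRadius n l)) ^
            ((Finset.univ.filter fun i => c i = l).card - 1)
        else (1 - screen G (cellRadius n k) (cellRadius n l)) ^
            (Finset.univ.filter fun i => c i = l).card := by
  rw [distanceSum, ← Finset.sum_fiberwise Finset.univ c]
  refine Finset.sum_congr rfl fun k _ => ?_
  set t : Fin M → ℝ := fun l => 1 - screen G (cellRadius n k) (cellRadius n l) with ht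
  set N : Fin M → ℕ := fun l => (Finset.univ.filter fun i => c i = l).card with hN
  have hterm : ∀ i ∈ Finset.univ.filter fun i => c i = k,
      f (cellRadius n (c i)) * ∏ j : {j // ¬ j = i},
        (1 - screen G (cellRadius n (c i)) (cellRadius n (c j))) =
      f (cellRadius n k) * ∏ l, t l ^ (if l = k then N l - 1 else N l) := by
    intro i hi
    have hi : c i = k := by simpa using hi
    rw [hi, ← Finset.prod_subtype (p := fun j => ¬ j = i) (Finset.univ.erase i)
      (fun j => by simp) fun j => t (c j), ← Finset.prod_fiberwise']
    congr 1
    refine Finset.prod_congr rfl fun l _ => ?_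
    rw [Finset.prod_const]
    congr 1
    split_ifs with hl
    · subst hl
      rw [hN, ← Finset.card_erase_of_mem (a := i) (by simpa using hi)]
      congr 1
      ext j
      simp
    · rw [hN]
      congr 1
      ext j
      simp only [Finset.mem_filter, Finset.mem_univ, true_and, and_iff_right_iff_imp]
      intro hj
      refine Finset.mem_erase.2 ⟨?_, Finset.mem_univ _⟩
      rintro rfl
      exact hl (hj.symm.trans hi)
  rw [Finset.sum_congr rfl hterm, Finset.sum_const, nsmul_eq_mul, mul_left_comm]
  congr 1
  have : ((Finset.univ.filter fun i => c i = k).card : ℝ) =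
      ∏ l, if l = k then (N l : ℝ) else 1 := by
    rw [Finset.prod_ite_eq' Finset.univ k (fun l => (N l : ℝ))]
    simp [hN]
  rw [this, ← Finset.prod_mul_distrib]
  refine Finset.prod_congr rfl fun l _ => ?_
  split_ifs
  · rfl
  · rw [one_mul]

/-! ### The numbers of stations in the cells of a network -/

lemma stationCount_eq_card (k : ℕ) (x : ℕ → Plane) (B : Set Plane) [DecidablePred (· ∈ B)] :
    stationCount k x B = (Finset.univ.filter fun i : Fin k => x i ∈ B).card := by
  classical
  rw [stationCount, Finset.card_filter, Finset.card_filter, Finset.sum_range]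
  congr!

lemma measurable_stationCount {Ω : Type*} [MeasurableSpace Ω] {K : Ω → ℕ} {X : ℕ → Ω → Plane}
    (hK : Measurable K) (hX : ∀ i, Measurable (X i)) {B : Set Plane} (hB : MeasurableSet B) :
    Measurable fun ω => stationCount (K ω) (fun j => X j ω) B := by
  classical
  have h : ∀ k : ℕ, Measurable fun ω => stationCount k (fun j => X j ω) B := by
    intro k
    simp only [stationCount, Finset.card_filter]
    refine Finset.measurable_fun_sum _ fun i _ => ?_
    exact Measurable.ite (hX i hB) measurable_const measurable_const
  have h2 : Measurable fun q : ℕ × Ω => stationCount q.1 (fun j => X j q.2) B :=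
    measurable_from_prod_countable_right h
  exact h2.comp (hK.prodMk measurable_id)

lemma poissonMeasure_real_singleton_toNNReal {t : ℝ} (ht : 0 ≤ t) (n : ℕ) :
    (poissonMeasure t.toNNReal).real {n} = poissonWeight t n := by
  rw [poissonMeasure_real_singleton, Real.coe_toNNReal t ht, poissonWeight]

/-- A product of independent Poisson laws, tested against a product. -/
lemma hasSum_prod_poissonWeight {M : ℕ} {t : Fin M → ℝ} (ht : ∀ i, 0 ≤ t i)
    {w : Fin M → ℕ → ℝ} (hw : ∀ i n, |w i n| ≤ 1) {e : Fin M → ℝ}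
    (he : ∀ i, HasSum (fun n => poissonWeight (t i) n * w i n) (e i)) :
    HasSum (fun n : Fin M → ℕ => (∏ i, poissonWeight (t i) (n i)) * ∏ i, w i (n i))
      (∏ i, e i) := by
  set κ := Measure.pi fun i => poissonMeasure (t i).toNNReal with hκ
  have hint : Integrable (fun n : Fin M → ℕ => ∏ i, w i (n i)) κ := by
    refine Integrable.mono' (integrable_const 1) (Measurable.of_discrete).aestronglyMeasurable
      (ae_of_all _ fun n => ?_)
    rw [Real.norm_eq_abs, Finset.abs_prod]
    exact Finset.prod_le_one (fun _ _ => abs_nonneg _) fun _ _ => hw _ _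
  have hsing : ∀ n : Fin M → ℕ, κ.real {n} = ∏ i, poissonWeight (t i) (n i) := by
    intro n
    rw [hκ, Measure.real, Measure.pi_singleton, ENNReal.toReal_prod]
    exact Finset.prod_congr rfl fun i _ => poissonMeasure_real_singleton_toNNReal (ht i) _
  have h1 := hasSum_integral_iUnion (μ := κ) (f := fun n : Fin M → ℕ => ∏ i, w i (n i))
    (s := fun n : Fin M → ℕ => {n}) (fun n => measurableSet_singleton n)
    (fun a b hab => by simpa using hab) hint.integrableOn
  simp only [integral_singleton, hsing, smul_eq_mul] at h1
  have h2 : ⋃ n : Fin M → ℕ, ({n} : Set (Fin M → ℕ)) = univ := by ext; simp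
  rw [h2, setIntegral_univ, hκ, integral_fintype_prod_eq_prod] at h1
  convert! h1 using 1
  refine Finset.prod_congr rfl fun i _ => ?_
  rw [integral_poissonMeasure, ← (he i).tsum_eq]
  refine tsum_congr fun n => ?_
  rw [Real.coe_toNNReal _ (ht i), poissonWeight, smul_eq_mul]

lemma poissonWeight_nonneg {t : ℝ} (ht : 0 ≤ t) (n : ℕ) : 0 ≤ poissonWeight t n := by
  unfold poissonWeight; positivity

lemma poissonWeight_le_one {t : ℝ} (ht : 0 ≤ t) (n : ℕ) : poissonWeight t n ≤ 1 := by
  rw [← poissonMeasure_real_singleton_toNNReal ht]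
  exact measureReal_le_one

@[fun_prop]
lemma measurable_poissonWeight (n : ℕ) : Measurable fun t => poissonWeight t n := by
  unfold poissonWeight; fun_prop

/-- The mean of a product of functions of counts that are, given their means, independent and
Poisson. -/
lemma integral_prod_of_mixed_poisson {Ω : Type*} [MeasurableSpace Ω] {P : Measure Ω}
    [IsProbabilityMeasure P] {M : ℕ} {N : Ω → Fin M → ℕ} {t : Ω → Fin M → ℝ} (hN : Measurable N)
    (htm : ∀ i, Measurable fun ω => t ω i) (ht : ∀ᵐ ω ∂P, ∀ i, 0 ≤ t ω i)
    (hlaw : ∀ n, P.real {ω | N ω = n} = ∫ ω, ∏ i, poissonWeight (t ω i) (n i) ∂P)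
    {w : Fin M → ℕ → ℝ} (hw : ∀ i n, |w i n| ≤ 1) {e : Fin M → ℝ → ℝ}
    (he : ∀ i s, HasSum (fun n => poissonWeight s n * w i n) (e i s)) :
    ∫ ω, ∏ i, w i (N ω i) ∂P = ∫ ω, ∏ i, e i (t ω i) ∂P := by
  have hw' : ∀ n : Fin M → ℕ, |∏ i, w i (n i)| ≤ 1 := fun n => by
    rw [Finset.abs_prod]
    exact Finset.prod_le_one (fun _ _ => abs_nonneg _) fun _ _ => hw _ _
  have hmeas : ∀ n : Fin M → ℕ, MeasurableSet {ω | N ω = n} := fun n =>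
    hN (measurableSet_singleton n)
  -- the mean as a sum over the values of the counts
  have h1 : HasSum (fun n : Fin M → ℕ => ∫ ω in {ω | N ω = n}, ∏ i, w i (N ω i) ∂P)
      (∫ ω, ∏ i, w i (N ω i) ∂P) := by
    have := hasSum_integral_iUnion (μ := P) (f := fun ω => ∏ i, w i (N ω i))
      (s := fun n : Fin M → ℕ => {ω | N ω = n}) hmeas ?_ ?_
    · have h2 : ⋃ n : Fin M → ℕ, {ω | N ω = n} = univ := by ext; simp
      rwa [h2, setIntegral_univ] at this
    · intro a b hab
      exact disjoint_left.2 fun ω h1 h2 => hab (h1.symm.trans h2)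
    · refine Integrable.integrableOn (Integrable.mono' (integrable_const 1)
        ((Measurable.of_discrete (f := fun n : Fin M → ℕ => ∏ i, w i (n i))).comp
          hN).aestronglyMeasurable (ae_of_all _ fun ω => hw' (N ω)))
  have h2 : ∀ n : Fin M → ℕ, ∫ ω in {ω | N ω = n}, ∏ i, w i (N ω i) ∂P =
      ∫ ω, (∏ i, poissonWeight (t ω i) (n i)) * ∏ i, w i (n i) ∂P := by
    intro n
    have : ∫ ω in {ω | N ω = n}, ∏ i, w i (N ω i) ∂P =
        ∫ ω in {ω | N ω = n}, ∏ i, w i (n i) ∂P :=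
      setIntegral_congr_fun (hmeas n) fun ω hω => by
        have hω : N ω = n := hω
        simp only [hω]
    rw [this, setIntegral_const, smul_eq_mul, hlaw, integral_mul_const]
  simp_rw [h2] at h1
  have hpm : ∀ n : Fin M → ℕ, Measurable fun ω => ∏ i, poissonWeight (t ω i) (n i) := fun n =>
    Finset.measurable_fun_prod _ fun i _ => (measurable_poissonWeight _).comp (htm i)
  have hpint : ∀ n : Fin M → ℕ, Integrable (fun ω => ∏ i, poissonWeight (t ω i) (n i)) P := by
    intro n
    refine Integrable.mono' (integrable_const 1) (hpm n).aestronglyMeasurable ?_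
    filter_upwards [ht] with ω hω
    rw [Real.norm_eq_abs, Finset.abs_prod]
    refine Finset.prod_le_one (fun _ _ => abs_nonneg _) fun i _ => ?_
    rw [abs_of_nonneg (poissonWeight_nonneg (hω i) _)]
    exact poissonWeight_le_one (hω i) _
  have hsum : Summable fun n : Fin M → ℕ =>
      ∫ ω, ‖(∏ i, poissonWeight (t ω i) (n i)) * ∏ i, w i (n i)‖ ∂P := by
    have hs : Summable fun n : Fin M → ℕ => P.real {ω | N ω = n} := by
      have := hasSum_integral_iUnion (μ := P) (f := fun _ => (1 : ℝ))
        (s := fun n : Fin M → ℕ => {ω | N ω = n}) hmeas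
        (fun a b hab => disjoint_left.2 fun ω h1 h2 => hab (h1.symm.trans h2))
        (integrable_const 1).integrableOn
      simpa using this.summable
    refine Summable.of_nonneg_of_le (fun n => integral_nonneg fun _ => norm_nonneg _)
      (fun n => ?_) hs
    rw [hlaw]
    refine integral_mono_ae ((hpint n).mul_const _).norm (hpint n) ?_
    filter_upwards [ht] with ω hω
    have h0 : 0 ≤ ∏ i, poissonWeight (t ω i) (n i) :=
      Finset.prod_nonneg fun i _ => poissonWeight_nonneg (hω i) _
    rw [norm_mul, Real.norm_of_nonneg h0, Real.norm_eq_abs]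
    exact mul_le_of_le_one_right h0 (hw' n)
  have h3 := hasSum_integral_of_summable_integral_norm (fun n => (hpint n).mul_const _) hsum
  rw [h1.unique h3]
  refine integral_congr_ae ?_
  filter_upwards [ht] with ω hω
  exact (hasSum_prod_poissonWeight hω hw fun i => he i _).tsum_eq

/-- The mean number of stations of `B`, for the densities `l` and `lS`. -/
noncomputable def regionMean (R a l lS : ℝ) (B : Set Plane) : ℝ :=
  l * volume.real (B ∩ innerDisc R) + lS * volume.real (B ∩ outerAnnulus R a)

section Network

variable {Ω : Type*} [MeasurableSpace Ω] {P : Measure Ω}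
  {ρ ν : Measure ℝ} {a H R ζ : ℝ} {lam lamS : Ω → ℝ} {K : Ω → ℕ} {X : ℕ → Ω → Plane}
  {g : ℕ → Ω → ℝ} {h : Ω → ℝ}

/-- The joint law of the counts in disjoint regions. -/
lemma IsStableNetwork.counts_law [IsProbabilityMeasure P]
    (hnet : IsStableNetwork P ρ ν a H R ζ lam lamS K X g h) {k : ℕ}
    {B : Fin k → Set Plane} (hB : ∀ i, MeasurableSet (B i))
    (hdisj : Pairwise (Function.onFun Disjoint B)) (n : Fin k → ℕ) :
    P.real {ω | (fun i => stationCount (K ω) (fun j => X j ω) (B i)) = n} =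
      ∫ ω, ∏ i, poissonWeight (regionMean R a (lam ω) (lamS ω) (B i)) (n i) ∂P := by
  have hset : {ω | (fun i => stationCount (K ω) (fun j => X j ω) (B i)) = n} =
      {ω | ∀ i, stationCount (K ω) (fun j => X j ω) (B i) = n i} := by
    ext ω
    exact funext_iff
  have hmeas : MeasurableSet {ω | ∀ i, stationCount (K ω) (fun j => X j ω) (B i) = n i} := by
    rw [← hset]
    exact measurableSet_eq_fun (measurable_pi_lambda _ fun i =>
      measurable_stationCount hnet.measurable_K hnet.measurable_X (hB i)) measurable_const
  have hm : MeasurableSpace.comap (fun ω => (lam ω, lamS ω)) inferInstance ≤ ‹MeasurableSpace Ω› :=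
    (hnet.measurable_lam.prodMk hnet.measurable_lamS).comap_le
  have h1 := integral_condExp (μ := P) hm (f :=
    {ω | ∀ i, stationCount (K ω) (fun j => X j ω) (B i) = n i}.indicator fun _ => (1 : ℝ))
  rw [integral_congr_ae (hnet.poisson k B hB hdisj n)] at h1
  rw [hset, ← integral_indicator_one hmeas]
  exact h1.symm

lemma IsStableNetwork.regionMean_nonneg
    (hnet : IsStableNetwork P ρ ν a H R ζ lam lamS K X g h) :
    ∀ᵐ ω ∂P, ∀ B, 0 ≤ regionMean R a (lam ω) (lamS ω) B := by
  filter_upwards [hnet.lam_nonneg, hnet.lamS_nonneg] with ω h1 h2 B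
  unfold regionMean
  positivity

lemma IsStableNetwork.measurable_regionMean
    (hnet : IsStableNetwork P ρ ν a H R ζ lam lamS K X g h) (B : Set Plane) :
    Measurable fun ω => regionMean R a (lam ω) (lamS ω) B :=
  (hnet.measurable_lam.mul_const _).add (hnet.measurable_lamS.mul_const _)

/-- Almost surely no station lies in a null part of the network region. -/
lemma IsStableNetwork.ae_notMem [IsProbabilityMeasure P]
    (hnet : IsStableNetwork P ρ ν a H R ζ lam lamS K X g h)
    {B : Set Plane} (hB : MeasurableSet B) (h1 : volume (B ∩ innerDisc R) = 0)
    (h2 : volume (B ∩ outerAnnulus R a) = 0) : ∀ᵐ ω ∂P, ∀ i < K ω, X i ω ∉ B := by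
  classical
  have h := hnet.counts_law (k := 1) (B := fun _ => B) (fun _ => hB)
    (fun i j hij => absurd (Subsingleton.elim i j) hij) (fun _ => 0)
  have h0 : ∀ ω, ∏ i : Fin 1, poissonWeight (regionMean R a (lam ω) (lamS ω) B) 0 = 1 := by
    intro ω
    simp [regionMean, Measure.real, h1, h2, poissonWeight]
  simp only [h0, integral_const, probReal_univ, smul_eq_mul, mul_one] at h
  have hmeas : MeasurableSet
      {ω | (fun _ : Fin 1 => stationCount (K ω) (fun j => X j ω) B) = fun _ => 0} :=
    measurableSet_eq_fun (measurable_pi_lambda _ fun i =>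
      measurable_stationCount hnet.measurable_K hnet.measurable_X hB) measurable_const
  have hae := (prob_compl_eq_zero_iff hmeas).2
    ((ENNReal.toReal_eq_one_iff _).1 h)
  have hae' : ∀ᵐ ω ∂P, (fun _ : Fin 1 => stationCount (K ω) (fun j => X j ω) B) = fun _ => 0 := hae
  filter_upwards [hae'] with ω hω i hi hmem
  have := congrFun hω 0
  simp only [stationCount, Finset.card_eq_zero, Finset.filter_eq_empty_iff,
    Finset.mem_range] at this
  exact this hi hmem

/-- Almost surely all stations lie strictly between the origin and the outer radius. -/
lemma IsStableNetwork.ae_norm_mem [IsProbabilityMeasure P]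
    (hnet : IsStableNetwork P ρ ν a H R ζ lam lamS K X g h)
    (hR : 0 < R) (ha : 1 < a) : ∀ᵐ ω ∂P, ∀ i < K ω, 0 < ‖X i ω‖ ∧ ‖X i ω‖ < a * R := by
  have hRa : R < a * R := by nlinarith
  have hB : MeasurableSet ({0} ∪ {x : Plane | a * R ≤ ‖x‖}) :=
    (measurableSet_singleton _).union (measurableSet_le measurable_const measurable_norm)
  have h0 : ∀ S : Set Plane, (∀ x ∈ S, ‖x‖ < a * R) →
      volume (({0} ∪ {x : Plane | a * R ≤ ‖x‖}) ∩ S) = 0 := by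
    intro S hS
    refine measure_mono_null (t := {0}) ?_ (by simp)
    rintro x ⟨hx | hx, hxS⟩
    · exact hx
    · exact absurd (hS x hxS) (not_lt.2 hx)
  filter_upwards [hnet.ae_notMem hB (h0 _ fun x hx => lt_trans hx hRa) (h0 _ fun x hx => hx.2)]
    with ω hω i hi
  have := hω i hi
  simp only [mem_union, mem_singleton_iff, mem_ofPred_eq, not_or, not_le] at this
  exact ⟨norm_pos_iff.2 this.1, this.2⟩

end Network

/-! ### The nearest station of a network -/

/-- The stations whose distance lies in the `k`-th cell. -/
def cell (n k : ℕ) : Set Plane := {x | cellIndex n ‖x‖ = k}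

lemma measurableSet_cell (n k : ℕ) : MeasurableSet (cell n k) :=
  measurableSet_eq_fun ((measurable_cellIndex n).comp measurable_norm) measurable_const

/-- The number of cells that meet the network region. -/
noncomputable def cellNumber (R a : ℝ) (n : ℕ) : ℕ := ⌈(n + 1) * (a * R)⌉₊

lemma cellIndex_lt_cellNumber {R a x : ℝ} (n : ℕ) (hx : 0 ≤ x) (h : x < a * R) :
    cellIndex n x < cellNumber R a n := by
  have hn : (0 : ℝ) < n + 1 := by positivity
  rw [cellIndex, cellNumber, Nat.floor_lt (by positivity)]
  exact lt_of_lt_of_le (by gcongr) (Nat.le_ceil _)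

/-- The discretised version of the coverage probability for the densities `l` and `lS`. -/
noncomputable def discreteCoverage (f : ℝ → ℝ) (G : ℝ → ℝ → ℝ) (R a : ℝ) (n : ℕ) (l lS : ℝ) : ℝ :=
  ∑ k : Fin (cellNumber R a n), f (cellRadius n k) * (regionMean R a l lS (cell n k) *
    Real.exp (-∑ j : Fin (cellNumber R a n), regionMean R a l lS (cell n j) *
      screen G (cellRadius n k) (cellRadius n j)))

lemma sum_cell_mul {R a : ℝ} (n : ℕ) {B : Set Plane} (hB : MeasurableSet B)
    (hBR : ∀ y ∈ B, ‖y‖ < a * R) (hfin : volume B < ∞) (c : ℝ → ℝ) :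
    ∑ k : Fin (cellNumber R a n), volume.real (cell n k ∩ B) * c (cellRadius n k) =
      ∫ y in B, c (roundUp n ‖y‖) := by
  have h1 : ∫ y in B, c (roundUp n ‖y‖) = ∫ y in B, ∑ k : Fin (cellNumber R a n),
      (cell n k).indicator (fun _ => c (cellRadius n k)) y := by
    refine setIntegral_congr_fun hB fun y hy => ?_
    have hlt := cellIndex_lt_cellNumber n (norm_nonneg y) (hBR y hy)
    rw [Finset.sum_eq_single ⟨cellIndex n ‖y‖, hlt⟩]
    · rw [indicator_of_mem (show y ∈ cell n (cellIndex n ‖y‖) from rfl)]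
      rfl
    · intro k _ hk
      refine indicator_of_notMem (fun hm => hk ?_) _
      exact Fin.ext (show (k : ℕ) = cellIndex n ‖y‖ from hm.symm)
    · simp
  have : IsFiniteMeasure (volume.restrict B) := ⟨by simpa using hfin⟩
  have h2 : ∀ k ∈ (Finset.univ : Finset (Fin (cellNumber R a n))),
      Integrable ((cell n k).indicator fun _ => c (cellRadius n k)) (volume.restrict B) :=
    fun k _ => (integrable_const _).indicator (measurableSet_cell n k)
  rw [h1, integral_finsetSum _ h2]
  refine Finset.sum_congr rfl fun k _ => ?_
  rw [integral_indicator (measurableSet_cell n k),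
    Measure.restrict_restrict (measurableSet_cell n k), setIntegral_const, smul_eq_mul]

lemma volume_innerDisc_lt_top (R : ℝ) : volume (innerDisc R) < ∞ :=
  innerDisc_eq_ring R ▸ volume_ring_lt_top 0 R

/-- The area screened in the discretised model. -/
noncomputable def roundedArea (G : ℝ → ℝ → ℝ) (B : Set Plane) (n : ℕ) (r : ℝ) : ℝ :=
  ∫ y in B, screen G r (roundUp n ‖y‖)

lemma sum_regionMean_mul {R a : ℝ} (hR : 0 < R) (ha : 1 < a) (n : ℕ) (l lS : ℝ) (c : ℝ → ℝ) :
    ∑ k : Fin (cellNumber R a n), regionMean R a l lS (cell n k) * c (cellRadius n k) =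
      l * (∫ y in innerDisc R, c (roundUp n ‖y‖)) +
        lS * ∫ y in outerAnnulus R a, c (roundUp n ‖y‖) := by
  have hRa : R < a * R := by nlinarith
  rw [← sum_cell_mul n (measurableSet_innerDisc R) (fun y hy => lt_trans hy hRa)
    (volume_innerDisc_lt_top R) c, ← sum_cell_mul n (measurableSet_outerAnnulus R a)
    (fun y hy => hy.2) (volume_ring_lt_top R (a * R)) c, Finset.mul_sum, Finset.mul_sum,
    ← Finset.sum_add_distrib]
  refine Finset.sum_congr rfl fun k _ => ?_
  rw [regionMean]
  ring

lemma discreteCoverage_eq {F : ℝ → ℝ} {G : ℝ → ℝ → ℝ} {R a : ℝ} (hR : 0 < R) (ha : 1 < a) (n : ℕ)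
    (l lS : ℝ) :
    discreteCoverage ((Iio R).indicator F) G R a n l lS =
      ∫ y in innerDisc R, l * (Iio R).indicator F (roundUp n ‖y‖) *
        Real.exp (-(l * roundedArea G (innerDisc R) n (roundUp n ‖y‖)) -
          lS * roundedArea G (outerAnnulus R a) n (roundUp n ‖y‖)) := by
  have h1 : ∀ k : ℕ, ∑ j : Fin (cellNumber R a n), regionMean R a l lS (cell n j) *
      screen G (cellRadius n k) (cellRadius n j) =
      l * roundedArea G (innerDisc R) n (cellRadius n k) +
        lS * roundedArea G (outerAnnulus R a) n (cellRadius n k) := fun k =>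
    sum_regionMean_mul hR ha n l lS (screen G (cellRadius n k))
  rw [discreteCoverage]
  simp_rw [h1]
  have h2 := sum_regionMean_mul hR ha n l lS fun r => (Iio R).indicator F r *
    Real.exp (-(l * roundedArea G (innerDisc R) n r + lS * roundedArea G (outerAnnulus R a) n r))
  have h3 : ∫ y in outerAnnulus R a, (Iio R).indicator F (roundUp n ‖y‖) *
      Real.exp (-(l * roundedArea G (innerDisc R) n (roundUp n ‖y‖) +
        lS * roundedArea G (outerAnnulus R a) n (roundUp n ‖y‖))) = 0 := by
    refine setIntegral_eq_zero_of_forall_eq_zero fun y hy => ?_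
    rw [indicator_of_notMem, zero_mul]
    exact not_lt.2 (hy.1.trans (lt_roundUp n ‖y‖).le)
  rw [h3, mul_zero, add_zero, ← integral_const_mul] at h2
  rw [← integral_congr_ae (ae_of_all _ fun y => ?_), ← h2]
  · exact Finset.sum_congr rfl fun k _ => by ring
  · rw [neg_add', mul_assoc]

lemma setIntegral_innerDisc_mul_exp {R : ℝ} (hR : 0 < R) (l : ℝ) :
    ∫ y in innerDisc R, l * Real.exp (-(l * (Real.pi * ‖y‖ ^ 2))) =
      1 - Real.exp (-(l * (Real.pi * R ^ 2))) := by
  rw [innerDisc_eq_ring, setIntegral_ring le_rfl fun r => l * Real.exp (-(l * (Real.pi * r ^ 2))),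
    ← integral_const_mul, ← integral_Ioc_eq_integral_Ioo, ← intervalIntegral.integral_of_le hR.le]
  have hd : ∀ r ∈ uIcc 0 R, HasDerivAt (fun r : ℝ => -Real.exp (-(l * (Real.pi * r ^ 2))))
      (2 * Real.pi * (r * (l * Real.exp (-(l * (Real.pi * r ^ 2)))))) r := by
    intro r _
    have h := ((((hasDerivAt_pow 2 r).const_mul Real.pi).const_mul l).neg.exp).neg
    refine h.congr_deriv ?_
    simp only [Pi.neg_apply]
    push_cast
    ring
  rw [intervalIntegral.integral_eq_sub_of_hasDerivAt hd]
  · simp; ring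
  · exact Continuous.intervalIntegrable (by fun_prop) _ _

section Limits

variable {F : ℝ → ℝ} {G : ℝ → ℝ → ℝ} {R a : ℝ}

lemma IsInterferenceFactor.measurable_screen_roundUp (hG : IsInterferenceFactor G) (n : ℕ)
    (r : ℝ) : Measurable fun y : Plane => screen G r (roundUp n ‖y‖) :=
  hG.measurable_screen.comp (measurable_const.prodMk ((measurable_roundUp n).comp measurable_norm))

lemma roundUp_nonneg (n : ℕ) (x : ℝ) : 0 ≤ roundUp n x := cellRadius_nonneg _ _

lemma IsInterferenceFactor.roundedArea_nonneg (hG : IsInterferenceFactor G) {r : ℝ} (hr : 0 ≤ r)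
    (B : Set Plane) (n : ℕ) : 0 ≤ roundedArea G B n r :=
  integral_nonneg fun _ => hG.screen_nonneg hr (roundUp_nonneg n _)

lemma IsInterferenceFactor.measurable_roundedArea (hG : IsInterferenceFactor G) (B : Set Plane)
    (n : ℕ) : Measurable (roundedArea G B n) := by
  refine StronglyMeasurable.measurable ?_
  refine StronglyMeasurable.integral_prod_right
    (f := fun r (y : Plane) => screen G r (roundUp n ‖y‖)) (Measurable.stronglyMeasurable ?_)
  exact hG.measurable_screen.comp
    (measurable_fst.prodMk ((measurable_roundUp n).comp measurable_snd.norm))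

lemma IsInterferenceFactor.integrableOn_screen_roundUp (hG : IsInterferenceFactor G) {r : ℝ}
    (hr : 0 ≤ r) (b c : ℝ) (n : ℕ) :
    IntegrableOn (fun y : Plane => screen G r (roundUp n ‖y‖)) (ring b c) := by
  refine Integrable.mono' (integrable_const 1)
    (hG.measurable_screen_roundUp n r).aestronglyMeasurable (ae_of_all _ fun y => ?_)
  rw [Real.norm_of_nonneg (hG.screen_nonneg hr (roundUp_nonneg n _))]
  exact hG.screen_le_one hr (roundUp_nonneg n _)

lemma IsInterferenceFactor.le_roundedArea (hG : IsInterferenceFactor G) {r : ℝ} (hr : 0 ≤ r)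
    (hrR : r ≤ R) (n : ℕ) :
    Real.pi * r ^ 2 ≤ roundedArea G (innerDisc R) n (roundUp n r) := by
  rw [innerDisc_eq_ring]
  have h1 : ∫ y in ring 0 r, screen G (roundUp n r) (roundUp n ‖y‖) = Real.pi * r ^ 2 := by
    have : ∫ y in ring 0 r, screen G (roundUp n r) (roundUp n ‖y‖) = ∫ y in ring 0 r, (1 : ℝ) :=
      setIntegral_congr_fun (measurableSet_ring _ _) fun y hy => by
        simp [screen, roundUp_mono n hy.2.le]
    rw [this, setIntegral_const, volume_real_ring le_rfl hr]
    simp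
  rw [← h1]
  refine setIntegral_mono_set (hG.integrableOn_screen_roundUp (roundUp_nonneg n r) 0 R n)
    (ae_of_all _ fun y => hG.screen_nonneg (roundUp_nonneg n r) (roundUp_nonneg n _))
    (ae_of_all _ fun y hy => ?_)
  exact ⟨hy.1, lt_of_lt_of_le hy.2 hrR⟩

lemma tendsto_roundedArea (hG : IsInterferenceFactor G)
    (hGc : ContinuousOn (Function.uncurry G) (Ici 0 ×ˢ Ioi 0)) {r : ℝ} (hr : 0 ≤ r) (b c : ℝ) :
    Tendsto (fun n => roundedArea G (ring b c) n (roundUp n r)) atTop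
      (𝓝 (screenedArea G (ring b c) r)) := by
  refine tendsto_integral_of_dominated_convergence (fun _ => 1)
    (fun n => (hG.measurable_screen_roundUp n _).aestronglyMeasurable) (integrable_const 1)
    (fun n => ae_of_all _ fun y => ?_) ?_
  · rw [Real.norm_of_nonneg (hG.screen_nonneg (roundUp_nonneg n r) (roundUp_nonneg n _))]
    exact hG.screen_le_one (roundUp_nonneg n r) (roundUp_nonneg n _)
  · have h0 : ∀ᵐ y ∂(volume.restrict (ring b c)), y ≠ 0 :=
      ae_restrict_of_ae (ae_iff.2 (by simp))
    filter_upwards [h0] with y hy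
    exact tendsto_screen_roundUp hGc hr (norm_pos_iff.2 hy)

/-- The integrand of `discreteCoverage_eq` is bounded by the density of the nearest station. -/
lemma discreteCoverage_integrand_mem (hF : IsDistanceFactor F) (hG : IsInterferenceFactor G)
    {l lS : ℝ} (hl : 0 ≤ l) (hlS : 0 ≤ lS) (n : ℕ) {r : ℝ} (hr : 0 ≤ r) (hrR : r ≤ R) :
    l * (Iio R).indicator F (roundUp n r) *
        Real.exp (-(l * roundedArea G (innerDisc R) n (roundUp n r)) -
          lS * roundedArea G (outerAnnulus R a) n (roundUp n r)) ∈
      Icc 0 (l * Real.exp (-(l * (Real.pi * r ^ 2)))) := by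
  have hf := hF.indicator R
  have h0 := hf.nonneg _ (roundUp_nonneg n r)
  have h1 := hf.le_one _ (roundUp_nonneg n r)
  refine ⟨by positivity, ?_⟩
  rw [mul_assoc]
  refine mul_le_mul_of_nonneg_left ?_ hl
  refine (mul_le_of_le_one_left (Real.exp_pos _).le h1).trans (Real.exp_le_exp.2 ?_)
  have h2 := mul_le_mul_of_nonneg_left (hG.le_roundedArea hr hrR n) hl
  have h3 := mul_nonneg hlS (hG.roundedArea_nonneg (roundUp_nonneg n r) (outerAnnulus R a) n)
  linarith

lemma discreteCoverage_mem_Icc (hF : IsDistanceFactor F) (hG : IsInterferenceFactor G)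
    (hR : 0 < R) (ha : 1 < a) {l lS : ℝ} (hl : 0 ≤ l) (hlS : 0 ≤ lS) (n : ℕ) :
    discreteCoverage ((Iio R).indicator F) G R a n l lS ∈ Icc (0 : ℝ) 1 := by
  have hmem : ∀ y ∈ innerDisc R, _ := fun y (hy : y ∈ innerDisc R) =>
    discreteCoverage_integrand_mem (a := a) hF hG hl hlS n (norm_nonneg y) (le_of_lt hy)
  rw [discreteCoverage_eq hR ha]
  refine ⟨setIntegral_nonneg (measurableSet_innerDisc R) fun y hy => (hmem y hy).1, ?_⟩
  have hfin : IsFiniteMeasure ((volume : Measure Plane).restrict (innerDisc R)) := by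
    rw [innerDisc_eq_ring]; infer_instance
  have hi : IntegrableOn (fun y : Plane => l * Real.exp (-(l * (Real.pi * ‖y‖ ^ 2))))
      (innerDisc R) := by
    refine Integrable.mono' (integrable_const l)
      (Continuous.aestronglyMeasurable (by fun_prop)) (ae_of_all _ fun y => ?_)
    rw [Real.norm_of_nonneg (by positivity)]
    have := Real.pi_pos
    exact mul_le_of_le_one_right hl (Real.exp_le_one_iff.2 (neg_nonpos.2 (by positivity)))
  have h := integral_mono_of_nonneg (μ := volume.restrict (innerDisc R))
    ((ae_restrict_iff' (measurableSet_innerDisc R)).2 (ae_of_all _ fun y hy => (hmem y hy).1))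
    hi ((ae_restrict_iff' (measurableSet_innerDisc R)).2 (ae_of_all _ fun y hy => (hmem y hy).2))
  refine h.trans ?_
  rw [setIntegral_innerDisc_mul_exp hR]
  linarith [Real.exp_pos (-(l * (Real.pi * R ^ 2)))]

lemma tendsto_discreteCoverage (hF : IsDistanceFactor F) (hFc : ContinuousOn F (Ici 0))
    (hG : IsInterferenceFactor G) (hGc : ContinuousOn (Function.uncurry G) (Ici 0 ×ˢ Ioi 0))
    (hR : 0 < R) (ha : 1 < a) {l lS : ℝ} (hl : 0 ≤ l) (hlS : 0 ≤ lS) :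
    Tendsto (fun n => discreteCoverage ((Iio R).indicator F) G R a n l lS) atTop
      (𝓝 (∫ y in innerDisc R, coverageDensity F G R a l lS ‖y‖)) := by
  have hfin : IsFiniteMeasure ((volume : Measure Plane).restrict (innerDisc R)) := by
    rw [innerDisc_eq_ring]; infer_instance
  simp_rw [discreteCoverage_eq hR ha]
  refine tendsto_integral_of_dominated_convergence (fun _ => l) (fun n => ?_)
    (integrable_const l) (fun n => ?_) ?_
  · have hf := (hF.indicator R).measurable
    have h1 := hG.measurable_roundedArea (innerDisc R) n
    have h2 := hG.measurable_roundedArea (outerAnnulus R a) n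
    have h3 : Measurable fun r : ℝ => l * (Iio R).indicator F r *
        Real.exp (-(l * roundedArea G (innerDisc R) n r) -
          lS * roundedArea G (outerAnnulus R a) n r) := by fun_prop
    exact (h3.comp ((measurable_roundUp n).comp measurable_norm)).aestronglyMeasurable
  · refine (ae_restrict_iff' (measurableSet_innerDisc R)).2 (ae_of_all _ fun y hy => ?_)
    have h := discreteCoverage_integrand_mem (a := a) hF hG hl hlS n (norm_nonneg y) (le_of_lt hy)
    rw [Real.norm_of_nonneg h.1]
    refine h.2.trans (mul_le_of_le_one_right hl (Real.exp_le_one_iff.2 (neg_nonpos.2 ?_)))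
    have := Real.pi_pos
    positivity
  · refine (ae_restrict_iff' (measurableSet_innerDisc R)).2 (ae_of_all _ fun y hy => ?_)
    have h1 := tendsto_indicator_roundUp hFc R (norm_nonneg y)
    rw [indicator_of_mem (show ‖y‖ ∈ Iio R from hy)] at h1
    have h2 := tendsto_roundedArea hG hGc (norm_nonneg y) 0 R
    have h3 := tendsto_roundedArea hG hGc (norm_nonneg y) R (a * R)
    rw [← innerDisc_eq_ring] at h2
    exact (h1.const_mul l).mul ((Real.continuous_exp.tendsto _).comp
      ((h2.const_mul l).neg.sub (h3.const_mul lS)))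

lemma measurable_discreteCoverage {Ω : Type*} [MeasurableSpace Ω] {lam lamS : Ω → ℝ}
    (h1 : Measurable lam) (h2 : Measurable lamS) (f : ℝ → ℝ) (n : ℕ) :
    Measurable fun ω => discreteCoverage f G R a n (lam ω) (lamS ω) := by
  unfold discreteCoverage regionMean
  fun_prop

lemma measurable_distanceSum {Ω : Type*} [MeasurableSpace Ω] {K : Ω → ℕ} {d : ℕ → Ω → ℝ}
    {f : ℝ → ℝ} (hK : Measurable K) (hd : ∀ i, Measurable (d i)) (hf : Measurable f)
    (hG : IsInterferenceFactor G) :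
    Measurable fun ω => distanceSum f G fun i : Fin (K ω) => d i ω := by
  have h : ∀ k : ℕ, Measurable fun ω => distanceSum f G fun i : Fin k => d i ω := by
    intro k
    unfold distanceSum
    refine Finset.measurable_fun_sum _ fun i _ => ?_
    refine (hf.comp (hd i)).mul (Finset.measurable_fun_prod _ fun j _ => ?_)
    exact measurable_const.sub (hG.measurable_screen.comp ((hd i).prodMk (hd j)))
  have h2 : Measurable fun q : ℕ × Ω => distanceSum f G fun i : Fin q.1 => d i q.2 :=
    measurable_from_prod_countable_right h
  exact h2.comp (hK.prodMk measurable_id)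

end Limits

/-! ### The coverage probability of a network -/

/-- The discretised sum over the stations, as a sum over the cells of products of functions of
the counts. -/
lemma distanceSum_roundUp_eq {R a : ℝ} {k : ℕ} {x : ℕ → Plane}
    (hx : ∀ i < k, ‖x i‖ < a * R) (f : ℝ → ℝ) (G : ℝ → ℝ → ℝ) (n : ℕ) :
    distanceSum f G (fun i : Fin k => roundUp n ‖x i‖) =
      ∑ p : Fin (cellNumber R a n), f (cellRadius n p) * ∏ l : Fin (cellNumber R a n),
        if l = p then ((stationCount k x (cell n l) : ℕ) : ℝ) *
          (1 - screen G (cellRadius n p) (cellRadius n l)) ^ (stationCount k x (cell n l) - 1)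
        else (1 - screen G (cellRadius n p) (cellRadius n l)) ^ (stationCount k x (cell n l)) := by
  classical
  set c : Fin k → Fin (cellNumber R a n) := fun i =>
    ⟨cellIndex n ‖x i‖, cellIndex_lt_cellNumber n (norm_nonneg _) (hx i i.2)⟩ with hc
  have hcard : ∀ l : Fin (cellNumber R a n),
      stationCount k x (cell n l) = (Finset.univ.filter fun i => c i = l).card := by
    intro l
    rw [stationCount_eq_card]
    congr 1
    ext i
    simp only [Finset.mem_filter, Finset.mem_univ, true_and, hc, Fin.ext_iff]
    rfl
  have h := distanceSum_cells f G n (cellNumber R a n) c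
  simp only [hcard]
  exact h

/-- The factor of the cell of a serving station: it is `1` if the station is alone in its cell, and
`0` otherwise. -/
lemma abs_natCast_mul_zero_pow_le (m : ℕ) : |(m : ℝ) * 0 ^ (m - 1)| ≤ 1 := by
  rcases m with _ | _ | m <;> simp

section Network

variable {Ω : Type*} [MeasurableSpace Ω] {P : Measure Ω} [IsProbabilityMeasure P]
  {ρ ν : Measure ℝ} {a H R ζ : ℝ} {lam lamS : Ω → ℝ} {K : Ω → ℕ} {X : ℕ → Ω → Plane}
  {g : ℕ → Ω → ℝ} {h : Ω → ℝ} {F : ℝ → ℝ} {G : ℝ → ℝ → ℝ}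

/-- The counts in the cells are independent Poisson variables given the densities, and each term
of `distanceSum_roundUp_eq` is a product of functions of these counts with values in `[0, 1]`. -/
lemma IsStableNetwork.integral_distanceSum_roundUp
    (hnet : IsStableNetwork P ρ ν a H R ζ lam lamS K X g h) (hR : 0 < R) (ha : 1 < a)
    (f : ℝ → ℝ) (hG : IsInterferenceFactor G) (n : ℕ) :
    ∫ ω, distanceSum f G (fun i : Fin (K ω) => roundUp n ‖X i ω‖) ∂P =
      ∫ ω, discreteCoverage f G R a n (lam ω) (lamS ω) ∂P := by
  set M := cellNumber R a n with hM
  set N : Ω → Fin M → ℕ := fun ω l => stationCount (K ω) (fun j => X j ω) (cell n l) with hN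
  set t : Ω → Fin M → ℝ := fun ω l => regionMean R a (lam ω) (lamS ω) (cell n l) with ht
  set s : Fin M → Fin M → ℝ := fun p l => screen G (cellRadius n p) (cellRadius n l) with hs
  have hs0 : ∀ p l, 0 ≤ s p l := fun p l =>
    hG.screen_nonneg (cellRadius_nonneg _ _) (cellRadius_nonneg _ _)
  have hs1 : ∀ p l, s p l ≤ 1 := fun p l =>
    hG.screen_le_one (cellRadius_nonneg _ _) (cellRadius_nonneg _ _)
  have hspp : ∀ p, s p p = 1 := fun p => by simp [hs, screen]
  have hNm : Measurable N := measurable_pi_lambda _ fun l =>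
    measurable_stationCount hnet.measurable_K hnet.measurable_X (measurableSet_cell n l)
  have htm : ∀ l, Measurable fun ω => t ω l := fun l => hnet.measurable_regionMean _
  have ht0 : ∀ᵐ ω ∂P, ∀ l, 0 ≤ t ω l := by
    filter_upwards [hnet.regionMean_nonneg] with ω hω l
    exact hω _
  have hlaw : ∀ m, P.real {ω | N ω = m} = ∫ ω, ∏ l, poissonWeight (t ω l) (m l) ∂P :=
    hnet.counts_law (fun l => measurableSet_cell n l) fun l l' hne =>
      disjoint_left.2 fun x h1 h2 => hne (Fin.ext (h1.symm.trans h2))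
  set w : Fin M → Fin M → ℕ → ℝ := fun p l m =>
    if l = p then (m : ℝ) * (1 - s p l) ^ (m - 1) else (1 - s p l) ^ m with hw
  have hw1 : ∀ p l m, |w p l m| ≤ 1 := by
    intro p l m
    simp only [hw]
    split_ifs with hlp
    · subst hlp
      rw [hspp, sub_self]
      exact abs_natCast_mul_zero_pow_le m
    · rw [abs_pow]
      refine pow_le_one₀ (abs_nonneg _) ?_
      rw [abs_le]
      constructor <;> linarith [hs0 p l, hs1 p l]
  set e : Fin M → Fin M → ℝ → ℝ := fun p l u =>
    (if l = p then u else 1) * Real.exp (-(u * s p l)) with he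
  have hsum : ∀ p l u, HasSum (fun m => poissonWeight u m * w p l m) (e p l u) := by
    intro p l u
    simp only [hw, he]
    split_ifs
    · simpa using hasSum_poissonWeight_mul_nat_mul_pow u (1 - s p l)
    · simpa using hasSum_poissonWeight_mul_pow u (1 - s p l)
  have hkey := fun p => integral_prod_of_mixed_poisson hNm htm ht0 hlaw (hw1 p) (hsum p)
  have hprod : ∀ p ω, ∏ l, e p l (t ω l) = t ω p * Real.exp (-∑ l, t ω l * s p l) := by
    intro p ω
    simp only [he]
    rw [Finset.prod_mul_distrib, Finset.prod_ite_eq' Finset.univ p (fun l => t ω l),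
      if_pos (Finset.mem_univ _), ← Finset.sum_neg_distrib, Real.exp_sum]
  simp only [hprod] at hkey
  have hL : ∀ᵐ ω ∂P, distanceSum f G (fun i : Fin (K ω) => roundUp n ‖X i ω‖) =
      ∑ p : Fin M, f (cellRadius n p) * ∏ l, w p l (N ω l) := by
    filter_upwards [hnet.ae_norm_mem hR ha] with ω hω
    exact distanceSum_roundUp_eq (x := fun j => X j ω) (fun i hi => (hω i hi).2) f G n
  rw [integral_congr_ae hL]
  unfold discreteCoverage
  rw [integral_finsetSum, integral_finsetSum]
  · refine Finset.sum_congr rfl fun p _ => ?_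
    rw [integral_const_mul, integral_const_mul, hkey p]
  · intro p _
    refine Integrable.const_mul (Integrable.mono' (integrable_const 1)
      (Measurable.aestronglyMeasurable ?_) ?_) _
    · exact (htm p).mul
        (Finset.measurable_fun_sum _ fun l _ => (htm l).mul_const (s p l)).neg.exp
    · filter_upwards [ht0] with ω hω
      rw [Real.norm_of_nonneg (mul_nonneg (hω p) (Real.exp_pos _).le)]
      have h1 : t ω p ≤ ∑ l, t ω l * s p l := by
        have := Finset.single_le_sum (f := fun l => t ω l * s p l)
          (fun l _ => mul_nonneg (hω l) (hs0 p l)) (Finset.mem_univ p)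
        simpa [hspp] using this
      have h2 := Real.add_one_le_exp (∑ l, t ω l * s p l)
      rw [Real.exp_neg, ← div_eq_mul_inv, div_le_one (Real.exp_pos _)]
      change t ω p ≤ _
      linarith
  · intro p _
    refine Integrable.const_mul (Integrable.mono' (integrable_const 1)
      (Measurable.aestronglyMeasurable ?_) (ae_of_all _ fun ω => ?_)) _
    · exact (Measurable.of_discrete (f := fun m : Fin M → ℕ => ∏ l, w p l (m l))).comp hNm
    · rw [Real.norm_eq_abs, Finset.abs_prod]
      exact Finset.prod_le_one (fun _ _ => abs_nonneg _) fun l _ => hw1 p l _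

/-- The mean over the network of the sum over the nearest station. -/
theorem IsStableNetwork.integral_nearestSum
    (hnet : IsStableNetwork P ρ ν a H R ζ lam lamS K X g h) (hR : 0 < R) (ha : 1 < a)
    (hF : IsDistanceFactor F) (hFc : ContinuousOn F (Ici 0)) (hG : IsInterferenceFactor G)
    (hGc : ContinuousOn (Function.uncurry G) (Ici 0 ×ˢ Ioi 0)) :
    ∫ ω, nearestSum F G R (fun i : Fin (K ω) => X i ω) ∂P =
      ∫ ω, ∫ y in innerDisc R, coverageDensity F G R a (lam ω) (lamS ω) ‖y‖ ∂volume ∂P := by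
  have hf := hF.indicator R
  have hl : Tendsto (fun n => ∫ ω, distanceSum ((Iio R).indicator F) G
      (fun i : Fin (K ω) => roundUp n ‖X i ω‖) ∂P) atTop
      (𝓝 (∫ ω, nearestSum F G R (fun i : Fin (K ω) => X i ω) ∂P)) := by
    refine tendsto_integral_of_dominated_convergence (fun _ => 1) (fun n => ?_)
      (integrable_const 1) (fun n => ae_of_all _ fun ω => ?_) ?_
    · exact (measurable_distanceSum (d := fun i ω => roundUp n ‖X i ω‖) hnet.measurable_K
        (fun i => (measurable_roundUp n).comp (hnet.measurable_X i).norm) hf.measurable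
        hG).aestronglyMeasurable
    · have := distanceSum_mem_Icc hf hG (d := fun i : Fin (K ω) => roundUp n ‖X i ω‖)
        fun i => roundUp_nonneg _ _
      rw [Real.norm_of_nonneg this.1]
      exact this.2
    · filter_upwards [hnet.ae_norm_mem hR ha] with ω hω
      rw [nearestSum_eq_distanceSum]
      exact tendsto_distanceSum_roundUp hFc hGc R fun i => (hω i i.2).1
  have hr : Tendsto (fun n => ∫ ω, discreteCoverage ((Iio R).indicator F) G R a n
      (lam ω) (lamS ω) ∂P) atTop
      (𝓝 (∫ ω, ∫ y in innerDisc R, coverageDensity F G R a (lam ω) (lamS ω) ‖y‖ ∂volume ∂P)) := by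
    refine tendsto_integral_of_dominated_convergence (fun _ => 1) (fun n => ?_)
      (integrable_const 1) (fun n => ?_) ?_
    · exact (measurable_discreteCoverage hnet.measurable_lam hnet.measurable_lamS _
        n).aestronglyMeasurable
    · filter_upwards [hnet.lam_nonneg, hnet.lamS_nonneg] with ω h1 h2
      have := discreteCoverage_mem_Icc hF hG hR ha h1 h2 n
      rw [Real.norm_of_nonneg this.1]
      exact this.2
    · filter_upwards [hnet.lam_nonneg, hnet.lamS_nonneg] with ω h1 h2
      exact tendsto_discreteCoverage hF hFc hG hGc hR ha h1 h2
  refine tendsto_nhds_unique hl (hr.congr fun n => ?_)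
  exact (hnet.integral_distanceSum_roundUp hR ha _ hG n).symm

lemma screenedArea_one_disc {r R : ℝ} (hr : 0 ≤ r) (hrR : r ≤ R) :
    screenedArea (fun _ _ => 1) (innerDisc R) r = Real.pi * r ^ 2 := by
  have h1 : screenedArea (fun _ _ => 1) (innerDisc R) r =
      ∫ y in innerDisc R, (Metric.closedBall (0 : Plane) r).indicator (fun _ => (1 : ℝ)) y := by
    refine integral_congr_ae (ae_of_all _ fun y => ?_)
    simp [screen, indicator]
  rw [h1, integral_indicator Metric.isClosed_closedBall.measurableSet,
    Measure.restrict_restrict Metric.isClosed_closedBall.measurableSet, setIntegral_const,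
    smul_eq_mul, mul_one, ← sub_zero (r ^ 2), ← zero_pow (M₀ := ℝ) two_ne_zero,
    ← volume_real_ring le_rfl hr]
  refine measureReal_congr ?_
  have h0 : ∀ᵐ y : Plane, ‖y‖ ≠ r := ae_iff.2 (by simpa using volume_norm_eq r)
  filter_upwards [h0] with y hy
  refine propext ⟨fun hm => ?_, fun hm => ?_⟩
  · exact ⟨norm_nonneg y, lt_of_le_of_ne (by simpa using hm.1) hy⟩
  · exact ⟨by simpa using hm.2.le, lt_of_lt_of_le hm.2 hrR⟩

/-- Almost surely the nearest station of the disc is unique: with the constant factors `1` the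
mean of `nearestSum` is the probability that a strictly nearest station exists, and it equals the
probability that the disc contains a station. -/
lemma IsStableNetwork.ae_nearest_unique
    (hnet : IsStableNetwork P ρ ν a H R ζ lam lamS K X g h) (hR : 0 < R) (ha : 1 < a) :
    ∀ᵐ ω ∂P, ∀ i : Fin (K ω), X i ω ∈ innerDisc R → (∀ j : Fin (K ω), ‖X i ω‖ ≤ ‖X j ω‖) →
      ∀ j : Fin (K ω), j ≠ i → ‖X i ω‖ < ‖X j ω‖ := by
  classical
  have hRa : R < a * R := by nlinarith
  have h1 := hnet.integral_nearestSum hR ha isDistanceFactor_one continuousOn_const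
    isInterferenceFactor_one (F := fun _ => 1) (G := fun _ _ => 1) continuousOn_const
  have hin : ∀ l lS : ℝ, ∫ y in innerDisc R,
      coverageDensity (fun _ => 1) (fun _ _ => 1) R a l lS ‖y‖ =
      1 - Real.exp (-(l * (Real.pi * R ^ 2))) := by
    intro l lS
    rw [← setIntegral_innerDisc_mul_exp hR]
    refine setIntegral_congr_fun (measurableSet_innerDisc R) fun y hy => ?_
    have hyR : ‖y‖ < R := hy
    have hS : screenedArea (fun _ _ => 1) (outerAnnulus R a) ‖y‖ = 0 := by
      refine setIntegral_eq_zero_of_forall_eq_zero fun z hz => ?_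
      simp [screen, hyR.trans_le hz.1]
    simp only [coverageDensity]
    rw [screenedArea_one_disc (norm_nonneg y) hyR.le, hS]
    simp
  simp only [hin] at h1
  -- the probability that the disc is empty
  have hvol : volume.real (innerDisc R) = Real.pi * R ^ 2 := by
    rw [innerDisc_eq_ring, volume_real_ring le_rfl hR.le]; ring
  have hdisj : innerDisc R ∩ outerAnnulus R a = ∅ := by
    ext y
    simp only [mem_inter_iff, mem_empty_iff_false, iff_false, not_and]
    exact fun h1 h2 => lt_irrefl R (h2.1.trans_lt h1)
  have hempty := hnet.counts_law (k := 1) (B := fun _ => innerDisc R)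
    (fun _ => measurableSet_innerDisc R) (fun i j hij => absurd (Subsingleton.elim i j) hij)
    (fun _ => 0)
  have hpw : ∀ ω, ∏ i : Fin 1, poissonWeight (regionMean R a (lam ω) (lamS ω) (innerDisc R)) 0 =
      Real.exp (-(lam ω * (Real.pi * R ^ 2))) := by
    intro ω
    simp [regionMean, poissonWeight, hvol, hdisj]
  simp only [hpw] at hempty
  set E : Set Ω :=
    {ω | (fun _ : Fin 1 => stationCount (K ω) (fun j => X j ω) (innerDisc R)) = fun _ => 0} with hE
  have hEm : MeasurableSet E :=
    measurableSet_eq_fun (measurable_pi_lambda _ fun i =>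
      measurable_stationCount hnet.measurable_K hnet.measurable_X (measurableSet_innerDisc R))
      measurable_const
  have hEmem : ∀ ω, ω ∈ E ↔ ∀ i : Fin (K ω), X i ω ∉ innerDisc R := by
    intro ω
    have : ω ∈ E ↔ stationCount (K ω) (fun j => X j ω) (innerDisc R) = 0 :=
      ⟨fun h => congrFun h 0, fun h => funext fun _ => h⟩
    rw [this, stationCount, Finset.card_eq_zero, Finset.filter_eq_empty_iff]
    exact ⟨fun h i => h (Finset.mem_range.2 i.2), fun h i hi => h ⟨i, Finset.mem_range.1 hi⟩⟩
  have hexpint : Integrable (fun ω => Real.exp (-(lam ω * (Real.pi * R ^ 2)))) P := by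
    refine Integrable.mono' (integrable_const 1)
      (hnet.measurable_lam.mul_const _).neg.exp.aestronglyMeasurable ?_
    filter_upwards [hnet.lam_nonneg] with ω hω
    rw [Real.norm_of_nonneg (Real.exp_pos _).le]
    have := Real.pi_pos
    exact Real.exp_le_one_iff.2 (neg_nonpos.2 (by positivity))
  rw [integral_sub (integrable_const 1) hexpint, ← hempty, integral_const, probReal_univ,
    one_smul, ← probReal_compl_eq_one_sub hEm, ← integral_indicator_one hEm.compl] at h1
  -- the two indicators agree almost surely
  have hnm : Measurable fun ω => nearestSum (fun _ => 1) (fun _ _ => 1) R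
      fun i : Fin (K ω) => X i ω := by
    simp_rw [nearestSum_eq_distanceSum]
    exact measurable_distanceSum (d := fun i ω => ‖X i ω‖) hnet.measurable_K
      (fun i => (hnet.measurable_X i).norm) (isDistanceFactor_one.indicator R).measurable
      isInterferenceFactor_one
  have hmem : ∀ ω, nearestSum (fun _ => 1) (fun _ _ => 1) R (fun i : Fin (K ω) => X i ω) ∈
      Icc (0 : ℝ) 1 := fun ω => by
    rw [nearestSum_eq_distanceSum]
    exact distanceSum_mem_Icc (isDistanceFactor_one.indicator R) isInterferenceFactor_one
      fun i => norm_nonneg _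
  have hle : ∀ ω, nearestSum (fun _ => 1) (fun _ _ => 1) R (fun i : Fin (K ω) => X i ω) ≤
      Eᶜ.indicator (1 : Ω → ℝ) ω := by
    intro ω
    by_cases hω : ω ∈ E
    · rw [nearestSum_eq_zero fun i _ => (hEmem ω).1 hω i]
      simp [hω]
    · rw [indicator_of_mem (by simpa using hω)]
      exact (hmem ω).2
  have hint : Integrable (fun ω => nearestSum (fun _ => 1) (fun _ _ => 1) R
      fun i : Fin (K ω) => X i ω) P :=
    Integrable.mono' (integrable_const 1) hnm.aestronglyMeasurable (ae_of_all _ fun ω => by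
      rw [Real.norm_of_nonneg (hmem ω).1]; exact (hmem ω).2)
  have hae := (integral_eq_iff_of_ae_le hint ((integrable_const (1 : ℝ)).indicator hEm.compl)
    (ae_of_all _ hle)).1 h1
  filter_upwards [hae] with ω hω i hi hnear j hj
  have hωE : ω ∉ E := fun h => (hEmem ω).1 h i hi
  have hpos : nearestSum (fun _ => 1) (fun _ _ => 1) R (fun i : Fin (K ω) => X i ω) ≠ 0 := by
    rw [hω, indicator_of_mem (by simpa using hωE)]
    simp
  have hex : ∃ i' : Fin (K ω), ∀ j', j' ≠ i' → ‖X i' ω‖ < ‖X j' ω‖ := by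
    by_contra hc
    push Not at hc
    refine hpos (nearestSum_eq_zero fun i' hi' => ?_)
    obtain ⟨j', hj', hlt⟩ := hc i'
    exact absurd (hi' j' hj') (not_lt.2 hlt)
  obtain ⟨i', hi'⟩ := hex
  have : i = i' := by
    by_contra hne
    exact absurd (hi' i hne) (not_lt.2 (hnear i'))
  exact hi' j (this ▸ hj) |> fun h => this ▸ h

end Network

lemma measurableSet_covered_sequences (R δ N₀ T : ℝ) :
    MeasurableSet {q : (ℕ × (ℕ → Plane)) × (ℕ → ℝ) × ℝ |
      Covered R δ N₀ T (fun i : Fin q.1.1 => q.1.2 i) (fun i : Fin q.1.1 => q.2.1 i) q.2.2} := by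
  have hset : {q : (ℕ × (ℕ → Plane)) × (ℕ → ℝ) × ℝ |
      Covered R δ N₀ T (fun i : Fin q.1.1 => q.1.2 i) (fun i : Fin q.1.1 => q.2.1 i) q.2.2} =
      ⋃ k : ℕ, {q | q.1.1 = k} ∩ {q | Covered R δ N₀ T (fun i : Fin k => q.1.2 i)
        (fun i : Fin k => q.2.1 i) q.2.2} := by
    ext ⟨⟨k, x⟩, g, h⟩
    simp only [mem_iUnion, mem_inter_iff, mem_ofPred_eq]
    constructor
    · exact fun hc => ⟨k, rfl, hc⟩
    · rintro ⟨k', rfl, hc⟩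
      exact hc
  rw [hset]
  refine MeasurableSet.iUnion fun k => MeasurableSet.inter ?_ ?_
  · exact measurableSet_eq_fun measurable_fst.fst measurable_const
  · have hx : Measurable fun q : (ℕ × (ℕ → Plane)) × (ℕ → ℝ) × ℝ => fun i : Fin k => q.1.2 i :=
      measurable_pi_lambda _ fun i => (measurable_pi_apply (i : ℕ)).comp measurable_fst.snd
    have hg : Measurable fun q : (ℕ × (ℕ → Plane)) × (ℕ → ℝ) × ℝ => fun i : Fin k => q.2.1 i :=
      measurable_pi_lambda _ fun i => (measurable_pi_apply (i : ℕ)).comp measurable_snd.fst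
    have h2 : Measurable fun q : (ℕ × (ℕ → Plane)) × (ℕ → ℝ) × ℝ => q.2.2 := measurable_snd.snd
    have hm := hx.prodMk (hg.prodMk h2)
    exact hm (measurableSet_covered (ι := Fin k) R δ N₀ T)

section Network

variable {Ω : Type*} [MeasurableSpace Ω] {P : Measure Ω} [IsProbabilityMeasure P]
  {ρ ν : Measure ℝ} {a H R ζ : ℝ} {lam lamS : Ω → ℝ} {K : Ω → ℕ} {X : ℕ → Ω → Plane}
  {g : ℕ → Ω → ℝ} {h : Ω → ℝ}

/-- Only the fadings of the stations that are present matter. -/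
lemma IsStableNetwork.coverage_of_sequence
    (hnet : IsStableNetwork P ρ ν a H R ζ lam lamS K X g h) [IsProbabilityMeasure ν]
    (hζ : 0 < ζ) (δ N₀ T : ℝ) (k : ℕ) (x : ℕ → Plane) :
    ((P.map fun ω i => g i ω).prod (expMeasure ζ)).real
        {p | Covered R δ N₀ T (fun i : Fin k => x i) (fun i : Fin k => p.1 i) p.2} =
      ((Measure.pi fun _ : Fin k => ν).prod (expMeasure ζ)).real
        {p | Covered R δ N₀ T (fun i : Fin k => x i) p.1 p.2} := by
  have := isProbabilityMeasure_expMeasure hζ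
  have hgm : Measurable fun ω i => g i ω := measurable_pi_lambda _ hnet.measurable_g
  have := Measure.isProbabilityMeasure_map (μ := P) hgm.aemeasurable
  have hrm : Measurable fun (q : ℕ → ℝ) (i : Fin k) => q i :=
    measurable_pi_lambda _ fun i => measurable_pi_apply (i : ℕ)
  have hlaw : (P.map fun ω i => g i ω).map (fun q (i : Fin k) => q i) =
      Measure.pi fun _ : Fin k => ν := by
    rw [Measure.map_map hrm hgm]
    have hind : iIndepFun (fun i : Fin k => g i) P := hnet.indep_g.precomp Fin.val_injective
    have h1 := (iIndepFun_iff_map_fun_eq_pi_map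
      fun i : Fin k => (hnet.measurable_g i).aemeasurable).1 hind
    simp only [hnet.law_g] at h1
    exact h1
  have hmeas : MeasurableSet {p : (Fin k → ℝ) × ℝ |
      Covered R δ N₀ T (fun i : Fin k => x i) p.1 p.2} :=
    measurable_prodMk_left (x := fun i : Fin k => x i)
      (measurableSet_covered (ι := Fin k) R δ N₀ T)
  have hmap := Measure.map_prod_map (P.map fun ω i => g i ω) (expMeasure ζ) hrm measurable_id
  rw [hlaw, Measure.map_id] at hmap
  rw [hmap, map_measureReal_apply (hrm.prodMap measurable_id) hmeas]
  rfl

/-- The coverage probability of a network, after averaging over the fadings. -/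
theorem IsStableNetwork.coverage_eq_integral
    (hnet : IsStableNetwork P ρ ν a H R ζ lam lamS K X g h) (hR : 0 < R) (ha : 1 < a) {δ N₀ T : ℝ}
    (hζ : 0 < ζ) (hT : 0 < T) (hN : 0 ≤ N₀) [IsProbabilityMeasure ν] (hν : ∀ᵐ g ∂ν, 0 ≤ g) :
    P.real {ω | Covered R δ N₀ T (fun i : Fin (K ω) => X i ω) (fun i : Fin (K ω) => g i ω)
        (h ω)} =
      ∫ ω, nearestSum (noiseFactor (ζ * T) δ N₀) (linkFactor ν δ (ζ * T)) R
        (fun i : Fin (K ω) => X i ω) ∂P := by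
  have := isProbabilityMeasure_expMeasure hζ
  have hgm : Measurable fun ω i => g i ω := measurable_pi_lambda _ hnet.measurable_g
  have := Measure.isProbabilityMeasure_map (μ := P) hgm.aemeasurable
  have hYm : Measurable fun ω => (K ω, fun i => X i ω) :=
    hnet.measurable_K.prodMk (measurable_pi_lambda _ hnet.measurable_X)
  have hZm : Measurable fun ω => ((fun i => g i ω : ℕ → ℝ), h ω) := hgm.prodMk hnet.measurable_h
  have hYZ : IndepFun (fun ω => (K ω, fun i => X i ω)) (fun ω => ((fun i => g i ω : ℕ → ℝ), h ω))
      P := by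
    have hq : Measurable fun q : ℝ × ℝ × ℕ × (ℕ → Plane) => q.2.2 := measurable_snd.snd
    exact hnet.indep_fading.comp hq measurable_id
  have hmap := (indepFun_iff_map_prod_eq_prod_map_map hYm.aemeasurable hZm.aemeasurable).1 hYZ
  have hZ := (indepFun_iff_map_prod_eq_prod_map_map hgm.aemeasurable
    hnet.measurable_h.aemeasurable).1 hnet.indep_g_h
  rw [hnet.law_h] at hZ
  rw [hZ] at hmap
  have hS := measurableSet_covered_sequences R δ N₀ T
  have h1 := map_measureReal_apply (μ := P) (hYm.prodMk hZm) hS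
  have := Measure.isProbabilityMeasure_map (μ := P) hYm.aemeasurable
  have hsm : Measurable fun y => ((P.map fun ω i => g i ω).prod (expMeasure ζ)).real
      (Prod.mk y ⁻¹' {q : (ℕ × (ℕ → Plane)) × (ℕ → ℝ) × ℝ |
        Covered R δ N₀ T (fun i : Fin q.1.1 => q.1.2 i) (fun i : Fin q.1.1 => q.2.1 i) q.2.2}) :=
    (measurable_measure_prodMk_left hS).ennreal_toReal
  rw [hmap, measureReal_prod_eq hS, integral_map hYm.aemeasurable hsm.aestronglyMeasurable] at h1
  refine h1.symm.trans (integral_congr_ae ?_)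
  filter_upwards [hnet.ae_norm_mem hR ha, hnet.ae_nearest_unique hR ha] with ω h2 h3
  refine (hnet.coverage_of_sequence hζ δ N₀ T (K ω) fun i => X i ω).trans ?_
  exact coverage_of_positions hζ hT hN hν (fun i => norm_pos_iff.1 (h2 i i.2).1) h3

end Network

/-! ### Averaging over the stable densities -/

lemma continuousOn_noiseFactor {q δ : ℝ} (hδ : 0 ≤ δ) (N₀ : ℝ) :
    ContinuousOn (noiseFactor q δ N₀) (Ici 0) := by
  have h : ContinuousOn (fun r : ℝ => r ^ δ) (Ici 0) :=
    (Real.continuous_rpow_const hδ).continuousOn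
  exact Real.continuous_exp.comp_continuousOn
    ((continuousOn_const.mul h).mul continuousOn_const).neg

lemma continuousOn_linkFactor {ν : Measure ℝ} [IsProbabilityMeasure ν] (hν : ∀ᵐ g ∂ν, 0 ≤ g)
    {q δ : ℝ} (hδ : 0 ≤ δ) (hq : 0 ≤ q) :
    ContinuousOn (Function.uncurry (linkFactor ν δ q)) (Ici 0 ×ˢ Ioi 0) := by
  have h : ContinuousOn (fun p : ℝ × ℝ => q * p.1 ^ δ * p.2 ^ (-δ)) (Ici 0 ×ˢ Ioi 0) := by
    refine ContinuousOn.mul (continuousOn_const.mul ?_) ?_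
    · exact ((Real.continuous_rpow_const hδ).comp continuous_fst).continuousOn
    · exact continuousOn_snd.rpow_const fun p hp => Or.inl (ne_of_gt hp.2)
  refine (continuousOn_fadingLaplace hν).comp h fun p hp => ?_
  have h1 : 0 ≤ p.1 := hp.1
  have h2 : 0 < p.2 := hp.2
  exact mem_Ici.2 (by positivity)

/-- The contribution of a serving station at distance `r` to the conditional coverage
probability, in polar coordinates. -/
noncomputable def radialCoverage (F : ℝ → ℝ) (G : ℝ → ℝ → ℝ) (R a : ℝ) (p : ℝ × ℝ) (r : ℝ) : ℝ :=
  2 * Real.pi * (r * coverageDensity F G R a p.1 p.2 r)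

lemma conditionalCoverage_eq {a R δ ζ T N₀ : ℝ} {ν : Measure ℝ} [IsProbabilityMeasure ν]
    (ha : 1 < a) (hR : 0 < R) (hζ : 0 < ζ) (hT : 0 < T) (hN : 0 ≤ N₀) (hν : ∀ᵐ g ∂ν, 0 ≤ g)
    (p : ℝ × ℝ) :
    conditionalCoverage a R δ ζ T N₀ ν p.1 p.2 =
      ∫ r in Ioo 0 R,
        radialCoverage (noiseFactor (ζ * T) δ N₀) (linkFactor ν δ (ζ * T)) R a p r := by
  rw [conditionalCoverage, (hasSum_coverageTerm ha hR hζ hT hN hν p.1 p.2).tsum_eq,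
    innerDisc_eq_ring, setIntegral_ring le_rfl]
  simp only [radialCoverage, integral_const_mul]

section

variable {F : ℝ → ℝ} {G : ℝ → ℝ → ℝ} {R a : ℝ}

lemma measurable_radialCoverage (hF : IsDistanceFactor F) (hG : IsInterferenceFactor G) :
    Measurable (Function.uncurry (radialCoverage F G R a)) := by
  have h1 := (hG.measurable_screenedArea (innerDisc R)).comp
    (measurable_snd : Measurable fun z : (ℝ × ℝ) × ℝ => z.2)
  have h2 := (hG.measurable_screenedArea (outerAnnulus R a)).comp
    (measurable_snd : Measurable fun z : (ℝ × ℝ) × ℝ => z.2)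
  have h3 := hF.measurable.comp (measurable_snd : Measurable fun z : (ℝ × ℝ) × ℝ => z.2)
  have hl : Measurable fun z : (ℝ × ℝ) × ℝ => z.1.1 := measurable_fst.fst
  have hlS : Measurable fun z : (ℝ × ℝ) × ℝ => z.1.2 := measurable_fst.snd
  exact (measurable_snd.mul ((hl.mul h3).mul
    ((hl.mul h1).neg.sub (hlS.mul h2)).exp)).const_mul (2 * Real.pi)

/-- A bound with integrable right-hand side. The screened area lies between `π r²` and `π R²`; the
lower bound matters for `p.1 ≥ 0`, the upper one for `p.1 ≤ 0`. -/
lemma abs_radialCoverage_le (hF : IsDistanceFactor F) (hG : IsInterferenceFactor G)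
    (p : ℝ × ℝ) {r : ℝ} (hr : r ∈ Ioo 0 R) :
    |radialCoverage F G R a p r| ≤
      (2 * Real.pi * R * |p.1 * Real.exp (-(Real.pi * R ^ 2 * p.1))|
        + |p.1| * (2 * Real.pi * (r * Real.exp (-(p.1 * (Real.pi * r ^ 2))))))
      * (1 + Real.exp (-(volume.real (outerAnnulus R a) * p.2))) := by
  obtain ⟨l, lS⟩ := p
  have hr0 : 0 ≤ r := hr.1.le
  have hR : 0 ≤ R := hr0.trans hr.2.le
  have hD1 := hG.le_screenedArea hr0 hr.2.le
  have hD1' := hG.screenedArea_le hr0 0 R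
  rw [volume_real_ring le_rfl hR, ← innerDisc_eq_ring] at hD1'
  have hD2 := hG.screenedArea_nonneg hr0 (outerAnnulus R a)
  have hD2' := hG.screenedArea_le hr0 R (a * R)
  rw [← outerAnnulus_eq_ring] at hD2'
  set D1 := screenedArea G (innerDisc R) r
  set D2 := screenedArea G (outerAnnulus R a) r
  set V := volume.real (outerAnnulus R a)
  have hpi := Real.pi_pos
  have e2 : Real.exp (-(lS * D2)) ≤ 1 + Real.exp (-(V * lS)) := by
    rcases le_total 0 lS with h | h
    · have : Real.exp (-(lS * D2)) ≤ 1 := Real.exp_le_one_iff.2 (by nlinarith)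
      linarith [Real.exp_pos (-(V * lS))]
    · have : Real.exp (-(lS * D2)) ≤ Real.exp (-(V * lS)) := Real.exp_le_exp.2 (by nlinarith)
      linarith
  -- the first summand is used for `l ≤ 0`, the second one for `l ≥ 0`
  have e1 : r * Real.exp (-(l * D1)) ≤
      R * Real.exp (-(Real.pi * R ^ 2 * l)) + r * Real.exp (-(l * (Real.pi * r ^ 2))) := by
    rcases le_total 0 l with h | h
    · have : Real.exp (-(l * D1)) ≤ Real.exp (-(l * (Real.pi * r ^ 2))) :=
        Real.exp_le_exp.2 (by nlinarith)
      have h2 : 0 ≤ R * Real.exp (-(Real.pi * R ^ 2 * l)) := by positivity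
      nlinarith
    · have : Real.exp (-(l * D1)) ≤ Real.exp (-(Real.pi * R ^ 2 * l)) :=
        Real.exp_le_exp.2 (by nlinarith)
      have h2 : 0 ≤ r * Real.exp (-(l * (Real.pi * r ^ 2))) := by positivity
      have h3 : r * Real.exp (-(l * D1)) ≤ R * Real.exp (-(Real.pi * R ^ 2 * l)) :=
        mul_le_mul hr.2.le this (Real.exp_pos _).le hR
      linarith
  have e3 : |radialCoverage F G R a (l, lS) r| =
      2 * Real.pi * |l| * F r * ((r * Real.exp (-(l * D1))) * Real.exp (-(lS * D2))) := by
    simp only [radialCoverage, coverageDensity, abs_mul, Real.abs_exp, abs_of_pos hpi, abs_two,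
      abs_of_nonneg hr0, abs_of_nonneg (hF.nonneg r hr0)]
    rw [sub_eq_add_neg, Real.exp_add]
    ring
  rw [e3, abs_mul, Real.abs_exp]
  have hFr := hF.le_one r hr0
  calc 2 * Real.pi * |l| * F r * ((r * Real.exp (-(l * D1))) * Real.exp (-(lS * D2)))
      ≤ 2 * Real.pi * |l| * 1 * ((R * Real.exp (-(Real.pi * R ^ 2 * l))
          + r * Real.exp (-(l * (Real.pi * r ^ 2)))) * (1 + Real.exp (-(V * lS)))) := by
        gcongr
    _ = _ := by ring

lemma integrableOn_mul_exp_neg_sq (l : ℝ) :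
    IntegrableOn (fun r => 2 * Real.pi * (r * Real.exp (-(l * (Real.pi * r ^ 2))))) (Ioo 0 R) :=
  (Continuous.integrableOn_Icc (by fun_prop)).mono_set Ioo_subset_Icc_self

/-- The factor `|l|` is absorbed by the integration over `r`. -/
lemma abs_mul_setIntegral_mul_exp_neg_sq_le (hR : 0 < R) (l : ℝ) :
    |l| * ∫ r in Ioo 0 R, 2 * Real.pi * (r * Real.exp (-(l * (Real.pi * r ^ 2)))) ≤
      1 + Real.exp (-(Real.pi * R ^ 2 * l)) := by
  have h := setIntegral_innerDisc_mul_exp hR l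
  rw [innerDisc_eq_ring,
    setIntegral_ring le_rfl fun y => l * Real.exp (-(l * (Real.pi * y ^ 2)))] at h
  have h0 : 0 ≤ ∫ r in Ioo 0 R, 2 * Real.pi * (r * Real.exp (-(l * (Real.pi * r ^ 2)))) :=
    setIntegral_nonneg measurableSet_Ioo fun r hr => by
      have := hr.1.le
      positivity
  rw [← abs_of_nonneg h0, ← abs_mul, ← integral_const_mul]
  rw [← integral_const_mul] at h
  have h2 : ∫ r in Ioo 0 R, l * (2 * Real.pi * (r * Real.exp (-(l * (Real.pi * r ^ 2))))) =
      1 - Real.exp (-(l * (Real.pi * R ^ 2))) := by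
    rw [← h]
    refine integral_congr_ae (ae_of_all _ fun r => ?_)
    simp only
    ring
  rw [h2, mul_comm (Real.pi * R ^ 2) l, abs_le]
  constructor <;> linarith [Real.exp_pos (-(l * (Real.pi * R ^ 2)))]

lemma isProbabilityMeasure_densityLaw (ρ : Measure ℝ) [IsProbabilityMeasure ρ] (a H : ℝ) :
    IsProbabilityMeasure (densityLaw ρ a H) := by
  have := Measure.isProbabilityMeasure_map (μ := ρ)
    (measurable_const_mul (a ^ (H - 2))).aemeasurable
  rw [densityLaw]
  infer_instance

section Stable

variable {α σ μ H : ℝ} {ρ : Measure ℝ}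

lemma IsStableLaw.integrable_densityLaw (hα₀ : 0 < α) (hα₂ : α ≤ 2)
    (hρ : IsStableLaw α 1 σ μ ρ) (ha : 0 < a) {f : ℝ → ℝ} (hf : Integrable f ρ) {t : ℝ}
    (ht : 0 ≤ t) :
    Integrable (fun p : ℝ × ℝ => f p.1 * Real.exp (-(t * p.2))) (densityLaw ρ a H) := by
  have := hρ.isProbabilityMeasure
  have hm : Measurable fun x : ℝ => a ^ (H - 2) * x := measurable_const_mul _
  have hc : 0 < a ^ (H - 2) := Real.rpow_pos_of_pos ha _
  have := Measure.isProbabilityMeasure_map (μ := ρ) hm.aemeasurable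
  refine Integrable.mul_prod (g := fun x => Real.exp (-(t * x))) hf ?_
  refine (integrable_map_measure (by fun_prop) hm.aemeasurable).2 ?_
  refine (hρ.laplace hα₀ hα₂ (t := t * a ^ (H - 2)) (by positivity)).1.congr
    (ae_of_all _ fun x => ?_)
  simp only [Function.comp_def]
  ring_nf

lemma IsStableLaw.integral_densityLaw (hα₀ : 0 < α) (hα₂ : α ≤ 2)
    (hρ : IsStableLaw α 1 σ μ ρ) (ha : 0 < a) {s t : ℝ} (hs : 0 < s) (ht : 0 ≤ t) :
    ∫ p, p.1 * Real.exp (-(s * p.1)) * Real.exp (-(t * p.2)) ∂(densityLaw ρ a H) =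
      stableLaplace α σ μ s * stableSlope α σ μ s * stableLaplace α σ μ (a ^ (H - 2) * t) := by
  have := hρ.isProbabilityMeasure
  have hm : Measurable fun x : ℝ => a ^ (H - 2) * x := measurable_const_mul _
  have hc : 0 < a ^ (H - 2) := Real.rpow_pos_of_pos ha _
  have := Measure.isProbabilityMeasure_map (μ := ρ) hm.aemeasurable
  rw [densityLaw, integral_prod_mul (fun x => x * Real.exp (-(s * x)))
    fun x => Real.exp (-(t * x)), integral_map hm.aemeasurable (by fun_prop),
    ← (hρ.laplace hα₀ hα₂ (t := a ^ (H - 2) * t) (by positivity)).2,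
    ← (hρ.integral_mul_exp hα₀ hα₂ hs).2]
  congr 1
  · simp only [neg_mul]
  · refine integral_congr_ae (ae_of_all _ fun x => ?_)
    simp only
    ring_nf

theorem IsStableLaw.integrable_radialCoverage (hα₀ : 0 < α) (hα₂ : α ≤ 2)
    (hρ : IsStableLaw α 1 σ μ ρ) (ha : 0 < a) (hR : 0 < R)
    (hF : IsDistanceFactor F) (hG : IsInterferenceFactor G) :
    Integrable (Function.uncurry (radialCoverage F G R a))
      ((densityLaw ρ a H).prod (volume.restrict (Ioo 0 R))) := by
  have := hρ.isProbabilityMeasure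
  have hpi := Real.pi_pos
  have := isProbabilityMeasure_densityLaw ρ a H
  set V := volume.real (outerAnnulus R a)
  have hV : 0 ≤ V := measureReal_nonneg
  have hK := measurable_radialCoverage (R := R) (a := a) hF hG
  have hbound : ∀ p : ℝ × ℝ, Integrable (fun r =>
      (2 * Real.pi * R * |p.1 * Real.exp (-(Real.pi * R ^ 2 * p.1))|
        + |p.1| * (2 * Real.pi * (r * Real.exp (-(p.1 * (Real.pi * r ^ 2))))))
      * (1 + Real.exp (-(V * p.2)))) (volume.restrict (Ioo 0 R)) := fun p =>
    ((integrable_const _).add ((integrableOn_mul_exp_neg_sq p.1).const_mul _)).mul_const _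
  have hsec : ∀ p : ℝ × ℝ, Integrable (radialCoverage F G R a p) (volume.restrict (Ioo 0 R)) :=
    fun p => (hbound p).mono' (hK.of_uncurry_left.aestronglyMeasurable)
      ((ae_restrict_mem measurableSet_Ioo).mono fun r hr => abs_radialCoverage_le hF hG p hr)
  refine (integrable_prod_iff hK.aestronglyMeasurable).2 ⟨ae_of_all _ hsec, ?_⟩
  have hf : Integrable (fun l => R * (2 * Real.pi * R * |l * Real.exp (-(Real.pi * R ^ 2) * l)|)
      + (1 + Real.exp (-(Real.pi * R ^ 2) * l))) ρ :=
    (((hρ.integral_mul_exp hα₀ hα₂ (by positivity)).1.abs.const_mul _).const_mul _).add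
      ((integrable_const _).add (hρ.laplace hα₀ hα₂ (by positivity)).1)
  have h0 := hρ.integrable_densityLaw (H := H) hα₀ hα₂ ha hf le_rfl
  have h1 := hρ.integrable_densityLaw (H := H) hα₀ hα₂ ha hf hV
  refine (h0.add h1).mono' hK.norm.stronglyMeasurable.integral_prod_right.aestronglyMeasurable
    (ae_of_all _ fun p => ?_)
  rw [Real.norm_of_nonneg (integral_nonneg fun _ => norm_nonneg _)]
  refine (integral_mono_ae (hsec p).norm (hbound p)
    ((ae_restrict_mem measurableSet_Ioo).mono fun r hr =>
      abs_radialCoverage_le hF hG p hr)).trans ?_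
  rw [integral_mul_const, integral_add (integrable_const _)
    ((integrableOn_mul_exp_neg_sq p.1).const_mul _), setIntegral_const, integral_const_mul,
    Real.volume_real_Ioo_of_le hR.le, sub_zero, smul_eq_mul]
  have h2 := abs_mul_setIntegral_mul_exp_neg_sq_le hR p.1
  have h3 := Real.exp_pos (-(V * p.2))
  simp only [Pi.add_apply, zero_mul, neg_zero, Real.exp_zero, mul_one, neg_mul]
  rw [← mul_one_add]
  gcongr

lemma IsStableLaw.integral_radialCoverage (hα₀ : 0 < α) (hα₂ : α ≤ 2)
    (hρ : IsStableLaw α 1 σ μ ρ) (ha : 0 < a) (hG : IsInterferenceFactor G) {r : ℝ}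
    (hr : r ∈ Ioo 0 R) :
    ∫ p, radialCoverage F G R a p r ∂(densityLaw ρ a H) =
      2 * Real.pi * r * F r * (stableLaplace α σ μ (screenedArea G (innerDisc R) r)
        * stableSlope α σ μ (screenedArea G (innerDisc R) r)
        * stableLaplace α σ μ (a ^ (H - 2) * screenedArea G (outerAnnulus R a) r)) := by
  have hpos : 0 < screenedArea G (innerDisc R) r := by
    have h1 := hr.1
    have := hG.le_screenedArea hr.1.le hr.2.le
    have : 0 < Real.pi * r ^ 2 := by positivity
    linarith
  rw [← hρ.integral_densityLaw hα₀ hα₂ ha hpos (hG.screenedArea_nonneg hr.1.le _),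
    ← integral_const_mul]
  refine integral_congr_ae (ae_of_all _ fun p => ?_)
  simp only [radialCoverage, coverageDensity]
  rw [sub_eq_add_neg, Real.exp_add]
  ring_nf

end Stable

end

/-- The coverage integrand, in terms of the Laplace transform of the stable law. -/
lemma IsStableLaw.integral_radialCoverage_eq_bsXi {α σ μ H R a δ q N₀ r : ℝ} {ρ ν : Measure ℝ}
    (hα₀ : 0 < α) (hα₂ : α ≤ 2) (hρ : IsStableLaw α 1 σ μ ρ) [IsProbabilityMeasure ν]
    (hν : ∀ᵐ g ∂ν, 0 ≤ g) (ha : 1 < a) (hδ : 0 < δ) (hq : 0 < q) (hr : r ∈ Ioo 0 R) :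
    ∫ p, radialCoverage (noiseFactor q δ N₀) (linkFactor ν δ q) R a p r ∂(densityLaw ρ a H) =
      2 * Real.pi * r * Real.exp (-(q * r ^ δ * N₀)) *
        (stableLaplace α σ μ (bsXi ν δ (q * r ^ δ) r R + Real.pi * r ^ 2)
          * stableSlope α σ μ (bsXi ν δ (q * r ^ δ) r R + Real.pi * r ^ 2)
          * stableLaplace α σ μ (a ^ (H - 2) * bsXi ν δ (q * r ^ δ) R (a * R))) := by
  rw [hρ.integral_radialCoverage hα₀ hα₂ (by linarith)
    (isInterferenceFactor_linkFactor hν δ hq.le) hr, screenedArea_disc hν hδ hq hr.1 hr.2,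
    screenedArea_annulus hν hδ hq hr.1 hr.2 ha.le, noiseFactor]

lemma coverageIntegrand_eq {α σ μ a H R δ ζ T N₀ r : ℝ} {ν : Measure ℝ} (hα : α ≠ 1)
    (ha : 0 < a) (hXi : 0 ≤ bsXi ν δ (ζ * T * r ^ δ) R (a * R)) :
    coverageIntegrand α σ μ a H R δ ζ T N₀ ν r =
      2 * Real.pi * r * Real.exp (-(ζ * T * r ^ δ * N₀)) *
        (stableLaplace α σ μ (bsXi ν δ (ζ * T * r ^ δ) r R + Real.pi * r ^ 2)
          * stableSlope α σ μ (bsXi ν δ (ζ * T * r ^ δ) r R + Real.pi * r ^ 2)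
          * stableLaplace α σ μ (a ^ (H - 2) * bsXi ν δ (ζ * T * r ^ δ) R (a * R))) := by
  have hpow : (a ^ (H - 2) * bsXi ν δ (ζ * T * r ^ δ) R (a * R)) ^ α =
      a ^ (α * (H - 2)) * bsXi ν δ (ζ * T * r ^ δ) R (a * R) ^ α := by
    rw [Real.mul_rpow (Real.rpow_nonneg ha.le _) hXi, ← Real.rpow_mul ha.le, mul_comm α]
  simp only [coverageIntegrand, stableLaplace, stableSlope, if_neg hα, hpow]
  generalize bsXi ν δ (ζ * T * r ^ δ) R (a * R) = Ξo
  generalize bsXi ν δ (ζ * T * r ^ δ) r R = Ξi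
  have hexp : -(σ ^ α * a ^ (α * (H - 2)) / Real.cos (Real.pi * α / 2)) * Ξo ^ α
      - a ^ (H - 2) * μ * Ξo - μ * Ξi
      - σ ^ α / Real.cos (Real.pi * α / 2) * (Ξi + Real.pi * r ^ 2) ^ α
      - μ * Real.pi * r ^ 2 - ζ * T * r ^ δ * N₀ =
      -(ζ * T * r ^ δ * N₀)
      + (-(σ ^ α / Real.cos (Real.pi * α / 2)) * (Ξi + Real.pi * r ^ 2) ^ α
        - μ * (Ξi + Real.pi * r ^ 2))
      + (-(σ ^ α / Real.cos (Real.pi * α / 2)) * (a ^ (α * (H - 2)) * Ξo ^ α)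
        - μ * (a ^ (H - 2) * Ξo)) := by ring
  rw [hexp, Real.exp_add, Real.exp_add]
  ring

lemma coverageIntegrandOne_eq {σ μ a H R δ ζ T N₀ r : ℝ} {ν : Measure ℝ} (ha : 0 < a) :
    coverageIntegrandOne σ μ a H R δ ζ T N₀ ν r =
      2 * Real.pi * r * Real.exp (-(ζ * T * r ^ δ * N₀)) *
        (stableLaplace 1 σ μ (bsXi ν δ (ζ * T * r ^ δ) r R + Real.pi * r ^ 2)
          * stableSlope 1 σ μ (bsXi ν δ (ζ * T * r ^ δ) r R + Real.pi * r ^ 2)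
          * stableLaplace 1 σ μ (a ^ (H - 2) * bsXi ν δ (ζ * T * r ^ δ) R (a * R))) := by
  simp only [coverageIntegrandOne, stableLaplace, stableSlope, if_true]
  generalize bsXi ν δ (ζ * T * r ^ δ) R (a * R) = Ξo
  generalize bsXi ν δ (ζ * T * r ^ δ) r R = Ξi
  -- at `Ξo = 0` both sides vanish, whatever the value of `log 0`
  have hlog : a ^ (H - 2) * Ξo * Real.log (a ^ (H - 2) * Ξo) =
      a ^ (H - 2) * Ξo * (Real.log Ξo + (H - 2) * Real.log a) := by
    rcases eq_or_ne Ξo 0 with h | h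
    · simp [h]
    · rw [Real.log_mul (Real.rpow_pos_of_pos ha _).ne' h, Real.log_rpow ha]
      ring
  have hexp : (2 * σ * a ^ (H - 2) / Real.pi * (Real.log Ξo + (H - 2) * Real.log a)
        - a ^ (H - 2) * μ) * Ξo
      + (2 * σ * Ξi + 2 * σ * Real.pi * r ^ 2) / Real.pi * Real.log (Ξi + Real.pi * r ^ 2)
      - μ * Ξi - μ * Real.pi * r ^ 2 - ζ * T * r ^ δ * N₀ =
      -(ζ * T * r ^ δ * N₀)
      + (2 * σ / Real.pi * ((Ξi + Real.pi * r ^ 2) * Real.log (Ξi + Real.pi * r ^ 2))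
        - μ * (Ξi + Real.pi * r ^ 2))
      + (2 * σ / Real.pi * (a ^ (H - 2) * Ξo * Real.log (a ^ (H - 2) * Ξo))
        - μ * (a ^ (H - 2) * Ξo)) := by
    rw [hlog]
    ring
  rw [hexp, Real.exp_add, Real.exp_add]
  ring

lemma IsStableNetwork.map_densities {Ω : Type*} [MeasurableSpace Ω] {P : Measure Ω}
    [IsProbabilityMeasure P] {ρ ν : Measure ℝ} {a H R ζ : ℝ} {lam lamS : Ω → ℝ} {K : Ω → ℕ}
    {X : ℕ → Ω → Plane} {g : ℕ → Ω → ℝ} {h : Ω → ℝ}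
    (hnet : IsStableNetwork P ρ ν a H R ζ lam lamS K X g h) :
    P.map (fun ω => (lam ω, lamS ω)) = densityLaw ρ a H := by
  rw [(indepFun_iff_map_prod_eq_prod_map_map hnet.measurable_lam.aemeasurable
    hnet.measurable_lamS.aemeasurable).1 hnet.indep_lam_lamS, hnet.law_lamS, densityLaw,
    ← hnet.law_lam, Measure.map_map (measurable_const_mul _) hnet.measurable_lam]
  rfl

theorem mainTheorem1 {α σ μ a H R δ ζ T N₀ : ℝ} {ρ ν : Measure ℝ}
    (hα₀ : 0 < α) (hα₂ : α ≤ 2) (hσ : 0 ≤ σ) (ha : 1 < a) (hH₀ : 0 ≤ H) (hH₁ : H < 1)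
    (hR : 0 < R) (hδ : 2 ≤ δ) (hζ : 0 < ζ) (hT : 0 < T) (hN : 0 ≤ N₀)
    (hρ : IsStableLaw α 1 σ μ ρ) [IsProbabilityMeasure ν] (hν : ∀ᵐ g ∂ν, 0 ≤ g) :
    -- the coverage probability of every realization of the network
    (∀ {Ω : Type*} [MeasurableSpace Ω] (P : Measure Ω) [IsProbabilityMeasure P]
        (lam lamS : Ω → ℝ) (K : Ω → ℕ) (X : ℕ → Ω → Plane) (g : ℕ → Ω → ℝ) (h : Ω → ℝ),
        IsStableNetwork P ρ ν a H R ζ lam lamS K X g h →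
        P.real {ω | Covered R δ N₀ T (fun i : Fin (K ω) => X i ω) (fun i : Fin (K ω) => g i ω)
            (h ω)} = coverageProbability ρ ν a H R δ ζ T N₀) ∧
    -- the mixture converges absolutely, for densities of either sign
    (∀ l lS : ℝ, Summable (coverageTerm a R δ ζ T N₀ ν l lS)) ∧
    Integrable (fun p : ℝ × ℝ => conditionalCoverage a R δ ζ T N₀ ν p.1 p.2)
      (densityLaw ρ a H) ∧
    -- the formula for `α ≠ 1`
    (α ≠ 1 →
      IntegrableOn (coverageIntegrand α σ μ a H R δ ζ T N₀ ν) (Ioo 0 R) ∧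
      coverageProbability ρ ν a H R δ ζ T N₀ =
        ∫ r in Ioo 0 R, coverageIntegrand α σ μ a H R δ ζ T N₀ ν r) ∧
    -- the formula for `α = 1`
    (α = 1 →
      IntegrableOn (coverageIntegrandOne σ μ a H R δ ζ T N₀ ν) (Ioo 0 R) ∧
      coverageProbability ρ ν a H R δ ζ T N₀ =
        ∫ r in Ioo 0 R, coverageIntegrandOne σ μ a H R δ ζ T N₀ ν r) := by
  have := hρ.isProbabilityMeasure
  have := isProbabilityMeasure_densityLaw ρ a H
  have ha0 : 0 < a := by linarith
  have hδ0 : 0 < δ := by linarith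
  have hq : 0 < ζ * T := by positivity
  have hF := isDistanceFactor_noiseFactor (δ := δ) hq.le hN
  have hG := isInterferenceFactor_linkFactor hν δ hq.le
  have hint := hρ.integrable_radialCoverage (H := H) hα₀ hα₂ ha0 hR hF hG
  have hcond := conditionalCoverage_eq (δ := δ) (ν := ν) ha hR hζ hT hN hν
  have hc : Integrable (fun p : ℝ × ℝ => conditionalCoverage a R δ ζ T N₀ ν p.1 p.2)
      (densityLaw ρ a H) :=
    hint.integral_prod_left.congr (ae_of_all _ fun p => (hcond p).symm)
  -- Fubini reduces both formulas to a pointwise identity of integrands.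
  have key : ∀ f : ℝ → ℝ, (∀ r ∈ Ioo 0 R, f r = ∫ p, radialCoverage (noiseFactor (ζ * T) δ N₀)
        (linkFactor ν δ (ζ * T)) R a p r ∂(densityLaw ρ a H)) →
      IntegrableOn f (Ioo 0 R) ∧
        coverageProbability ρ ν a H R δ ζ T N₀ = ∫ r in Ioo 0 R, f r := by
    intro f hf
    constructor
    · exact hint.integral_prod_right.congr
        ((ae_restrict_mem measurableSet_Ioo).mono fun r hr => (hf r hr).symm)
    · rw [coverageProbability, setIntegral_congr_fun measurableSet_Ioo hf,
        ← integral_integral_swap hint]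
      exact integral_congr_ae (ae_of_all _ hcond)
  refine ⟨?_, fun l lS => (hasSum_coverageTerm ha hR hζ hT hN hν l lS).summable, hc,
    fun hα => key _ fun r hr => ?_, fun hα => key _ fun r hr => ?_⟩
  · intro Ω _ P _ lam lamS K X g h hnet
    have hlaw := hnet.map_densities
    have hm := hnet.measurable_lam.prodMk hnet.measurable_lamS
    rw [hnet.coverage_eq_integral hR ha hζ hT hN hν, hnet.integral_nearestSum hR ha hF
      (continuousOn_noiseFactor hδ0.le N₀) hG (continuousOn_linkFactor hν hδ0.le hq.le),
      coverageProbability, ← hlaw, integral_map hm.aemeasurable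
        (hlaw ▸ hc.aestronglyMeasurable)]
    refine integral_congr_ae (ae_of_all _ fun ω => ?_)
    exact (hasSum_coverageTerm ha hR hζ hT hN hν (lam ω) (lamS ω)).tsum_eq.symm
  · rw [hρ.integral_radialCoverage_eq_bsXi hα₀ hα₂ hν ha hδ0 hq hr]
    refine coverageIntegrand_eq hα ha0 ?_
    rw [← screenedArea_annulus hν hδ0 hq hr.1 hr.2 ha.le]
    exact hG.screenedArea_nonneg hr.1.le _
  · rw [hρ.integral_radialCoverage_eq_bsXi hα₀ hα₂ hν ha hδ0 hq hr, hα]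
    exact coverageIntegrandOne_eq ha0
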